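/- Let $\mathsf T$ be a category with a subcanonical Grothendieck topology. "Stack" means a category fibered in groupoids over $\mathsf T$ with effective descent, morphisms of stacks are functors over $\mathsf T$, and 2-morphisms are natural transformations over $\mathsf T$. Let $G$ be a sheaf of groups on $\mathsf T$ and $\mathcal X$ a stack. Let $\mathrm{Map}(G,\mathcal X)$ be the mapping stack, with $\mathrm{Map}(G,\mathcal X)(T)=\mathrm{Hom}(G\times T,\mathcal X)$. The group $G$ acts on it strictly from the left by $(g\cdot f)(a,t)=f(ag,t)$. Let $\lfloor G\backslash\mathrm{Map}(G,\mathcal X)\rfloor$ be the prestack of transformation groupoids: it has the same objects, and an arrow $f\to f'$ over $T$ is a pair $(\gamma,g)$ with $g\in G(T)$ and $\gamma\colon f\Rightarrow g\cdot f'$; arrows compose by $(\gamma,g)(\delta,h)=(\gamma\,(g\cdot\delta),gh)$. Let $[G\backslash\mathrm{Map}(G,\mathcal X)]$ be its stackification, $\iota\colon\lfloor G\backslash\mathrm{Map}(G,\mathcal X)\rfloor\to[G\backslash\mathrm{Map}(G,\mathcal X)]$ the unit, and $q\colon\mathrm{Map}(G,\mathcal X)\to[G\backslash\mathrm{Map}(G,\mathcal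 X)]$ the projection. Let $\mathrm{Prinu}_{G,\mathcal X}$ be the category fibered in groupoids over $\mathsf T$ whose objects over $T$ are the pairs $(P,\chi)$ of a left $G$-torsor $P\to T$ and an arbitrary morphism $\chi\colon P\to\mathcal X$, and whose arrows $(P,\chi)\to(P',\chi')$ are the pairs $(u,\phi)$ of a map of $G$-torsors $u\colon P\to P'$ and a 2-morphism $\phi\colon\chi\Rightarrow\chi'\circ u$. Let $p\colon\mathrm{Map}(G,\mathcal X)\to\mathrm{Prinu}_{G,\mathcal X}$ send $f\colon G\times T\to\mathcal X$ to $(G\times T,f)$, where $G\times T$ is the trivial torsor. Let $\Phi_0\colon\lfloor G\backslash\mathrm{Map}(G,\mathcal X)\rfloor\to\mathrm{Prinu}_{G,\mathcal X}$ be its extension which sends an arrow $(\gamma,g)$ over $T$ to $(\rho_g,\gamma)$, where $\rho_g(a,t)=(ag,t)$. Then $[G\backslash\mathrm{Map}(G,\mathcal X)]$ and $\mathrm{Prinu}_{G,\mathcal X}$ are stacks, and there is an equivalence of stacks $$\Phi\colon[G\backslash\mathrm{Map}(G,\mathcal X)]\xrightarrow{\ \sim\ }\mathrm{Prinu}_{G,\mathcal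 X}$$ with a 2-isomorphism $\tau\colon\Phi\circ\iota\cong\Phi_0$, and hence with a 2-isomorphism $\sigma\colon\Phi\circ q\cong p$, the restriction of $\tau$ to $\mathrm{Map}(G,\mathcal X)$. The pair $(\Phi,\tau)$ is unique up to a unique 2-isomorphism: for every morphism of stacks $\Phi'\colon[G\backslash\mathrm{Map}(G,\mathcal X)]\to\mathrm{Prinu}_{G,\mathcal X}$ with a 2-isomorphism $\tau'\colon\Phi'\circ\iota\cong\Phi_0$ there is exactly one 2-isomorphism $\theta\colon\Phi\cong\Phi'$ with $\tau'\circ(\theta\iota)=\tau$. In particular, over the category of topological spaces with open covers and for $G=S^1$, the same holds for the loop stack $L\mathcal X=\mathrm{Map}(S^1,\mathcal X)$ of every stack $\mathcal X$: the stack $[S^1\backslash L\mathcal X]$ is canonically equivalent, compatibly with the morphisms from $L\mathcal X$, to the stack $\mathrm{Prinu}_{S^1,\mathcal X}$ of unparametrized loops in $\mathcal X$. -/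

import Mathlib

open CategoryTheory Opposite

universe v₃ u₃ v₂ u₂ v u

namespace UnparametrizedTorsor

variable {C : Type u} [Category.{v} C]

/-- A presheaf of sets `A`, regarded as a category fibered in sets over `C` (its category of
elements): an object over `S` is an element of `A(S)`. For a representable presheaf this is the
fibered category which the object of `C` represents. -/
def elts (A : Cᵒᵖ ⥤ Type v) : BasedCategory.{v, max u v} C :=
  BasedCategory.ofFunctor (CategoryOfElements.π A).leftOp

/-- The morphism of fibered categories induced by a map of presheaves. -/
def eltsMap {A B : Cᵒᵖ ⥤ Type v} (a : A ⟶ B) : elts A ⥤ᵇ elts B where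
  toFunctor := (CategoryOfElements.map a).op
  w := rfl

/-- `𝒳 → C` is a category fibered in groupoids: it is fibered, and every arrow is cartesian. -/
structure IsFiberedInGroupoids (𝒳 : BasedCategory.{v₂, u₂} C) : Prop where
  isFibered : 𝒳.p.IsFibered
  isCartesian : ∀ {a b : 𝒳.obj} (φ : a ⟶ b), 𝒳.p.IsCartesian (𝒳.p.map φ) φ

/-- Restriction `Hom(B, 𝒳) ⥤ Hom(A, 𝒳)` along a map of presheaves `a : A ⟶ B`. The categories
`Hom` consist of functors over `C` and natural transformations over `C`. -/
def precomp {A B : Cᵒᵖ ⥤ Type v} (a : A ⟶ B) (𝒳 : BasedCategory.{v₂, u₂} C) :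
    (elts B ⥤ᵇ 𝒳) ⥤ (elts A ⥤ᵇ 𝒳) where
  obj F := (eltsMap a).comp F
  map α := BasedCategory.whiskerLeft (eltsMap a) α

/-- `𝒳` is a stack over the site `(C, J)`: it is fibered in groupoids and has effective descent,
that is, for every covering sieve `R` of `S` the restriction `Hom(S, 𝒳) ⥤ Hom(R, 𝒳)` is an
equivalence of categories. An object of `Hom(R, 𝒳)` is a descent datum along `R`. -/
structure IsStack (J : GrothendieckTopology C) (𝒳 : BasedCategory.{v₂, u₂} C) : Prop where
  fibered : IsFiberedInGroupoids 𝒳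
  descent : ∀ (S : C) (R : Sieve S), R ∈ J S → (precomp R.functorInclusion 𝒳).IsEquivalence

/-- A morphism of stacks is an equivalence if it has a quasi-inverse over `C`. -/
def IsEquivalence {𝒳 : BasedCategory.{v₂, u₂} C} {𝒴 : BasedCategory.{v₃, u₃} C}
    (F : 𝒳 ⥤ᵇ 𝒴) : Prop :=
  ∃ F' : 𝒴 ⥤ᵇ 𝒳, Nonempty (F.comp F' ≅ BasedFunctor.id 𝒳) ∧
    Nonempty (F'.comp F ≅ BasedFunctor.id 𝒴)

/-- A presheaf of sets over `𝒳`, that is a pair `(P, χ : P → 𝒳)`. -/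
structure Probe (𝒳 : BasedCategory.{v₂, u₂} C) where
  psh : Cᵒᵖ ⥤ Type v
  map : elts psh ⥤ᵇ 𝒳

/-- An arrow `(P, χ) → (P', χ')`: a map `u : P → P'` and a 2-morphism `γ : χ ⇒ χ' ∘ u`. -/
@[ext]
structure Probe.Hom {𝒳 : BasedCategory.{v₂, u₂} C} (X Y : Probe 𝒳) where
  u : X.psh ⟶ Y.psh
  γ : X.map ⟶ (eltsMap u).comp Y.map

section Probe

variable {𝒳 : BasedCategory.{v₂, u₂} C}

instance : Category (Probe 𝒳) where
  Hom := Probe.Hom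
  id X := ⟨𝟙 _, 𝟙 X.map⟩
  comp φ ψ := ⟨φ.u ≫ ψ.u, φ.γ ≫ BasedCategory.whiskerLeft (eltsMap φ.u) ψ.γ⟩
  id_comp φ := by
    refine Probe.Hom.ext rfl (heq_of_eq ?_)
    apply BasedNatTrans.homCategory.ext; ext e
    exact Category.id_comp _
  comp_id φ := by
    refine Probe.Hom.ext rfl (heq_of_eq ?_)
    apply BasedNatTrans.homCategory.ext; ext e
    exact Category.comp_id _
  assoc φ ψ χ := by
    refine Probe.Hom.ext rfl (heq_of_eq ?_)
    apply BasedNatTrans.homCategory.ext; ext e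
    exact Category.assoc _ _ _

lemma Probe.comp_u {X Y Z : Probe 𝒳} (φ : X ⟶ Y) (ψ : Y ⟶ Z) : (φ ≫ ψ).u = φ.u ≫ ψ.u := rfl

lemma Probe.id_u (X : Probe 𝒳) : Probe.Hom.u (𝟙 X) = 𝟙 X.psh := rfl

lemma isIso_of_isFiberedInGroupoids (h : IsFiberedInGroupoids 𝒳) {a b : 𝒳.obj} {S : C}
    (φ : a ⟶ b) [𝒳.p.IsHomLift (𝟙 S) φ] : IsIso φ := by
  have := h.isFibered
  have := h.isCartesian φ
  have hi : IsIso (𝒳.p.map φ) := by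
    rw [IsHomLift.fac' 𝒳.p (𝟙 S) φ]; infer_instance
  exact Functor.IsStronglyCartesian.isIso_of_base_isIso 𝒳.p (𝒳.p.map φ) φ

lemma isIso_basedNatTrans (h : IsFiberedInGroupoids 𝒳) {𝒲 : BasedCategory.{v₃, u₃} C}
    {F F' : 𝒲 ⥤ᵇ 𝒳} (α : F ⟶ F') : IsIso α := by
  have h1 : ∀ a, IsIso (α.toNatTrans.app a) := fun a =>
    isIso_of_isFiberedInGroupoids h (S := 𝒲.p.obj a) _
  have : IsIso (C := 𝒲.obj ⥤ 𝒳.obj) (X := F.toFunctor) α.toNatTrans :=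
    NatIso.isIso_of_isIso_app _
  exact BasedNatIso.isIso_of_toNatTrans_isIso α

/-- Every arrow of `Probe 𝒳` is cartesian over the underlying map of presheaves. -/
lemma Probe.existsUnique_lift (h : IsFiberedInGroupoids 𝒳) {X Y Z : Probe 𝒳} (φ : X ⟶ Y)
    (φ' : Z ⟶ Y) (w : Z.psh ⟶ X.psh) (hw : w ≫ φ.u = φ'.u) :
    ∃! ψ : Z ⟶ X, ψ.u = w ∧ ψ ≫ φ = φ' := by
  obtain ⟨u', γ'⟩ := φ'
  obtain ⟨u, γ⟩ := φ
  dsimp only at hw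
  subst hw
  have := isIso_basedNatTrans h γ
  have hγ : IsIso (BasedCategory.whiskerLeft (eltsMap w) γ) := isIso_basedNatTrans h _
  obtain ⟨β, hβ, hβ'⟩ := hγ
  let δ : Z.map ⟶ (eltsMap w).comp ((eltsMap u).comp Y.map) := γ'
  refine ⟨⟨w, δ ≫ β⟩, ⟨rfl, ?_⟩, ?_⟩
  · refine Probe.Hom.ext rfl (heq_of_eq ?_)
    exact (Category.assoc _ _ _).trans ((congrArg (δ ≫ ·) hβ').trans (Category.comp_id δ))
  · rintro ⟨w', ε⟩ ⟨h1, h2⟩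
    dsimp only at h1
    subst h1
    have h3 : (⟨w' ≫ u, ε ≫ BasedCategory.whiskerLeft (eltsMap w') γ⟩ : Probe.Hom Z Y) =
      ⟨w' ≫ u, δ⟩ := h2
    injection h3 with _ h3
    refine Probe.Hom.ext rfl (heq_of_eq ?_)
    exact ((Category.comp_id ε).symm.trans (congrArg (ε ≫ ·) hβ.symm)).trans
      ((Category.assoc _ _ _).symm.trans (congrArg (· ≫ β) h3))

end Probe

section Map

/-- `id × t : Y × T ⟶ Y × T'`. -/
def prodMap (Y : Cᵒᵖ ⥤ Type v) {T T' : C} (t : T ⟶ T') :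
    FunctorToTypes.prod Y (yoneda.obj T) ⟶ FunctorToTypes.prod Y (yoneda.obj T') :=
  FunctorToTypes.prod.lift FunctorToTypes.prod.fst (FunctorToTypes.prod.snd ≫ yoneda.map t)

lemma prodMap_id (Y : Cᵒᵖ ⥤ Type v) (T : C) : prodMap Y (𝟙 T) = 𝟙 _ := by
  refine NatTrans.ext (funext fun S => ConcreteCategory.hom_ext _ _ fun x => ?_)
  exact Prod.ext rfl (Category.comp_id _)

lemma prodMap_comp (Y : Cᵒᵖ ⥤ Type v) {T T' T'' : C} (t : T ⟶ T') (t' : T' ⟶ T'') :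
    prodMap Y (t ≫ t') = prodMap Y t ≫ prodMap Y t' := by
  refine NatTrans.ext (funext fun S => ConcreteCategory.hom_ext _ _ fun x => ?_)
  exact Prod.ext rfl (Category.assoc _ _ _).symm

/-- An object of the mapping stack `Map(Y, 𝒳)` over `T = base` is a morphism `Y × T → 𝒳`. -/
structure MapObj (Y : Cᵒᵖ ⥤ Type v) (𝒳 : BasedCategory.{v₂, u₂} C) where
  base : C
  map : elts (FunctorToTypes.prod Y (yoneda.obj base)) ⥤ᵇ 𝒳

variable {Y : Cᵒᵖ ⥤ Type v} {𝒳 : BasedCategory.{v₂, u₂} C}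

/-- The pair `(Y × T, f)`. -/
abbrev MapObj.probe (X : MapObj Y 𝒳) : Probe 𝒳 := ⟨_, X.map⟩

/-- An arrow `f → f'` of `Map(Y, 𝒳)` over `t : T → T'` is a 2-morphism `f ⇒ f' ∘ (id × t)`. -/
@[ext]
structure MapObj.Hom (X X' : MapObj Y 𝒳) where
  base : X.base ⟶ X'.base
  hom : X.probe ⟶ X'.probe
  hom_u : hom.u = prodMap Y base

instance : Category (MapObj Y 𝒳) where
  Hom := MapObj.Hom
  id X := ⟨𝟙 _, 𝟙 _, (prodMap_id Y X.base).symm⟩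
  comp φ ψ := ⟨φ.base ≫ ψ.base, φ.hom ≫ ψ.hom, by
    rw [Probe.comp_u, φ.hom_u, ψ.hom_u]; exact (prodMap_comp Y _ _).symm⟩
  id_comp φ := MapObj.Hom.ext (Category.id_comp _) (Category.id_comp _)
  comp_id φ := MapObj.Hom.ext (Category.comp_id _) (Category.comp_id _)
  assoc φ ψ χ := MapObj.Hom.ext (Category.assoc _ _ _) (Category.assoc _ _ _)

end Map

/-- The mapping stack `Map(Y, 𝒳)`, with `Map(Y, 𝒳)(T) = Hom(Y × T, 𝒳)`. -/
def mapStack (Y : Cᵒᵖ ⥤ Type v) (𝒳 : BasedCategory.{v₂, u₂} C) : BasedCategory C where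
  obj := MapObj Y 𝒳
  p := { obj := fun X => X.base, map := fun φ => MapObj.Hom.base φ }

section Quot

/-- The underlying presheaf of sets of a presheaf of groups. -/
abbrev groupSet (G : Cᵒᵖ ⥤ GrpCat.{v}) : Cᵒᵖ ⥤ Type v := G ⋙ forget GrpCat.{v}

/-- The presheaf `G × T`. -/
abbrev trivPsh (G : Cᵒᵖ ⥤ GrpCat.{v}) (T : C) : Cᵒᵖ ⥤ Type v :=
  FunctorToTypes.prod (groupSet G) (yoneda.obj T)

/-- The map `G × T → G × T`, `(a, t) ↦ (a g(t), t)`, for `g ∈ G(T)`. -/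
def rightMul (G : Cᵒᵖ ⥤ GrpCat.{v}) {T : C} (g : G.obj (op T)) : trivPsh G T ⟶ trivPsh G T where
  app S := ↾fun x => (HMul.hMul (α := G.obj S) x.1 (G.map (Quiver.Hom.op x.2) g), x.2)
  naturality S S' s := by
    refine ConcreteCategory.hom_ext (C := Type v) _ _ fun x => ?_
    refine Prod.ext ?_ rfl
    change HMul.hMul (α := G.obj S') (G.map s x.1) (G.map (Quiver.Hom.op (s.unop ≫ x.2)) g) =
      G.map s (HMul.hMul (α := G.obj S) x.1 (G.map (Quiver.Hom.op x.2) g))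
    rw [map_mul]; simp

lemma psh_hom_ext {A B : Cᵒᵖ ⥤ Type v} {a b : A ⟶ B}
    (h : ∀ (S : Cᵒᵖ) (x : A.obj S), a.app S x = b.app S x) : a = b :=
  NatTrans.ext (funext fun S => ConcreteCategory.hom_ext _ _ (h S))

lemma rightMul_one (G : Cᵒᵖ ⥤ GrpCat.{v}) (T : C) :
    rightMul G (1 : G.obj (op T)) = 𝟙 _ := by
  refine psh_hom_ext fun S x => Prod.ext ?_ rfl
  change HMul.hMul (α := G.obj S) x.1 (G.map (Quiver.Hom.op x.2) 1) = x.1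
  rw [map_one, mul_one]

lemma rightMul_mul (G : Cᵒᵖ ⥤ GrpCat.{v}) {T : C} (g h : G.obj (op T)) :
    rightMul G (g * h) = rightMul G g ≫ rightMul G h := by
  refine psh_hom_ext fun S x => Prod.ext ?_ rfl
  change HMul.hMul (α := G.obj S) x.1 (G.map (Quiver.Hom.op x.2) (g * h)) =
    (HMul.hMul (α := G.obj S) x.1 (G.map (Quiver.Hom.op x.2) g)) *
      G.map (Quiver.Hom.op x.2) h
  rw [map_mul, mul_assoc]

lemma prodMap_rightMul (G : Cᵒᵖ ⥤ GrpCat.{v}) {T T' : C} (t : T ⟶ T') (g : G.obj (op T')) :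
    prodMap (groupSet G) t ≫ rightMul G g =
      rightMul G (G.map t.op g) ≫ prodMap (groupSet G) t := by
  refine psh_hom_ext fun S x => Prod.ext ?_ rfl
  change HMul.hMul (α := G.obj S) x.1 (G.map (Quiver.Hom.op (x.2 ≫ t)) g) =
    HMul.hMul (α := G.obj S) x.1 (G.map (Quiver.Hom.op x.2) (G.map t.op g))
  simp

/-- The map `G × T → G × T'`, `(a, s) ↦ (a g(s), t(s))`. -/
def twist (G : Cᵒᵖ ⥤ GrpCat.{v}) {T T' : C} (g : G.obj (op T)) (t : T ⟶ T') :
    trivPsh G T ⟶ trivPsh G T' :=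
  rightMul G g ≫ prodMap (groupSet G) t

lemma twist_one (G : Cᵒᵖ ⥤ GrpCat.{v}) {T T' : C} (t : T ⟶ T') :
    twist G 1 t = prodMap (groupSet G) t := by
  rw [twist, rightMul_one, Category.id_comp]

lemma twist_one_id (G : Cᵒᵖ ⥤ GrpCat.{v}) (T : C) : twist G 1 (𝟙 T) = 𝟙 _ := by
  rw [twist_one, prodMap_id]

lemma twist_comp (G : Cᵒᵖ ⥤ GrpCat.{v}) {T T' T'' : C} (g : G.obj (op T)) (t : T ⟶ T')
    (g' : G.obj (op T')) (t' : T' ⟶ T'') :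
    twist G g t ≫ twist G g' t' = twist G (g * G.map t.op g') (t ≫ t') := by
  have h := prodMap_rightMul G t g'
  simp only [twist, rightMul_mul, prodMap_comp, Category.assoc]
  rw [reassoc_of% h]

variable {G : Cᵒᵖ ⥤ GrpCat.{v}} {𝒳 : BasedCategory.{v₂, u₂} C}

/-- The strict left action of `g ∈ G(T)` on `Map(G, 𝒳)(T)`: `(g · f)(a, t) = f(a g, t)`. -/
def act {T : C} (g : G.obj (op T)) (f : elts (trivPsh G T) ⥤ᵇ 𝒳) : elts (trivPsh G T) ⥤ᵇ 𝒳 :=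
  (eltsMap (rightMul G g)).comp f

/-- The action is strict: `1 · f = f`. -/
lemma one_act {T : C} (f : elts (trivPsh G T) ⥤ᵇ 𝒳) : act (1 : G.obj (op T)) f = f := by
  rw [act, rightMul_one]; rfl

/-- The action is strict: `(g h) · f = g · (h · f)`. -/
lemma mul_act {T : C} (g h : G.obj (op T)) (f : elts (trivPsh G T) ⥤ᵇ 𝒳) :
    act (g * h) f = act g (act h f) := by
  rw [act, rightMul_mul]; rfl

/-- The objects of the transformation prestack `⌊G\Map(G, 𝒳)⌋`: those of `Map(G, 𝒳)`. -/
structure QuotObj (G : Cᵒᵖ ⥤ GrpCat.{v}) (𝒳 : BasedCategory.{v₂, u₂} C) where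
  pt : MapObj (groupSet G) 𝒳

/-- An arrow `f → f'` of `⌊G\Map(G, 𝒳)⌋` over `t : T → T'` is a pair `(g, γ)` of an element
`g ∈ G(T)` and an arrow `γ : f ⇒ g · t^* f'` of `Map(G, 𝒳)(T)`. Here `g · t^* f'` is `f'` composed
with `(a, s) ↦ (a g(s), t(s))`, so that `γ` is an arrow of pairs over that map. Arrows compose by
`(γ, g) (δ, h) = (γ (g · δ), g h)`, over `t = id`. -/
@[ext]
structure QuotObj.Hom (X X' : QuotObj G 𝒳) where
  base : X.pt.base ⟶ X'.pt.base
  elt : G.obj (op X.pt.base)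
  hom : X.pt.probe ⟶ X'.pt.probe
  hom_u : hom.u = twist G elt base

instance : Category (QuotObj G 𝒳) where
  Hom := QuotObj.Hom
  id X := ⟨𝟙 _, 1, 𝟙 _, (twist_one_id G _).symm⟩
  comp φ ψ := ⟨φ.base ≫ ψ.base, φ.elt * G.map φ.base.op ψ.elt, φ.hom ≫ ψ.hom, by
    rw [Probe.comp_u, φ.hom_u, ψ.hom_u]; exact twist_comp G _ _ _ _⟩
  id_comp φ := QuotObj.Hom.ext (Category.id_comp _) (by simp) (Category.id_comp _)
  comp_id φ := QuotObj.Hom.ext (Category.comp_id _) (by simp) (Category.comp_id _)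
  assoc φ ψ χ := QuotObj.Hom.ext (Category.assoc _ _ _) (by simp [mul_assoc])
    (Category.assoc _ _ _)

lemma QuotObj.existsUnique_lift (h : IsFiberedInGroupoids 𝒳) {Z X X' : QuotObj G 𝒳}
    (φ : QuotObj.Hom X X') (φ' : QuotObj.Hom Z X') (t : Z.pt.base ⟶ X.pt.base)
    (ht : t ≫ φ.base = φ'.base) :
    ∃! ψ : Z ⟶ X, QuotObj.Hom.base ψ = t ∧ ψ ≫ (φ : X ⟶ X') = φ' := by
  have hk : φ'.elt * (G.map t.op φ.elt)⁻¹ * G.map t.op φ.elt = φ'.elt := by simp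
  obtain ⟨ψ, ⟨hψ, hψ'⟩, huniq⟩ := Probe.existsUnique_lift h φ.hom φ'.hom
    (twist G (φ'.elt * (G.map t.op φ.elt)⁻¹) t) (by
      rw [φ.hom_u, φ'.hom_u, ← ht]
      exact (twist_comp G _ _ _ _).trans (by rw [hk]))
  refine ⟨⟨t, _, ψ, hψ⟩, ⟨rfl, QuotObj.Hom.ext ht hk hψ'⟩, ?_⟩
  rintro ⟨t', g, χ, hχ⟩ ⟨h1, h2⟩
  dsimp only at h1
  subst h1
  have h3 : g * G.map t'.op φ.elt = φ'.elt := congrArg (fun a : Z ⟶ X' => QuotObj.Hom.elt a) h2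
  have h4 : g = φ'.elt * (G.map t'.op φ.elt)⁻¹ := by rw [← h3]; simp
  subst h4
  exact QuotObj.Hom.ext rfl rfl
    (huniq χ ⟨hχ, congrArg (fun a : Z ⟶ X' => QuotObj.Hom.hom a) h2⟩)

end Quot

/-- The prestack `⌊G\Map(G, 𝒳)⌋` over `C` of transformation groupoids `[G(T)\Map(G, 𝒳)(T)]`. -/
def quotPrestack (G : Cᵒᵖ ⥤ GrpCat.{v}) (𝒳 : BasedCategory.{v₂, u₂} C) : BasedCategory C where
  obj := QuotObj G 𝒳
  p := { obj := fun X => X.pt.base, map := fun φ => QuotObj.Hom.base φ }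

/-- The projection `Map(G, 𝒳) → ⌊G\Map(G, 𝒳)⌋`, the identity on objects, with `γ ↦ (1, γ)`. -/
def quotProj (G : Cᵒᵖ ⥤ GrpCat.{v}) (𝒳 : BasedCategory.{v₂, u₂} C) :
    mapStack (groupSet G) 𝒳 ⥤ᵇ quotPrestack G 𝒳 where
  obj X := ⟨X⟩
  map φ := ⟨MapObj.Hom.base φ, 1, MapObj.Hom.hom φ,
    (MapObj.Hom.hom_u φ).trans (twist_one G _).symm⟩
  map_id X := rfl
  map_comp φ ψ := QuotObj.Hom.ext rfl (by
    change (1 : G.obj _) = 1 * G.map _ 1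
    simp) rfl
  w := rfl

lemma isFiberedInGroupoids_of_existsUnique (𝒵 : BasedCategory.{v₂, u₂} C)
    (h1 : ∀ (a : 𝒵.obj) (R : C) (f : R ⟶ 𝒵.p.obj a),
      ∃ (b : 𝒵.obj) (φ : b ⟶ a), 𝒵.p.IsHomLift f φ)
    (h2 : ∀ {c a b : 𝒵.obj} (φ : a ⟶ b) (φ' : c ⟶ b) (t : 𝒵.p.obj c ⟶ 𝒵.p.obj a),
      t ≫ 𝒵.p.map φ = 𝒵.p.map φ' → ∃! ψ : c ⟶ a, 𝒵.p.map ψ = t ∧ ψ ≫ φ = φ') :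
    IsFiberedInGroupoids 𝒵 := by
  have key : ∀ {a b : 𝒵.obj} (φ : a ⟶ b), 𝒵.p.IsStronglyCartesian (𝒵.p.map φ) φ := by
    intro a b φ
    refine { universal_property' := ?_ }
    intro c t φ' hφ'
    obtain ⟨ψ, ⟨hψ, hψ'⟩, hu⟩ := h2 φ φ' t (IsHomLift.eq_of_isHomLift 𝒵.p (t ≫ 𝒵.p.map φ) φ')
    refine ⟨ψ, ⟨hψ ▸ inferInstance, hψ'⟩, fun χ hχ => hu χ ⟨?_, hχ.2⟩⟩
    have := hχ.1
    exact (IsHomLift.eq_of_isHomLift 𝒵.p t χ).symm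
  refine ⟨Functor.IsFibered.of_exists_isStronglyCartesian fun a R f => ?_,
    fun φ => have := key φ; inferInstance⟩
  obtain ⟨b, φ, hφ⟩ := h1 a R f
  refine ⟨b, φ, ?_⟩
  obtain rfl := IsHomLift.domain_eq 𝒵.p f φ
  rw [IsHomLift.eq_of_isHomLift 𝒵.p f φ]
  exact key φ

lemma isFiberedInGroupoids_quotPrestack (G : Cᵒᵖ ⥤ GrpCat.{v}) {𝒳 : BasedCategory.{v₂, u₂} C}
    (h : IsFiberedInGroupoids 𝒳) : IsFiberedInGroupoids (quotPrestack G 𝒳) := by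
  refine isFiberedInGroupoids_of_existsUnique _ (fun X R f => ?_)
    fun φ φ' t ht => QuotObj.existsUnique_lift h φ φ' t ht
  let X' : QuotObj G 𝒳 := X
  let f' : R ⟶ X'.pt.base := f
  let Z : QuotObj G 𝒳 := ⟨⟨R, (eltsMap (prodMap (groupSet G) f')).comp X'.pt.map⟩⟩
  let φ : Z ⟶ X' := ⟨f', 1, ⟨prodMap (groupSet G) f', 𝟙 _⟩, (twist_one G f').symm⟩
  exact ⟨Z, φ, IsHomLift.map (p := (quotPrestack G 𝒳).p) φ⟩

/-- A left `G`-torsor `P → T`: a sheaf `P` over `T` with a left action of `G` over `T`, simply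
transitive on the sections over a common section of `T`, and with local sections. -/
structure Torsor (J : GrothendieckTopology C) (G : Cᵒᵖ ⥤ GrpCat.{v}) (T : C) where
  psh : Cᵒᵖ ⥤ Type v
  isSheaf : Presieve.IsSheaf J psh
  proj : psh ⟶ yoneda.obj T
  smul {S : Cᵒᵖ} : G.obj S → psh.obj S → psh.obj S
  one_smul {S : Cᵒᵖ} (x : psh.obj S) : smul 1 x = x
  mul_smul {S : Cᵒᵖ} (g h : G.obj S) (x : psh.obj S) : smul (g * h) x = smul g (smul h x)
  map_smul {S S' : Cᵒᵖ} (s : S ⟶ S') (g : G.obj S) (x : psh.obj S) :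
    psh.map s (smul g x) = smul (G.map s g) (psh.map s x)
  proj_smul {S : Cᵒᵖ} (g : G.obj S) (x : psh.obj S) : proj.app S (smul g x) = proj.app S x
  simplyTransitive {S : Cᵒᵖ} (x y : psh.obj S) :
    proj.app S x = proj.app S y → ∃! g : G.obj S, smul g x = y
  locallyTrivial : Sieve.sieveOfSubfunctor proj ∈ J T

/-- An object over `T`: a left `G`-torsor `P → T` with an arbitrary morphism `χ : P → 𝒳`. -/
structure UnparObj (J : GrothendieckTopology C) (G : Cᵒᵖ ⥤ GrpCat.{v})
    (𝒳 : BasedCategory.{v₂, u₂} C) where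
  base : C
  torsor : Torsor J G base
  map : elts torsor.psh ⥤ᵇ 𝒳

section Unpar

variable {J : GrothendieckTopology C} {G : Cᵒᵖ ⥤ GrpCat.{v}} {𝒳 : BasedCategory.{v₂, u₂} C}

/-- The pair `(P, χ)`. -/
abbrev UnparObj.probe (X : UnparObj J G 𝒳) : Probe 𝒳 := ⟨_, X.map⟩

/-- An arrow `(P, χ) → (P', χ')` over `t : T → T'`: a `G`-equivariant map `u : P → P'` over `t`,
together with a 2-morphism `χ ⇒ χ' ∘ u`. -/
@[ext]
structure UnparObj.Hom (X X' : UnparObj J G 𝒳) where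
  base : X.base ⟶ X'.base
  hom : X.probe ⟶ X'.probe
  proj_hom : hom.u ≫ X'.torsor.proj = X.torsor.proj ≫ yoneda.map base
  smul_hom : ∀ {S : Cᵒᵖ} (g : G.obj S) (x : X.torsor.psh.obj S),
    hom.u.app S (X.torsor.smul g x) = X'.torsor.smul g (hom.u.app S x)

instance : Category (UnparObj J G 𝒳) where
  Hom := UnparObj.Hom
  id X := ⟨𝟙 _, 𝟙 _, by rw [Probe.id_u, yoneda.map_id]; rfl, fun g x => rfl⟩
  comp {X X' X''} φ ψ := ⟨φ.base ≫ ψ.base, φ.hom ≫ ψ.hom, by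
    have h1 := φ.proj_hom
    have h2 := ψ.proj_hom
    rw [Probe.comp_u, yoneda.map_comp, ← reassoc_of% h1, ← h2, Category.assoc], fun g x =>
      (congrArg (ψ.hom.u.app _) (φ.smul_hom g x)).trans (ψ.smul_hom g _)⟩
  id_comp φ := UnparObj.Hom.ext (Category.id_comp _) (Category.id_comp _)
  comp_id φ := UnparObj.Hom.ext (Category.comp_id _) (Category.comp_id _)
  assoc φ ψ χ := UnparObj.Hom.ext (Category.assoc _ _ _) (Category.assoc _ _ _)

end Unpar

/-- The fibered category of `G`-torsors with an arbitrary morphism to `𝒳`. -/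
def unparStack (J : GrothendieckTopology C) (G : Cᵒᵖ ⥤ GrpCat.{v})
    (𝒳 : BasedCategory.{v₂, u₂} C) : BasedCategory C where
  obj := UnparObj J G 𝒳
  p := { obj := fun X => X.base, map := fun φ => UnparObj.Hom.base φ }

lemma isSheaf_prod (J : GrothendieckTopology C) {A B : Cᵒᵖ ⥤ Type v} (hA : Presieve.IsSheaf J A)
    (hB : Presieve.IsSheaf J B) : Presieve.IsSheaf J (FunctorToTypes.prod A B) := by
  intro T R hR x hx
  obtain ⟨a, ha, ha'⟩ := hA R hR (fun S s hs => (x s hs).1)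
    (fun _ _ _ g₁ g₂ _ _ h₁ h₂ w => congrArg Prod.fst (hx g₁ g₂ h₁ h₂ w))
  obtain ⟨b, hb, hb'⟩ := hB R hR (fun S s hs => (x s hs).2)
    (fun _ _ _ g₁ g₂ _ _ h₁ h₂ w => congrArg Prod.snd (hx g₁ g₂ h₁ h₂ w))
  refine ⟨(a, b), fun S s hs => Prod.ext (ha s hs) (hb s hs), fun y hy => Prod.ext ?_ ?_⟩
  · exact ha' _ fun S s hs => congrArg Prod.fst (hy s hs)
  · exact hb' _ fun S s hs => congrArg Prod.snd (hy s hs)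

/-- The trivial torsor `G × T → T`, with `g · (a, t) = (g a, t)`. -/
def trivTorsor (J : GrothendieckTopology C) [J.Subcanonical] (G : Cᵒᵖ ⥤ GrpCat.{v})
    (hG : Presieve.IsSheaf J (groupSet G)) (T : C) : Torsor J G T where
  psh := trivPsh G T
  isSheaf := isSheaf_prod J hG (GrothendieckTopology.Subcanonical.isSheaf_of_isRepresentable _)
  proj := FunctorToTypes.prod.snd
  smul {S} g x := (HMul.hMul (α := G.obj S) g x.1, x.2)
  one_smul {S} x := Prod.ext (one_mul (M := G.obj S) x.1) rfl
  mul_smul {S} g h x := Prod.ext (mul_assoc (G := G.obj S) g h x.1) rfl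
  map_smul s g x := Prod.ext (map_mul (G.map s).hom g x.1) rfl
  proj_smul g x := rfl
  simplyTransitive {S} x y h := by
    obtain ⟨a, s⟩ := x
    obtain ⟨b, s'⟩ := y
    have key : ∀ a b : G.obj S, ∃! g : G.obj S, g * a = b := fun a b =>
      ⟨b * a⁻¹, by simp, fun g hg => by rw [← hg]; simp⟩
    obtain ⟨g, hg, hu⟩ := key a b
    exact ⟨g, Prod.ext hg h, fun g' hg' => hu g' (congrArg Prod.fst hg')⟩
  locallyTrivial := by
    have : Sieve.sieveOfSubfunctor (FunctorToTypes.prod.snd : trivPsh G T ⟶ yoneda.obj T) = ⊤ := by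
      ext S s
      simp only [Sieve.top_apply, iff_true]
      exact ⟨((1 : G.obj (op S)), s), rfl⟩
    rw [this]; exact J.top_mem T

/-- The morphism `p` from `Map(G, 𝒳)` to the stack of torsors over `𝒳`, which sends
`f : G × T → 𝒳` to the trivial torsor `G × T` with the map `f`. -/
def mapToUnpar (J : GrothendieckTopology C) [J.Subcanonical] (G : Cᵒᵖ ⥤ GrpCat.{v})
    (hG : Presieve.IsSheaf J (groupSet G)) (𝒳 : BasedCategory.{v₂, u₂} C) :
    mapStack (groupSet G) 𝒳 ⥤ᵇ unparStack J G 𝒳 where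
  obj X := ⟨X.base, trivTorsor J G hG X.base, X.map⟩
  map φ := ⟨MapObj.Hom.base φ, MapObj.Hom.hom φ, by
      rw [MapObj.Hom.hom_u φ]; rfl, fun g x => by
      rw [MapObj.Hom.hom_u φ]; rfl⟩
  map_id X := rfl
  map_comp φ ψ := rfl
  w := rfl

/-- The extension of `p` to the transformation prestack: `f` is sent to `(G × T, f)`, and the
arrow `(g, γ)` over `t` to the torsor map `(a, s) ↦ (a g(s), t(s))` together with `γ`. -/
def quotToUnpar (J : GrothendieckTopology C) [J.Subcanonical] (G : Cᵒᵖ ⥤ GrpCat.{v})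
    (hG : Presieve.IsSheaf J (groupSet G)) (𝒳 : BasedCategory.{v₂, u₂} C) :
    quotPrestack G 𝒳 ⥤ᵇ unparStack J G 𝒳 where
  obj X := ⟨X.pt.base, trivTorsor J G hG X.pt.base, X.pt.map⟩
  map φ := ⟨QuotObj.Hom.base φ, QuotObj.Hom.hom φ, by
      rw [QuotObj.Hom.hom_u φ]; rfl, fun {S} g x => by
      rw [QuotObj.Hom.hom_u φ]; exact Prod.ext (mul_assoc (G := G.obj S) _ _ _) rfl⟩
  map_id X := rfl
  map_comp φ ψ := rfl
  w := rfl

/-- The stackification of a prestack `𝒴`, by local data. An object over `S = base` is a descent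
datum in `𝒴` along a covering sieve of `S`. Arrows are given locally on `S`, see below. -/
structure LocObj (J : GrothendieckTopology C) (𝒴 : BasedCategory.{v₂, u₂} C) where
  base : C
  cover : Sieve base
  cover_mem : cover ∈ J base
  datum : elts cover.functor ⥤ᵇ 𝒴

section Loc

variable {J : GrothendieckTopology C} {𝒴 : BasedCategory.{v₂, u₂} C}

/-- The covering sieve, with its morphism to `𝒴`. -/
abbrev LocObj.probe (X : LocObj J 𝒴) : Probe 𝒴 := ⟨_, X.datum⟩

/-- The restriction of a descent datum to a smaller sieve `W`. -/
abbrev LocObj.restrict (X : LocObj J 𝒴) {W : Sieve X.base} (h : W ≤ X.cover) : Probe 𝒴 :=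
  ⟨W.functor, (eltsMap (Sieve.natTransOfLe h)).comp X.datum⟩

/-- The inclusion of the restriction. -/
def LocObj.incl (X : LocObj J 𝒴) {W : Sieve X.base} (h : W ≤ X.cover) :
    X.restrict h ⟶ X.probe :=
  ⟨Sieve.natTransOfLe h, 𝟙 _⟩

/-- The inclusion between two restrictions. -/
def LocObj.restrictMap (X : LocObj J 𝒴) {W W' : Sieve X.base} (h : W ≤ W') (h' : W' ≤ X.cover) :
    X.restrict (h.trans h') ⟶ X.restrict h' :=
  ⟨Sieve.natTransOfLe h, 𝟙 _⟩

/-- An arrow into a descent datum whose underlying map takes values in the sieve `W` is an arrow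
into the restriction to `W`. -/
def LocObj.corestr (X : LocObj J 𝒴) {A : Probe 𝒴} (α : A ⟶ X.probe) {W : Sieve X.base}
    (h : W ≤ X.cover) (hα : ∀ (S : Cᵒᵖ) (x : A.psh.obj S), W.arrows (α.u.app S x).1) :
    A ⟶ X.restrict h where
  u :=
    { app := fun S => ↾fun x => ⟨(α.u.app S x).1, hα S x⟩
      naturality := fun S S' s => by
        refine ConcreteCategory.hom_ext (C := Type v) _ _ fun x => Subtype.ext ?_
        have := congrArg Subtype.val (NatTrans.naturality_apply α.u s x)
        exact this }
  γ := α.γ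

lemma LocObj.corestr_incl (X : LocObj J 𝒴) {A : Probe 𝒴} (α : A ⟶ X.probe) {W : Sieve X.base}
    (h : W ≤ X.cover) (hα : ∀ (S : Cᵒᵖ) (x : A.psh.obj S), W.arrows (α.u.app S x).1) :
    X.corestr α h hα ≫ X.incl h = α := by
  refine Probe.Hom.ext rfl (heq_of_eq ?_)
  apply BasedNatTrans.homCategory.ext; ext x
  exact Category.comp_id _

lemma LocObj.restrictMap_incl (X : LocObj J 𝒴) {W W' : Sieve X.base} (h : W ≤ W')
    (h' : W' ≤ X.cover) : X.restrictMap h h' ≫ X.incl h' = X.incl (h.trans h') := by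
  refine Probe.Hom.ext rfl (heq_of_eq ?_)
  apply BasedNatTrans.homCategory.ext; ext x
  exact Category.comp_id _

lemma LocObj.incl_cancel (X : LocObj J 𝒴) {A : Probe 𝒴} {W : Sieve X.base} (h : W ≤ X.cover)
    {α β : A ⟶ X.restrict h} (e : α ≫ X.incl h = β ≫ X.incl h) : α = β := by
  obtain ⟨u, γ⟩ := α
  obtain ⟨u', γ'⟩ := β
  have e' : (⟨u ≫ Sieve.natTransOfLe h, γ ≫ 𝟙 _⟩ : Probe.Hom A X.probe) =
    ⟨u' ≫ Sieve.natTransOfLe h, γ' ≫ 𝟙 _⟩ := e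
  have hu : u = u' := by
    refine psh_hom_ext fun S x => Subtype.ext ?_
    have := congrArg (fun χ : Probe.Hom A X.probe => (χ.u.app S x).1) e'
    exact this
  subst hu
  injection e' with _ e'
  refine Probe.Hom.ext rfl (heq_of_eq ?_)
  exact (Category.comp_id γ).symm.trans (e'.trans (Category.comp_id γ'))

/-- A representative of an arrow over `base : S → S'`: a map of descent data over `base`, defined
on a covering sieve `dom` of `S`. It lies over the composition `k ↦ k ≫ base`. -/
structure LocObj.PreHom (X Y : LocObj J 𝒴) where
  base : X.base ⟶ Y.base
  dom : Sieve X.base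
  dom_mem : dom ∈ J X.base
  dom_le : dom ≤ X.cover
  hom : X.restrict dom_le ⟶ Y.probe
  hom_u : ∀ {S : Cᵒᵖ} (x : dom.functor.obj S), (hom.u.app S x).1 = x.1 ≫ base

/-- Restriction of a representative to a smaller sieve. -/
def LocObj.PreHom.restrict {X Y : LocObj J 𝒴} (φ : PreHom X Y) {W : Sieve X.base}
    (h : W ≤ φ.dom) : X.restrict (h.trans φ.dom_le) ⟶ Y.probe :=
  X.restrictMap h φ.dom_le ≫ φ.hom

lemma LocObj.PreHom.restrict_u {X Y : LocObj J 𝒴} (φ : PreHom X Y) {W : Sieve X.base}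
    (h : W ≤ φ.dom) {S : Cᵒᵖ} (x : W.functor.obj S) :
    ((φ.restrict h).u.app S x).1 = x.1 ≫ φ.base :=
  φ.hom_u ⟨x.1, h _ x.2⟩

/-- Two representatives define the same arrow if they agree on a smaller covering sieve. -/
def LocObj.PreHom.Rel {X Y : LocObj J 𝒴} (φ ψ : PreHom X Y) : Prop :=
  φ.base = ψ.base ∧ ∃ (W : Sieve X.base) (_ : W ∈ J X.base) (h : W ≤ φ.dom) (h' : W ≤ ψ.dom),
    φ.restrict h = ψ.restrict h'

lemma LocObj.PreHom.restrictMap_restrict {X Y : LocObj J 𝒴} (φ : PreHom X Y)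
    {W W' : Sieve X.base} (hW : W' ≤ W) (h : W ≤ φ.dom) :
    X.restrictMap hW (h.trans φ.dom_le) ≫ φ.restrict h = φ.restrict (hW.trans h) := by
  rw [LocObj.PreHom.restrict, LocObj.PreHom.restrict, ← Category.assoc]
  congr 1
  apply X.incl_cancel
  rw [Category.assoc, X.restrictMap_incl, X.restrictMap_incl, X.restrictMap_incl]

lemma LocObj.PreHom.restrict_eq {X Y : LocObj J 𝒴} {φ ψ : PreHom X Y} {W W' : Sieve X.base}
    {h : W ≤ φ.dom} {h' : W ≤ ψ.dom} (e : φ.restrict h = ψ.restrict h') (hW : W' ≤ W) :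
    φ.restrict (hW.trans h) = ψ.restrict (hW.trans h') := by
  rw [← φ.restrictMap_restrict hW h, ← ψ.restrictMap_restrict hW h', e]

/-- The equivalence relation `Rel`. -/
def LocObj.PreHom.setoid (X Y : LocObj J 𝒴) : Setoid (PreHom X Y) where
  r := PreHom.Rel
  iseqv :=
    { refl := fun φ => ⟨rfl, φ.dom, φ.dom_mem, le_rfl, le_rfl, rfl⟩
      symm := fun ⟨e, W, hW, h, h', e'⟩ => ⟨e.symm, W, hW, h', h, e'.symm⟩
      trans := by
        rintro φ ψ χ ⟨e, W, hW, h, h', e'⟩ ⟨f, V, hV, k, k', f'⟩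
        refine ⟨e.trans f, W ⊓ V, J.intersection_covering hW hV,
          inf_le_left.trans h, inf_le_right.trans k', ?_⟩
        exact (PreHom.restrict_eq e' inf_le_left).trans (PreHom.restrict_eq f' inf_le_right) }

/-- The identity. -/
def LocObj.PreHom.id (X : LocObj J 𝒴) : PreHom X X where
  base := 𝟙 _
  dom := X.cover
  dom_mem := X.cover_mem
  dom_le := le_rfl
  hom := 𝟙 X.probe
  hom_u x := (Category.comp_id x.1).symm

lemma LocObj.PreHom.restrict_mem {X Y : LocObj J 𝒴} (φ : PreHom X Y) {W : Sieve X.base}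
    (h : W ≤ φ.dom) {V : Sieve Y.base} (hV : W ≤ V.pullback φ.base) (S : Cᵒᵖ)
    (x : W.functor.obj S) : V.arrows ((φ.restrict h).u.app S x).1 :=
  (congrArg (fun k : S.unop ⟶ Y.base => V.arrows k) (φ.restrict_u h x)).mpr (hV _ x.2)

/-- Composition, defined where the first arrow maps into the domain of the second. -/
def LocObj.PreHom.comp {X Y Z : LocObj J 𝒴} (φ : PreHom X Y) (ψ : PreHom Y Z) : PreHom X Z where
  base := φ.base ≫ ψ.base
  dom := φ.dom ⊓ ψ.dom.pullback φ.base
  dom_mem := J.intersection_covering φ.dom_mem (J.pullback_stable _ ψ.dom_mem)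
  dom_le := inf_le_left.trans φ.dom_le
  hom := Y.corestr (φ.restrict inf_le_left) ψ.dom_le (φ.restrict_mem _ inf_le_right) ≫ ψ.hom
  hom_u x := (ψ.hom_u _).trans
    ((congrArg (· ≫ ψ.base) (φ.restrict_u inf_le_left x)).trans (Category.assoc _ _ _))

lemma LocObj.PreHom.comp_restrict {X Y Z : LocObj J 𝒴} (φ : PreHom X Y) (ψ : PreHom Y Z)
    {W : Sieve X.base} (h : W ≤ (φ.comp ψ).dom) {V : Sieve Y.base} (hV : V ≤ ψ.dom)
    (hWV : W ≤ V.pullback φ.base) :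
    (φ.comp ψ).restrict h =
      Y.corestr (φ.restrict (h.trans inf_le_left)) (hV.trans ψ.dom_le) (φ.restrict_mem _ hWV) ≫
        ψ.restrict hV := by
  have k : W ≤ φ.dom ⊓ ψ.dom.pullback φ.base := h
  have h1 : (φ.comp ψ).restrict h = X.restrictMap k (inf_le_left.trans φ.dom_le) ≫
    Y.corestr (φ.restrict inf_le_left) ψ.dom_le (φ.restrict_mem _ inf_le_right) ≫ ψ.hom := rfl
  have h2 : ψ.restrict hV = Y.restrictMap hV ψ.dom_le ≫ ψ.hom := rfl
  rw [h1, h2, ← Category.assoc, ← Category.assoc]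
  congr 1
  apply Y.incl_cancel
  rw [Category.assoc, Category.assoc, Y.corestr_incl, Y.restrictMap_incl, Y.corestr_incl]
  exact φ.restrictMap_restrict k inf_le_left

lemma LocObj.PreHom.comp_rel {X Y Z : LocObj J 𝒴} {φ φ' : PreHom X Y} {ψ ψ' : PreHom Y Z}
    (hφ : φ.Rel φ') (hψ : ψ.Rel ψ') : (φ.comp ψ).Rel (φ'.comp ψ') := by
  obtain ⟨e, W, hW, h, h', e'⟩ := hφ
  obtain ⟨f, V, hV, k, k', f'⟩ := hψ
  have hb : (φ.comp ψ).base = (φ'.comp ψ').base := by simp only [PreHom.comp, e, f]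
  have hm : W ⊓ V.pullback φ.base ∈ J X.base :=
    J.intersection_covering hW (J.pullback_stable _ hV)
  have hd : W ⊓ V.pullback φ.base ≤ (φ.comp ψ).dom :=
    inf_le_inf h (Sieve.pullback_monotone φ.base k)
  have hV' : W ⊓ V.pullback φ.base ≤ V.pullback φ'.base := e ▸ inf_le_right
  have hd' : W ⊓ V.pullback φ.base ≤ (φ'.comp ψ').dom :=
    le_inf (inf_le_left.trans h') (hV'.trans (Sieve.pullback_monotone φ'.base k'))
  refine ⟨hb, _, hm, hd, hd', ?_⟩
  rw [comp_restrict φ ψ hd k inf_le_right, comp_restrict φ' ψ' hd' k' hV', f']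
  congr 1
  apply Y.incl_cancel
  rw [Y.corestr_incl, Y.corestr_incl]
  exact PreHom.restrict_eq e' inf_le_left

lemma LocObj.PreHom.id_comp_rel {X Y : LocObj J 𝒴} (φ : PreHom X Y) :
    ((PreHom.id X).comp φ).Rel φ := by
  have hi : φ.dom ≤ φ.dom.pullback (PreHom.id X).base := Sieve.pullback_id.ge
  have hd : φ.dom ≤ ((PreHom.id X).comp φ).dom := le_inf φ.dom_le hi
  refine ⟨Category.id_comp _, φ.dom, φ.dom_mem, hd, le_rfl, ?_⟩
  rw [comp_restrict (PreHom.id X) φ hd le_rfl hi]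
  have h1 : X.corestr ((PreHom.id X).restrict φ.dom_le) φ.dom_le
      (restrict_mem _ φ.dom_le hi) = 𝟙 _ := by
    apply X.incl_cancel
    rw [X.corestr_incl, Category.id_comp]
    exact Category.comp_id _
  exact (congrArg (· ≫ φ.restrict le_rfl) h1).trans (Category.id_comp _)

lemma LocObj.PreHom.comp_id_rel {X Y : LocObj J 𝒴} (φ : PreHom X Y) :
    (φ.comp (PreHom.id Y)).Rel φ := by
  have hle : φ.dom ≤ (PreHom.id Y).dom.pullback φ.base := fun S s hs =>
    (congrArg (fun k : S ⟶ Y.base => Y.cover.arrows k) (φ.hom_u (S := op S) ⟨s, hs⟩)).mp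
      (φ.hom.u.app (op S) ⟨s, hs⟩).2
  have hd : φ.dom ≤ (φ.comp (PreHom.id Y)).dom := le_inf le_rfl hle
  refine ⟨Category.comp_id _, φ.dom, φ.dom_mem, hd, le_rfl, ?_⟩
  rw [comp_restrict φ (PreHom.id Y) hd le_rfl hle]
  have h1 : (PreHom.id Y).restrict le_rfl = Y.incl le_rfl := Category.comp_id _
  rw [h1]
  exact Y.corestr_incl (φ.restrict le_rfl) le_rfl _

lemma LocObj.PreHom.assoc_rel {X Y Z T : LocObj J 𝒴} (φ : PreHom X Y) (ψ : PreHom Y Z)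
    (χ : PreHom Z T) : ((φ.comp ψ).comp χ).Rel (φ.comp (ψ.comp χ)) := by
  have hm : ((φ.comp ψ).comp χ).dom ⊓ (φ.comp (ψ.comp χ)).dom ∈ J X.base :=
    J.intersection_covering (dom_mem _) (dom_mem _)
  have hl : ((φ.comp ψ).comp χ).dom ⊓ (φ.comp (ψ.comp χ)).dom ≤ ((φ.comp ψ).comp χ).dom :=
    inf_le_left
  have hr : ((φ.comp ψ).comp χ).dom ⊓ (φ.comp (ψ.comp χ)).dom ≤ (φ.comp (ψ.comp χ)).dom :=
    inf_le_right
  have hl1 : ((φ.comp ψ).comp χ).dom ≤ (φ.comp ψ).dom := inf_le_left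
  have hl2 : ((φ.comp ψ).comp χ).dom ≤ χ.dom.pullback (φ.comp ψ).base := inf_le_right
  have hr2 : (φ.comp (ψ.comp χ)).dom ≤ (ψ.comp χ).dom.pullback φ.base := inf_le_right
  have hc1 : (ψ.comp χ).dom ≤ ψ.dom := inf_le_left
  have hc2 : (ψ.comp χ).dom ≤ χ.dom.pullback ψ.base := inf_le_right
  refine ⟨Category.assoc _ _ _, _, hm, hl, hr, ?_⟩
  rw [comp_restrict (φ.comp ψ) χ hl le_rfl (hl.trans hl2),
    comp_restrict φ (ψ.comp χ) hr le_rfl (hr.trans hr2),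
    comp_restrict ψ χ le_rfl le_rfl hc2, ← Category.assoc]
  congr 1
  apply Z.incl_cancel
  rw [Z.corestr_incl, Category.assoc, Z.corestr_incl,
    comp_restrict φ ψ (hl.trans hl1) hc1 (hr.trans hr2)]

instance : Category (LocObj J 𝒴) where
  Hom X Y := Quotient (LocObj.PreHom.setoid X Y)
  id X := Quotient.mk _ (LocObj.PreHom.id X)
  comp := Quotient.map₂ LocObj.PreHom.comp fun _ _ h _ _ h' => LocObj.PreHom.comp_rel h h'
  id_comp := by
    rintro X Y ⟨φ⟩
    exact Quotient.sound φ.id_comp_rel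
  comp_id := by
    rintro X Y ⟨φ⟩
    exact Quotient.sound φ.comp_id_rel
  assoc := by
    rintro X Y Z T ⟨φ⟩ ⟨ψ⟩ ⟨χ⟩
    exact Quotient.sound (φ.assoc_rel ψ χ)

end Loc

/-- The stackification of a prestack `𝒴` (a category fibered in groupoids in which arrows satisfy
descent): its objects are local objects of `𝒴` with descent data, and its arrows are the local
arrows. For the prestack below, arrows satisfy descent because `G` is a sheaf and `𝒳` a stack. -/
def stackification (J : GrothendieckTopology C) (𝒴 : BasedCategory.{v₂, u₂} C) :
    BasedCategory C where
  obj := LocObj J 𝒴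
  p :=
    { obj := fun X => X.base
      map := fun {X Y} φ => Quotient.lift (s := LocObj.PreHom.setoid X Y)
        LocObj.PreHom.base (fun _ _ h => h.1) φ
      map_id := fun _ => rfl
      map_comp := by
        rintro X Y Z ⟨φ⟩ ⟨ψ⟩
        rfl }

section Unit

variable {𝒴 : BasedCategory.{v₂, u₂} C}

open Functor.IsPreFibered

lemma IsFiberedInGroupoids.isStronglyCartesian (h : IsFiberedInGroupoids 𝒴) {a b : 𝒴.obj}
    (φ : a ⟶ b) {S T : C} (f : S ⟶ T) [𝒴.p.IsHomLift f φ] : 𝒴.p.IsStronglyCartesian f φ := by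
  have := h.isFibered
  obtain rfl := IsHomLift.domain_eq 𝒴.p f φ
  obtain rfl := IsHomLift.codomain_eq 𝒴.p f φ
  obtain rfl := IsHomLift.eq_of_isHomLift 𝒴.p f φ
  have := h.isCartesian φ
  infer_instance

lemma IsFiberedInGroupoids.existsUnique_lift (h : IsFiberedInGroupoids 𝒴) {a b c : 𝒴.obj}
    {R S T : C} (f : S ⟶ T) (g : R ⟶ S) (k : R ⟶ T) (φ : a ⟶ b) (ψ : c ⟶ b)
    (hφ : 𝒴.p.IsHomLift f φ) (hψ : 𝒴.p.IsHomLift k ψ) (hk : k = g ≫ f) :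
    ∃! χ : c ⟶ a, 𝒴.p.IsHomLift g χ ∧ χ ≫ φ = ψ :=
  have := h.isStronglyCartesian φ f
  Functor.IsStronglyCartesian.universal_property 𝒴.p f φ g k hk ψ

/-- The unique factorization of `ψ` through `φ` over `g`. -/
noncomputable def IsFiberedInGroupoids.lift (h : IsFiberedInGroupoids 𝒴) {a b c : 𝒴.obj}
    {R S T : C} (f : S ⟶ T) (g : R ⟶ S) (k : R ⟶ T) (φ : a ⟶ b) (ψ : c ⟶ b)
    (hφ : 𝒴.p.IsHomLift f φ) (hψ : 𝒴.p.IsHomLift k ψ) (hk : k = g ≫ f) : c ⟶ a :=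
  (h.existsUnique_lift f g k φ ψ hφ hψ hk).choose

lemma IsFiberedInGroupoids.lift_isHomLift (h : IsFiberedInGroupoids 𝒴) {a b c : 𝒴.obj}
    {R S T : C} (f : S ⟶ T) (g : R ⟶ S) (k : R ⟶ T) (φ : a ⟶ b) (ψ : c ⟶ b)
    (hφ : 𝒴.p.IsHomLift f φ) (hψ : 𝒴.p.IsHomLift k ψ) (hk : k = g ≫ f) :
    𝒴.p.IsHomLift g (h.lift f g k φ ψ hφ hψ hk) :=
  (h.existsUnique_lift f g k φ ψ hφ hψ hk).choose_spec.1.1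

lemma IsFiberedInGroupoids.lift_comp (h : IsFiberedInGroupoids 𝒴) {a b c : 𝒴.obj}
    {R S T : C} (f : S ⟶ T) (g : R ⟶ S) (k : R ⟶ T) (φ : a ⟶ b) (ψ : c ⟶ b)
    (hφ : 𝒴.p.IsHomLift f φ) (hψ : 𝒴.p.IsHomLift k ψ) (hk : k = g ≫ f) :
    h.lift f g k φ ψ hφ hψ hk ≫ φ = ψ :=
  (h.existsUnique_lift f g k φ ψ hφ hψ hk).choose_spec.1.2

lemma IsFiberedInGroupoids.hom_ext (h : IsFiberedInGroupoids 𝒴) {a b c : 𝒴.obj}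
    {R S T : C} (f : S ⟶ T) (g : R ⟶ S) (φ : a ⟶ b) (χ χ' : c ⟶ a)
    (hφ : 𝒴.p.IsHomLift f φ) (hχ : 𝒴.p.IsHomLift g χ) (hχ' : 𝒴.p.IsHomLift g χ')
    (e : χ ≫ φ = χ' ≫ φ) : χ = χ' :=
  (h.existsUnique_lift f g (g ≫ f) φ (χ' ≫ φ) hφ inferInstance rfl).unique ⟨hχ, e⟩ ⟨hχ', rfl⟩

/-- A chosen pullback `k^* y`. -/
noncomputable def IsFiberedInGroupoids.pull (h : IsFiberedInGroupoids 𝒴) (y : 𝒴.obj) {U : C}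
    (k : U ⟶ 𝒴.p.obj y) : 𝒴.obj :=
  have := h.isFibered
  pullbackObj (p := 𝒴.p) (a := y) rfl k

/-- The cartesian arrow `k^* y → y`. -/
noncomputable def IsFiberedInGroupoids.pullMap (h : IsFiberedInGroupoids 𝒴) (y : 𝒴.obj) {U : C}
    (k : U ⟶ 𝒴.p.obj y) : h.pull y k ⟶ y :=
  have := h.isFibered
  pullbackMap (p := 𝒴.p) (a := y) rfl k

lemma IsFiberedInGroupoids.pullMap_isHomLift (h : IsFiberedInGroupoids 𝒴) (y : 𝒴.obj) {U : C}
    (k : U ⟶ 𝒴.p.obj y) : 𝒴.p.IsHomLift k (h.pullMap y k) :=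
  have := h.isFibered
  (pullbackMap.IsCartesian (p := 𝒴.p) (a := y) rfl k).toIsHomLift

lemma IsFiberedInGroupoids.pull_obj (h : IsFiberedInGroupoids 𝒴) (y : 𝒴.obj) {U : C}
    (k : U ⟶ 𝒴.p.obj y) : 𝒴.p.obj (h.pull y k) = U :=
  have := h.pullMap_isHomLift y k
  IsHomLift.domain_eq 𝒴.p k (h.pullMap y k)

/-- The arrow `k^* y → k'^* y` over `g`, if `k` factors as `k'` after `g`. -/
noncomputable def IsFiberedInGroupoids.pullLift (h : IsFiberedInGroupoids 𝒴) (y : 𝒴.obj)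
    {U U' : C} (k : U ⟶ 𝒴.p.obj y) (k' : U' ⟶ 𝒴.p.obj y) (g : U ⟶ U') (hg : g ≫ k' = k) :
    h.pull y k ⟶ h.pull y k' :=
  h.lift k' g k (h.pullMap y k') (h.pullMap y k) (h.pullMap_isHomLift _ _)
    (h.pullMap_isHomLift _ _) hg.symm

lemma IsFiberedInGroupoids.pullLift_isHomLift (h : IsFiberedInGroupoids 𝒴) (y : 𝒴.obj)
    {U U' : C} (k : U ⟶ 𝒴.p.obj y) (k' : U' ⟶ 𝒴.p.obj y) (g : U ⟶ U') (hg : g ≫ k' = k) :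
    𝒴.p.IsHomLift g (h.pullLift y k k' g hg) :=
  h.lift_isHomLift _ _ _ _ _ _ _ _

lemma IsFiberedInGroupoids.pullLift_pullMap (h : IsFiberedInGroupoids 𝒴) (y : 𝒴.obj)
    {U U' : C} (k : U ⟶ 𝒴.p.obj y) (k' : U' ⟶ 𝒴.p.obj y) (g : U ⟶ U') (hg : g ≫ k' = k) :
    h.pullLift y k k' g hg ≫ h.pullMap y k' = h.pullMap y k :=
  h.lift_comp _ _ _ _ _ _ _ _

lemma IsFiberedInGroupoids.pullLift_id (h : IsFiberedInGroupoids 𝒴) (y : 𝒴.obj)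
    {U : C} (k : U ⟶ 𝒴.p.obj y) (hg : 𝟙 U ≫ k = k) : h.pullLift y k k (𝟙 U) hg = 𝟙 _ :=
  h.hom_ext k (𝟙 U) (h.pullMap y k) _ _ (h.pullMap_isHomLift _ _)
    (h.pullLift_isHomLift _ _ _ _ _) (IsHomLift.id (h.pull_obj y k))
    ((h.pullLift_pullMap _ _ _ _ _).trans (Category.id_comp _).symm)

lemma IsFiberedInGroupoids.pullLift_pullLift (h : IsFiberedInGroupoids 𝒴) (y : 𝒴.obj)
    {U U' U'' : C} (k : U ⟶ 𝒴.p.obj y) (k' : U' ⟶ 𝒴.p.obj y) (k'' : U'' ⟶ 𝒴.p.obj y)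
    (g : U ⟶ U') (g' : U' ⟶ U'') (hg : g ≫ k' = k) (hg' : g' ≫ k'' = k')
    (hh : (g ≫ g') ≫ k'' = k) :
    h.pullLift y k k'' (g ≫ g') hh = h.pullLift y k k' g hg ≫ h.pullLift y k' k'' g' hg' := by
  have h1 := h.pullLift_isHomLift y k k' g hg
  have h2 := h.pullLift_isHomLift y k' k'' g' hg'
  refine h.hom_ext k'' (g ≫ g') (h.pullMap y k'') _ _ (h.pullMap_isHomLift _ _)
    (h.pullLift_isHomLift _ _ _ _ _) inferInstance ?_
  rw [Category.assoc, h.pullLift_pullMap, h.pullLift_pullMap, h.pullLift_pullMap]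

/-- The morphism `S → 𝒴` given by an object `y` over `S`, that is `k ↦ k^* y`. -/
noncomputable def unitDatum (h : IsFiberedInGroupoids 𝒴) (y : 𝒴.obj) :
    elts (⊤ : Sieve (𝒴.p.obj y)).functor ⥤ᵇ 𝒴 where
  obj e := h.pull y e.unop.2.1
  map {e e'} f := h.pullLift y e.unop.2.1 e'.unop.2.1 f.unop.1.unop
    (congrArg Subtype.val f.unop.2)
  map_id e := h.pullLift_id y _ _
  map_comp {e e' e''} f f' := h.pullLift_pullLift y _ _ _ _ _ _ _ _
  w := by
    refine CategoryTheory.Functor.ext (fun e => h.pull_obj y _) fun e e' f => ?_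
    have h1 := h.pullLift_isHomLift y e.unop.2.1 e'.unop.2.1 f.unop.1.unop
      (congrArg Subtype.val f.unop.2)
    exact IsHomLift.fac' 𝒴.p f.unop.1.unop (h.pullLift y e.unop.2.1 e'.unop.2.1 f.unop.1.unop
      (congrArg Subtype.val f.unop.2))

/-- The object `y` as a descent datum along the maximal sieve. -/
noncomputable def unitObj (J : GrothendieckTopology C) (h : IsFiberedInGroupoids 𝒴) (y : 𝒴.obj) :
    LocObj J 𝒴 where
  base := 𝒴.p.obj y
  cover := ⊤
  cover_mem := J.top_mem _
  datum := unitDatum h y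

lemma unit_hom_ext (J : GrothendieckTopology C) (h : IsFiberedInGroupoids 𝒴) {y : 𝒴.obj}
    {A : Probe 𝒴} {α β : A ⟶ (unitObj J h y).probe}
    (hu : ∀ (S : Cᵒᵖ) (x : A.psh.obj S), (α.u.app S x).1 = (β.u.app S x).1)
    (hγ : ∀ e : (elts A.psh).obj,
      α.γ.toNatTrans.app e ≫ h.pullMap y (α.u.app e.unop.1 e.unop.2).1 =
        β.γ.toNatTrans.app e ≫ h.pullMap y (β.u.app e.unop.1 e.unop.2).1) : α = β := by
  obtain ⟨u, γ⟩ := α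
  obtain ⟨u', γ'⟩ := β
  have h1 : u = u' := psh_hom_ext fun S x => Subtype.ext (hu S x)
  subst h1
  refine Probe.Hom.ext rfl (heq_of_eq ?_)
  apply BasedNatTrans.homCategory.ext; ext e
  exact h.hom_ext _ (𝟙 _) _ _ _ (h.pullMap_isHomLift _ _) (γ.isHomLift rfl) (γ'.isHomLift rfl)
    (hγ e)

/-- The arrow `k^* y → (p(ψ) k)^* y'` induced by `ψ : y → y'`. -/
noncomputable def IsFiberedInGroupoids.pullHom (h : IsFiberedInGroupoids 𝒴) {y y' : 𝒴.obj}
    (ψ : y ⟶ y') {U : C} (k : U ⟶ 𝒴.p.obj y) : h.pull y k ⟶ h.pull y' (k ≫ 𝒴.p.map ψ) :=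
  h.lift (k ≫ 𝒴.p.map ψ) (𝟙 _) (k ≫ 𝒴.p.map ψ) (h.pullMap y' (k ≫ 𝒴.p.map ψ))
    (h.pullMap y k ≫ ψ) (h.pullMap_isHomLift _ _)
    (have := h.pullMap_isHomLift y k; inferInstance) (Category.id_comp _).symm

lemma IsFiberedInGroupoids.pullHom_isHomLift (h : IsFiberedInGroupoids 𝒴) {y y' : 𝒴.obj}
    (ψ : y ⟶ y') {U : C} (k : U ⟶ 𝒴.p.obj y) : 𝒴.p.IsHomLift (𝟙 U) (h.pullHom ψ k) :=
  h.lift_isHomLift _ _ _ _ _ _ _ _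

lemma IsFiberedInGroupoids.pullHom_pullMap (h : IsFiberedInGroupoids 𝒴) {y y' : 𝒴.obj}
    (ψ : y ⟶ y') {U : C} (k : U ⟶ 𝒴.p.obj y) :
    h.pullHom ψ k ≫ h.pullMap y' (k ≫ 𝒴.p.map ψ) = h.pullMap y k ≫ ψ :=
  h.lift_comp _ _ _ _ _ _ _ _

lemma IsFiberedInGroupoids.pullHom_naturality (h : IsFiberedInGroupoids 𝒴) {y y' : 𝒴.obj}
    (ψ : y ⟶ y') {U U' : C} (k : U ⟶ 𝒴.p.obj y) (k' : U' ⟶ 𝒴.p.obj y) (g : U ⟶ U')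
    (hg : g ≫ k' = k) (hg' : g ≫ k' ≫ 𝒴.p.map ψ = k ≫ 𝒴.p.map ψ) :
    h.pullLift y k k' g hg ≫ h.pullHom ψ k' =
      h.pullHom ψ k ≫ h.pullLift y' (k ≫ 𝒴.p.map ψ) (k' ≫ 𝒴.p.map ψ) g hg' := by
  have h1 := h.pullLift_isHomLift y k k' g hg
  have h2 := h.pullLift_isHomLift y' (k ≫ 𝒴.p.map ψ) (k' ≫ 𝒴.p.map ψ) g hg'
  have h3 := h.pullHom_isHomLift ψ k
  have h4 := h.pullHom_isHomLift ψ k'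
  refine h.hom_ext (k' ≫ 𝒴.p.map ψ) g (h.pullMap y' (k' ≫ 𝒴.p.map ψ)) _ _
    (h.pullMap_isHomLift _ _) ?_ ?_ ?_
  · exact IsHomLift.comp_lift_id_right ..
  · exact IsHomLift.comp_lift_id_left ..
  · rw [Category.assoc, Category.assoc, h.pullLift_pullMap, h.pullHom_pullMap, h.pullHom_pullMap,
      ← Category.assoc, h.pullLift_pullMap]

lemma IsFiberedInGroupoids.pullHom_id (h : IsFiberedInGroupoids 𝒴) (y : 𝒴.obj) {U : C}
    (k : U ⟶ 𝒴.p.obj y) :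
    (𝟙 _ ≫ h.pullHom (𝟙 y) k) ≫ h.pullMap y (k ≫ 𝒴.p.map (𝟙 y)) =
      (𝟙 _ ≫ 𝟙 _) ≫ h.pullMap y k := by
  rw [Category.assoc, h.pullHom_pullMap]; simp

lemma IsFiberedInGroupoids.pullHom_comp (h : IsFiberedInGroupoids 𝒴) {y y' y'' : 𝒴.obj}
    (ψ : y ⟶ y') (ψ' : y' ⟶ y'') {U : C} (k : U ⟶ 𝒴.p.obj y) :
    (𝟙 _ ≫ h.pullHom (ψ ≫ ψ') k) ≫ h.pullMap y'' (k ≫ 𝒴.p.map (ψ ≫ ψ')) =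
      (𝟙 _ ≫ (𝟙 _ ≫ h.pullHom ψ k) ≫ h.pullHom ψ' (k ≫ 𝒴.p.map ψ)) ≫
        h.pullMap y'' ((k ≫ 𝒴.p.map ψ) ≫ 𝒴.p.map ψ') := by
  have h1 := h.pullHom_pullMap ψ' (k ≫ 𝒴.p.map ψ)
  have h2 := h.pullHom_pullMap ψ k
  rw [Category.id_comp, Category.id_comp, Category.id_comp, h.pullHom_pullMap,
    Category.assoc (h.pullHom ψ k), h1, ← Category.assoc (h.pullHom ψ k), h2, Category.assoc]

/-- The action of the unit on arrows. -/
noncomputable def unitHom (J : GrothendieckTopology C) (h : IsFiberedInGroupoids 𝒴) {y y' : 𝒴.obj}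
    (ψ : y ⟶ y') : LocObj.PreHom (unitObj J h y) (unitObj J h y') where
  base := 𝒴.p.map ψ
  dom := ⊤
  dom_mem := J.top_mem _
  dom_le := le_rfl
  hom :=
    { u :=
        { app := fun S => ↾fun k => ⟨k.1 ≫ 𝒴.p.map ψ, trivial⟩
          naturality := fun S S' s => by
            refine ConcreteCategory.hom_ext (C := Type v) _ _ fun x => Subtype.ext ?_
            exact Category.assoc _ _ _ }
      γ :=
        { app := fun e => h.pullHom ψ e.unop.2.1
          naturality := fun e e' f =>
            have hg : f.unop.1.unop ≫ e'.unop.2.1 = e.unop.2.1 := congrArg Subtype.val f.unop.2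
            h.pullHom_naturality ψ e.unop.2.1 e'.unop.2.1 f.unop.1.unop hg
              ((Category.assoc _ _ _).symm.trans (congrArg (· ≫ 𝒴.p.map ψ) hg))
          isHomLift' := fun e => h.pullHom_isHomLift ψ _ } }
  hom_u _ := rfl

/-- The unit `𝒴 → 𝒴^a` of the stackification. -/
noncomputable def toStackification (J : GrothendieckTopology C) (h : IsFiberedInGroupoids 𝒴) :
    𝒴 ⥤ᵇ stackification J 𝒴 where
  obj y := unitObj J h y
  map ψ := Quotient.mk _ (unitHom J h ψ)
  map_id y := by
    refine Quotient.sound ⟨𝒴.p.map_id y, ⊤, J.top_mem _, le_rfl, le_rfl, ?_⟩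
    refine unit_hom_ext J h (fun S x => ?_) fun e => ?_
    · exact ((unitHom J h (𝟙 y)).restrict_u le_rfl x).trans
        ((congrArg (x.1 ≫ ·) (𝒴.p.map_id y)).trans
          ((LocObj.PreHom.id (unitObj J h y)).restrict_u le_rfl x).symm)
    · exact h.pullHom_id y e.unop.2.1
  map_comp {y y' y''} ψ ψ' := by
    have hle : (unitHom J h (ψ ≫ ψ')).dom ≤ ((unitHom J h ψ).comp (unitHom J h ψ')).dom :=
      fun _ _ _ => ⟨trivial, trivial⟩
    refine Quotient.sound ⟨𝒴.p.map_comp ψ ψ', ⊤, J.top_mem _, le_rfl, hle, ?_⟩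
    refine unit_hom_ext J h (fun S x => ?_) fun e => ?_
    · exact ((unitHom J h (ψ ≫ ψ')).restrict_u le_rfl x).trans
        ((congrArg (x.1 ≫ ·) (𝒴.p.map_comp ψ ψ')).trans (Category.assoc _ _ _).symm)
    · exact h.pullHom_comp ψ ψ' e.unop.2.1
  w := rfl

end Unit

section QuotStack

variable (J : GrothendieckTopology C) (G : Cᵒᵖ ⥤ GrpCat.{v}) {𝒳 : BasedCategory.{v₂, u₂} C}

/-- The quotient stack `[G\Map(G, 𝒳)]`, the stackification of `⌊G\Map(G, 𝒳)⌋`. -/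
def quotStack (𝒳 : BasedCategory.{v₂, u₂} C) : BasedCategory C :=
  stackification J (quotPrestack G 𝒳)

/-- The unit `⌊G\Map(G, 𝒳)⌋ → [G\Map(G, 𝒳)]`. -/
noncomputable def quotUnit (h : IsFiberedInGroupoids 𝒳) : quotPrestack G 𝒳 ⥤ᵇ quotStack J G 𝒳 :=
  toStackification J (isFiberedInGroupoids_quotPrestack G h)

/-- The projection `q : Map(G, 𝒳) → [G\Map(G, 𝒳)]`. -/
noncomputable def quotStackProj (h : IsFiberedInGroupoids 𝒳) :
    mapStack (groupSet G) 𝒳 ⥤ᵇ quotStack J G 𝒳 :=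
  (quotProj G 𝒳).comp (quotUnit J G h)

end QuotStack

/-- The circle group `S^1` as a sheaf of groups over topological spaces: `T ↦ C(T, S^1)`. -/
noncomputable def circleGroup : TopCat.{0}ᵒᵖ ⥤ GrpCat.{0} where
  obj T := GrpCat.of C(T.unop, Circle)
  map t := GrpCat.ofHom (ContinuousMap.compMonoidHom' t.unop.hom)
  map_id _ := rfl
  map_comp _ _ := rfl

/-- It is a sheaf for open covers, being represented by the circle. -/
lemma isSheaf_circleGroup : Presieve.IsSheaf TopCat.grothendieckTopology (groupSet circleGroup) := by
  have h : yoneda.obj (TopCat.of Circle) ≅ groupSet circleGroup :=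
    NatIso.ofComponents (fun T => Equiv.toIso
      { toFun := fun f => (TopCat.Hom.hom f : C(T.unop, Circle))
        invFun := fun f => TopCat.ofHom f
        left_inv := fun _ => rfl
        right_inv := fun _ => rfl }) fun _ => rfl
  exact Presieve.isSheaf_iso _ h
    (GrothendieckTopology.Subcanonical.isSheaf_of_isRepresentable _)

/-- The loop stack `L𝒳 = Map(S^1, 𝒳)`. -/
noncomputable def loopStack (𝒳 : BasedCategory.{v₂, u₂} TopCat.{0}) : BasedCategory TopCat.{0} :=
  mapStack (groupSet circleGroup) 𝒳

/-- The stack of unparametrized loops in `𝒳`: over `T`, the pairs of an `S^1`-torsor `P → T` and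
an arbitrary morphism `P → 𝒳`. -/
noncomputable def unparametrizedLoops (𝒳 : BasedCategory.{v₂, u₂} TopCat.{0}) : BasedCategory TopCat.{0} :=
  unparStack TopCat.grothendieckTopology circleGroup 𝒳

/-- The quotient stack `[S^1\L𝒳]` of the loop stack by rotation of loops. -/
noncomputable def circleQuotient (𝒳 : BasedCategory.{v₂, u₂} TopCat.{0}) :
    BasedCategory TopCat.{0} :=
  quotStack TopCat.grothendieckTopology circleGroup 𝒳

/-- The projection `L𝒳 → [S^1\L𝒳]`. -/
noncomputable def loopStackProj {𝒳 : BasedCategory.{v₂, u₂} TopCat.{0}}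
    (h : IsFiberedInGroupoids 𝒳) : loopStack 𝒳 ⥤ᵇ circleQuotient 𝒳 :=
  quotStackProj TopCat.grothendieckTopology circleGroup h

/-- The morphism from loops to unparametrized loops, `f ↦ (S^1 × T, f)`. -/
noncomputable def loopStackToUnparametrized (𝒳 : BasedCategory.{v₂, u₂} TopCat.{0}) :
    loopStack 𝒳 ⥤ᵇ unparametrizedLoops 𝒳 :=
  mapToUnpar TopCat.grothendieckTopology circleGroup isSheaf_circleGroup 𝒳

end UnparametrizedTorsor

open UnparametrizedTorsor

/-!
Write `Φ₀` for `quotToUnpar`, from the transformation prestack `⌊G\Map(G, 𝒳)⌋` to the fibered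
category of torsors over `𝒳`. The theorem holds because `Φ₀` is fully faithful and hits every object
locally, and because its target is a stack: an arrow between trivial torsors is an equivariant map
`G × T → G × T'`, which is `(a, s) ↦ (a g(s), t(s))` for the image `(g, t)` of the unit section
(`quotToUnpar_faithful`, `quotToUnpar_full`), and a local section of a torsor identifies it with a
trivial one (`quotToUnpar_exists_lift`).

For any morphism `F` from a prestack `𝒴` to a stack `𝒵`, the image under `F` of a descent datum in
`𝒴` can be glued in `𝒵`. This extends `F` to the stackification of `𝒴` (`extFunctor`,
`nonempty_extFunctor_iso`), uniquely up to a unique 2-isomorphism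
(`existsUnique_iso_of_whiskerLeft`), since 2-morphisms glue as well. The extension is fully faithful
if `F` is, and it is essentially surjective if moreover every object of `𝒵` is locally in the image
(`extFunctor_faithful`, `extFunctor_full`, `extFunctor_exists_iso`). In particular the
stackification of `⌊G\Map(G, 𝒳)⌋` is a stack without a separate proof: it is equivalent to a stack
over `C` (`isStack_of_fullyFaithful`, `isEquivalence_of_fullyFaithful`).

That torsors over a stack form a stack (`isStack_unparStack`) is the longest part. Arrows of torsors
over `𝒳` are glued from the sections of the source which lie over the covering sieve, as a
2-morphism to `𝒳` extends uniquely from a covering subpresheaf (`Probe.exists_extension`). A descent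
datum of torsors is glued to the presheaf of its compatible families of sections
(`TorsorDatum.Fam`, `TorsorDatum.exists_descent`); on the part of the glued torsor over the sieve
the given maps to `𝒳` define a morphism, and this extends to the whole torsor because `𝒳` is a stack
(`exists_extension_of_covering`).

Descent is formulated throughout in terms of arrows and objects of the total category
(`HasDescent`), which is equivalent to the formulation by restriction functors and avoids choices of
pullbacks.
-/

namespace UnparametrizedTorsor

variable {C : Type u} [Category.{v} C]

/-! ### Morphisms out of a presheaf -/

section Elements

variable {A : Cᵒᵖ ⥤ Type v} {𝒵 : BasedCategory.{v₂, u₂} C}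

/-- The object of `elts A` over `T` given by an element of `A(T)`. -/
abbrev elt {T : C} (x : A.obj (op T)) : (elts A).obj :=
  show A.Elementsᵒᵖ from op ⟨op T, x⟩

/-- The arrow of `elts A` over `g : T' ⟶ T` from `x' = g^* x` to `x`. -/
abbrev eltHom {T T' : C} {x : A.obj (op T)} {x' : A.obj (op T')} (g : T' ⟶ T)
    (h : A.map g.op x = x') : (elt x' : (elts A).obj) ⟶ elt x :=
  Quiver.Hom.op (V := A.Elements) (X := ⟨op T, x⟩) (Y := ⟨op T', x'⟩)
    (CategoryOfElements.homMk _ _ g.op h)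

lemma eltHom_isHomLift {T T' : C} {x : A.obj (op T)} {x' : A.obj (op T')} (g : T' ⟶ T)
    (h : A.map g.op x = x') : (elts A).p.IsHomLift g (eltHom g h) :=
  IsHomLift.map (p := (elts A).p) (eltHom g h)

lemma map_eltHom_isHomLift (D : elts A ⥤ᵇ 𝒵) {T T' : C} {x : A.obj (op T)} {x' : A.obj (op T')}
    (g : T' ⟶ T) (h : A.map g.op x = x') : 𝒵.p.IsHomLift g (D.map (eltHom g h)) :=
  have := eltHom_isHomLift g h
  D.preserves_isHomLift g _

lemma p_obj_elt (D : elts A ⥤ᵇ 𝒵) {T : C} (x : A.obj (op T)) : 𝒵.p.obj (D.obj (elt x)) = T :=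
  D.w_obj (elt x)

lemma map_eltHom_id (D : elts A ⥤ᵇ 𝒵) {T : C} (x : A.obj (op T))
    (h : A.map (𝟙 T : T ⟶ T).op x = x) :
    D.map (eltHom (𝟙 T) h) = 𝟙 (D.obj (elt x)) :=
  D.map_id (elt x)

lemma map_eltHom_comp (D : elts A ⥤ᵇ 𝒵) {T T' T'' : C} {x : A.obj (op T)} {x' : A.obj (op T')}
    {x'' : A.obj (op T'')} (g : T' ⟶ T) (h : A.map g.op x = x') (g' : T'' ⟶ T')
    (h' : A.map g'.op x' = x'') (h'' : A.map (g' ≫ g).op x = x'') :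
    D.map (eltHom (g' ≫ g) h'') = D.map (eltHom g' h') ≫ D.map (eltHom g h) :=
  D.map_comp (eltHom g' h') (eltHom g h)

/-- A morphism `elts A ⥤ᵇ 𝒵` from its values on elements and on arrows. -/
def mkEltsFunctor (obj : ∀ {T : C}, A.obj (op T) → 𝒵.obj)
    (map : ∀ {T T' : C} {x : A.obj (op T)} {x' : A.obj (op T')} (g : T' ⟶ T),
      A.map g.op x = x' → (obj x' ⟶ obj x))
    (lift : ∀ {T T' : C} {x : A.obj (op T)} {x' : A.obj (op T')} (g : T' ⟶ T)
      (h : A.map g.op x = x'), 𝒵.p.IsHomLift g (map g h))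
    (id : ∀ {T : C} (x : A.obj (op T)) (h : A.map (𝟙 T : T ⟶ T).op x = x), map (𝟙 T) h = 𝟙 _)
    (comp : ∀ {T T' T'' : C} {x : A.obj (op T)} {x' : A.obj (op T')}
      {x'' : A.obj (op T'')} (g : T' ⟶ T) (h : A.map g.op x = x') (g' : T'' ⟶ T')
      (h' : A.map g'.op x' = x'') (h'' : A.map (g' ≫ g).op x = x''),
      map (g' ≫ g) h'' = map g' h' ≫ map g h) : elts A ⥤ᵇ 𝒵 where
  obj e := obj e.unop.2
  map {e e'} f := map f.unop.1.unop f.unop.2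
  map_id e := id _ _
  map_comp f f' := comp _ _ _ _ _
  w := by
    have hobj : ∀ {T : C} (x : A.obj (op T)), 𝒵.p.obj (obj x) = T := fun {T} x =>
      have := lift (x := x) (𝟙 T) (Functor.map_id_apply A _ x)
      IsHomLift.domain_eq 𝒵.p (𝟙 T) (map (𝟙 T) (Functor.map_id_apply A _ x))
    refine CategoryTheory.Functor.ext (fun e => hobj e.unop.2) fun e e' f => ?_
    have := lift f.unop.1.unop f.unop.2
    exact IsHomLift.fac' 𝒵.p f.unop.1.unop (map f.unop.1.unop f.unop.2)

/-- A 2-morphism between morphisms `elts A ⥤ᵇ 𝒵` from its components. -/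
def mkEltsNatTrans {D E : elts A ⥤ᵇ 𝒵}
    (app : ∀ {T : C} (x : A.obj (op T)), D.obj (elt x) ⟶ E.obj (elt x))
    (lift : ∀ {T : C} (x : A.obj (op T)), 𝒵.p.IsHomLift (𝟙 T) (app x))
    (nat : ∀ {T T' : C} {x : A.obj (op T)} {x' : A.obj (op T')} (g : T' ⟶ T)
      (h : A.map g.op x = x'),
      D.map (eltHom g h) ≫ app x = app x' ≫ E.map (eltHom g h)) : D ⟶ E where
  app e := app e.unop.2
  naturality _ _ f := nat f.unop.1.unop f.unop.2
  isHomLift' e := lift e.unop.2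

lemma natTrans_app_isHomLift {D E : elts A ⥤ᵇ 𝒵} (α : D ⟶ E) {T : C} (x : A.obj (op T)) :
    𝒵.p.IsHomLift (𝟙 T) (α.toNatTrans.app (elt x)) :=
  α.isHomLift' (elt x)

lemma natTrans_ext {𝒲 : BasedCategory.{v₃, u₃} C} {D E : 𝒲 ⥤ᵇ 𝒵} {α β : D ⟶ E}
    (h : ∀ e, α.toNatTrans.app e = β.toNatTrans.app e) : α = β := by
  apply BasedNatTrans.homCategory.ext; ext e; exact h e

lemma natTrans_naturality {𝒲 : BasedCategory.{v₃, u₃} C} {D E : 𝒲 ⥤ᵇ 𝒵} (α : D ⟶ E)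
    {e e' : 𝒲.obj} (f : e ⟶ e') :
    D.map f ≫ α.toNatTrans.app e' = α.toNatTrans.app e ≫ E.map f :=
  α.toNatTrans.naturality f

lemma natTrans_nat {D E : elts A ⥤ᵇ 𝒵} (α : D ⟶ E) {T T' : C} {x : A.obj (op T)}
    {x' : A.obj (op T')} (g : T' ⟶ T) (h : A.map g.op x = x') :
    D.map (eltHom g h) ≫ α.toNatTrans.app (elt x) = α.toNatTrans.app (elt x') ≫
      E.map (eltHom g h) :=
  α.toNatTrans.naturality (eltHom g h)

end Elements

/-! ### Lifts in categories fibered in groupoids -/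

section Lift

variable {𝒵 : BasedCategory.{v₂, u₂} C}

/-- In a category fibered in groupoids every arrow can be cancelled on the right, among arrows over
the same arrow of the base. -/
lemma IsFiberedInGroupoids.cancel (h : IsFiberedInGroupoids 𝒵) {a b c : 𝒵.obj} {R S : C}
    (g : R ⟶ S) (φ : a ⟶ b) {χ χ' : c ⟶ a} (hχ : 𝒵.p.IsHomLift g χ) (hχ' : 𝒵.p.IsHomLift g χ')
    (e : χ ≫ φ = χ' ≫ φ) : χ = χ' := by
  obtain rfl := IsHomLift.codomain_eq 𝒵.p g χ
  exact h.hom_ext (𝒵.p.map φ) g φ χ χ' inferInstance hχ hχ' e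

lemma IsFiberedInGroupoids.exists_lift (h : IsFiberedInGroupoids 𝒵) {a b c : 𝒵.obj} {R S T : C}
    (f : S ⟶ T) (g : R ⟶ S) (φ : a ⟶ b) (ψ : c ⟶ b) (hφ : 𝒵.p.IsHomLift f φ)
    (hψ : 𝒵.p.IsHomLift (g ≫ f) ψ) : ∃ χ : c ⟶ a, 𝒵.p.IsHomLift g χ ∧ χ ≫ φ = ψ :=
  (h.existsUnique_lift f g (g ≫ f) φ ψ hφ hψ rfl).exists

lemma isHomLift_comp {a b c : 𝒵.obj} {R S T : C} {f : R ⟶ S} {g : S ⟶ T} {k : R ⟶ T} {φ : a ⟶ b}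
    {ψ : b ⟶ c} (hφ : 𝒵.p.IsHomLift f φ) (hψ : 𝒵.p.IsHomLift g ψ) (hk : f ≫ g = k) :
    𝒵.p.IsHomLift k (φ ≫ ψ) := by
  subst hk; infer_instance

lemma isHomLift_id_comp {a b c : 𝒵.obj} {R S : C} {f : R ⟶ S} {φ : a ⟶ b} {ψ : b ⟶ c}
    (hφ : 𝒵.p.IsHomLift (𝟙 R) φ) (hψ : 𝒵.p.IsHomLift f ψ) : 𝒵.p.IsHomLift f (φ ≫ ψ) :=
  isHomLift_comp hφ hψ (Category.id_comp f)

lemma isHomLift_comp_id {a b c : 𝒵.obj} {R S : C} {f : R ⟶ S} {φ : a ⟶ b} {ψ : b ⟶ c}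
    (hφ : 𝒵.p.IsHomLift f φ) (hψ : 𝒵.p.IsHomLift (𝟙 S) ψ) : 𝒵.p.IsHomLift f (φ ≫ ψ) :=
  isHomLift_comp hφ hψ (Category.comp_id f)

lemma mem_of_isHomLift {a b : 𝒵.obj} {T : C} {k : T ⟶ 𝒵.p.obj b} {φ : a ⟶ b}
    (hφ : 𝒵.p.IsHomLift k φ) (W : Sieve (𝒵.p.obj b)) (hk : W k) : W (𝒵.p.map φ) := by
  rw [IsHomLift.fac' 𝒵.p k φ]
  simpa using W.downward_closed hk (eqToHom (IsHomLift.domain_eq 𝒵.p k φ))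

lemma IsFiberedInGroupoids.comm_of_comp (h : IsFiberedInGroupoids 𝒵) {a b c d z : 𝒵.obj} {R S : C}
    (g : R ⟶ S) {t : a ⟶ b} {r : b ⟶ d} {l : a ⟶ c} {s : c ⟶ d} (π : d ⟶ z)
    (ht : 𝒵.p.IsHomLift g t) (hr : 𝒵.p.IsHomLift (𝟙 S) r) (hl : 𝒵.p.IsHomLift (𝟙 R) l)
    (hs : 𝒵.p.IsHomLift g s) (e : t ≫ r ≫ π = l ≫ s ≫ π) : t ≫ r = l ≫ s :=
  h.cancel g π (isHomLift_comp_id ht hr) (isHomLift_id_comp hl hs) (by simpa using e)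

/-- The morphism `A → 𝒵` which sends `x` to `f(x)^* z`, for `f : A ⟶ p(z)`. -/
noncomputable def pullFunctor (h : IsFiberedInGroupoids 𝒵) (z : 𝒵.obj) {A : Cᵒᵖ ⥤ Type v}
    (f : ∀ {T : C}, A.obj (op T) → (T ⟶ 𝒵.p.obj z))
    (hf : ∀ {T T' : C} {x : A.obj (op T)} {x' : A.obj (op T')} (g : T' ⟶ T),
      A.map g.op x = x' → g ≫ f x = f x') : elts A ⥤ᵇ 𝒵 :=
  mkEltsFunctor (fun x => h.pull z (f x))
    (fun g e => h.pullLift z _ _ g (hf g e))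
    (fun _ _ => h.pullLift_isHomLift _ _ _ _ _)
    (fun _ _ => h.pullLift_id _ _ _)
    (fun _ _ _ _ _ => h.pullLift_pullLift _ _ _ _ _ _ _ _ _)

/-- The 2-morphism given by arrows `f(x)^* a ⟶ b` over `f'(x)`. -/
noncomputable def pullNatTrans (h : IsFiberedInGroupoids 𝒵) {a b : 𝒵.obj} {A : Cᵒᵖ ⥤ Type v}
    (f : ∀ {T : C}, A.obj (op T) → (T ⟶ 𝒵.p.obj a))
    (hf : ∀ {T T' : C} {x : A.obj (op T)} {x' : A.obj (op T')} (g : T' ⟶ T),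
      A.map g.op x = x' → g ≫ f x = f x')
    (f' : ∀ {T : C}, A.obj (op T) → (T ⟶ 𝒵.p.obj b))
    (hf' : ∀ {T T' : C} {x : A.obj (op T)} {x' : A.obj (op T')} (g : T' ⟶ T),
      A.map g.op x = x' → g ≫ f' x = f' x')
    (m : ∀ {T : C} (x : A.obj (op T)), h.pull a (f x) ⟶ b)
    (hm : ∀ {T : C} (x : A.obj (op T)), 𝒵.p.IsHomLift (f' x) (m x))
    (nat : ∀ {T T' : C} {x : A.obj (op T)} {x' : A.obj (op T')} (g : T' ⟶ T)
      (e : A.map g.op x = x'), h.pullLift a _ _ g (hf g e) ≫ m x = m x') :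
    pullFunctor h a f hf ⟶ pullFunctor h b f' hf' :=
  mkEltsNatTrans
    (fun {T} x => h.lift (f' x) (𝟙 T) (f' x) (h.pullMap b _) (m x)
      (h.pullMap_isHomLift _ _) (hm x) (Category.id_comp _).symm)
    (fun x => h.lift_isHomLift _ _ _ _ _ _ _ _)
    (fun {T T' x x'} g e => by
      have hx := h.lift_comp (f' x) (𝟙 T) (f' x) (h.pullMap b _) (m x)
        (h.pullMap_isHomLift _ _) (hm x) (Category.id_comp _).symm
      have hx' := h.lift_comp (f' x') (𝟙 T') (f' x') (h.pullMap b _) (m x')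
        (h.pullMap_isHomLift _ _) (hm x') (Category.id_comp _).symm
      refine h.comm_of_comp g (h.pullMap b (f' x)) (h.pullLift_isHomLift _ _ _ _ (hf g e))
        (h.lift_isHomLift _ _ _ _ _ _ _ _) (h.lift_isHomLift _ _ _ _ _ _ _ _)
        (h.pullLift_isHomLift _ _ _ _ (hf' g e)) ?_
      exact (congrArg (h.pullLift a _ _ g (hf g e) ≫ ·) hx).trans ((nat g e).trans
        (hx'.symm.trans (congrArg (_ ≫ ·) (h.pullLift_pullMap _ _ _ _ (hf' g e)).symm))))

lemma pullNatTrans_app_pullMap (h : IsFiberedInGroupoids 𝒵) {a b : 𝒵.obj} {A : Cᵒᵖ ⥤ Type v}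
    (f : ∀ {T : C}, A.obj (op T) → (T ⟶ 𝒵.p.obj a)) (hf)
    (f' : ∀ {T : C}, A.obj (op T) → (T ⟶ 𝒵.p.obj b)) (hf')
    (m : ∀ {T : C} (x : A.obj (op T)), h.pull a (f x) ⟶ b) (hm) (nat) {T : C} (x : A.obj (op T)) :
    (pullNatTrans h f hf f' hf' m hm nat).toNatTrans.app (elt x) ≫ h.pullMap b (f' x) = m x :=
  h.lift_comp (f' x) (𝟙 T) (f' x) (h.pullMap b _) (m x)
        (h.pullMap_isHomLift _ _) (hm x) (Category.id_comp _).symm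

end Lift

/-! ### Effective descent in the total category -/

section Descent

variable {𝒵 : BasedCategory.{v₂, u₂} C} (J : GrothendieckTopology C)

/-- Effective descent in terms of arrows and objects of the total category: arrows `a ⟶ b` over a
given arrow of `C` are determined by, and can be glued from, their restrictions to a covering sieve
of the base of `a`, and every descent datum has a cocone whose legs lie over the arrows of the
sieve. -/
structure HasDescent (𝒵 : BasedCategory.{v₂, u₂} C) : Prop where
  hom_ext : ∀ {a b : 𝒵.obj} (W : Sieve (𝒵.p.obj a)), W ∈ J (𝒵.p.obj a) → ∀ (m m' : a ⟶ b),
    𝒵.p.map m = 𝒵.p.map m' →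
    (∀ {c : 𝒵.obj} (φ : c ⟶ a), W (𝒵.p.map φ) → φ ≫ m = φ ≫ m') → m = m'
  exists_hom : ∀ {a b : 𝒵.obj} (f : 𝒵.p.obj a ⟶ 𝒵.p.obj b) (W : Sieve (𝒵.p.obj a)),
    W ∈ J (𝒵.p.obj a) → ∀ (m : ∀ {c : 𝒵.obj} (φ : c ⟶ a), W (𝒵.p.map φ) → (c ⟶ b)),
    (∀ {c : 𝒵.obj} (φ : c ⟶ a) (h : W (𝒵.p.map φ)), 𝒵.p.map (m φ h) = 𝒵.p.map φ ≫ f) →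
    (∀ {c c' : 𝒵.obj} (ψ : c' ⟶ c) (φ : c ⟶ a) (h : W (𝒵.p.map φ)) (h' : W (𝒵.p.map (ψ ≫ φ))),
      m (ψ ≫ φ) h' = ψ ≫ m φ h) →
    ∃ m' : a ⟶ b, 𝒵.p.map m' = f ∧ ∀ {c : 𝒵.obj} (φ : c ⟶ a) (h : W (𝒵.p.map φ)), φ ≫ m' = m φ h
  exists_obj : ∀ {S : C} (R : Sieve S), R ∈ J S → ∀ (D : elts R.functor ⥤ᵇ 𝒵),
    ∃ (a : 𝒵.obj) (i : ∀ {T : C} (x : R.functor.obj (op T)), D.obj (elt x) ⟶ a),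
      𝒵.p.obj a = S ∧ (∀ {T : C} (x : R.functor.obj (op T)), 𝒵.p.IsHomLift x.1 (i x)) ∧
      ∀ {T T' : C} {x : R.functor.obj (op T)} {x' : R.functor.obj (op T')} (g : T' ⟶ T)
        (h : R.functor.map g.op x = x'), D.map (eltHom g h) ≫ i x = i x'

variable {J}

/-- An arrow `m : a ⟶ b` is recovered from the 2-morphism `k^* a ⟶ (k p(m))^* b`, so that the
faithfulness of restriction to a covering sieve applies. -/
lemma IsStack.hom_ext (h𝒵 : IsStack J 𝒵) {a b : 𝒵.obj} (W : Sieve (𝒵.p.obj a))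
    (hW : W ∈ J (𝒵.p.obj a)) (m m' : a ⟶ b) (hm : 𝒵.p.map m = 𝒵.p.map m')
    (hmm : ∀ {c : 𝒵.obj} (φ : c ⟶ a), W (𝒵.p.map φ) → φ ≫ m = φ ≫ m') : m = m' := by
  have h := h𝒵.fibered
  have := h𝒵.descent _ W hW
  let α (n : a ⟶ b) (hn : 𝒵.p.map n = 𝒵.p.map m') :
      pullFunctor h a (A := yoneda.obj (𝒵.p.obj a)) (fun k => k) (fun g e => e) ⟶
      pullFunctor h b (A := yoneda.obj (𝒵.p.obj a)) (fun k => k ≫ 𝒵.p.map m')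
        (fun g e => by rw [← e]; exact (Category.assoc _ _ _).symm) :=
    pullNatTrans h _ _ _ _ (fun k => h.pullMap a k ≫ n)
      (fun k => isHomLift_comp (h.pullMap_isHomLift a k) (IsHomLift.map (p := 𝒵.p) n)
        (congrArg (k ≫ ·) hn))
      (fun g e => by rw [← Category.assoc, h.pullLift_pullMap])
  have hα (n hn) {T : C} (k : T ⟶ 𝒵.p.obj a) :
      (α n hn).toNatTrans.app (elt k) ≫ h.pullMap b (k ≫ 𝒵.p.map m') = h.pullMap a k ≫ n :=
    pullNatTrans_app_pullMap h _ _ _ _ _ _ _ _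
  have key : α m hm = α m' rfl := by
    apply (precomp W.functorInclusion 𝒵).map_injective
    refine natTrans_ext fun e => ?_
    change (α m hm).toNatTrans.app (elt (e.unop.2.1 : _ ⟶ 𝒵.p.obj a)) =
      (α m' rfl).toNatTrans.app (elt (e.unop.2.1 : _ ⟶ 𝒵.p.obj a))
    refine h.cancel (𝟙 _) (h.pullMap b (e.unop.2.1 ≫ 𝒵.p.map m')) (natTrans_app_isHomLift _ _)
      (natTrans_app_isHomLift _ _) ?_
    refine (hα m hm _).trans ((hmm _ ?_).trans (hα m' rfl _).symm)
    exact mem_of_isHomLift (h.pullMap_isHomLift a e.unop.2.1) W e.unop.2.2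
  have e1 : h.pullMap a (𝟙 _) ≫ m = h.pullMap a (𝟙 _) ≫ m' := by
    rw [← hα m hm (𝟙 _), key, hα m' rfl]
  have : IsIso (h.pullMap a (𝟙 _)) :=
    have := h.pullMap_isHomLift a (𝟙 _)
    isIso_of_isFiberedInGroupoids h (S := 𝒵.p.obj a) _
  exact (cancel_epi _).1 e1

lemma comp_comp_comp_eq {D : Type*} [Category* D] {p₀ p₁ q₀ q₁ a b : D} {π₀ : p₀ ⟶ a} {s : p₀ ⟶ p₁}
    {π₁ : p₁ ⟶ a} {ι : a ⟶ p₁} {β₁ : p₁ ⟶ q₁} {ρ₁ : q₁ ⟶ b} {β₀ : p₀ ⟶ q₀} {t : q₀ ⟶ q₁}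
    {ρ₀ : q₀ ⟶ b} (hι : π₁ ≫ ι = 𝟙 _) (h₁ : s ≫ π₁ = π₀) (h₂ : t ≫ ρ₁ = ρ₀)
    (h₃ : s ≫ β₁ = β₀ ≫ t) : π₀ ≫ ι ≫ β₁ ≫ ρ₁ = β₀ ≫ ρ₀ := by
  rw [← h₁, ← h₂, Category.assoc, reassoc_of% hι, reassoc_of% h₃]

lemma comp_comp_eq {D : Type*} [Category* D] {p₀ p₁ q₀ q₁ b : D} {s : p₀ ⟶ p₁}
    {β₁ : p₁ ⟶ q₁} {ρ₁ : q₁ ⟶ b} {β₀ : p₀ ⟶ q₀} {t : q₀ ⟶ q₁}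
    {ρ₀ : q₀ ⟶ b} (h₂ : t ≫ ρ₁ = ρ₀) (h₃ : s ≫ β₁ = β₀ ≫ t) : s ≫ β₁ ≫ ρ₁ = β₀ ≫ ρ₀ := by
  rw [← h₂, reassoc_of% h₃]

/-- The given arrows define a 2-morphism `k^* a ⟶ (k f)^* b` on the covering sieve; it extends to
the base of `a`, and its value at the identity is the glued arrow. -/
lemma IsStack.exists_hom (h𝒵 : IsStack J 𝒵) {a b : 𝒵.obj} (f : 𝒵.p.obj a ⟶ 𝒵.p.obj b)
    (W : Sieve (𝒵.p.obj a)) (hW : W ∈ J (𝒵.p.obj a))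
    (m : ∀ {c : 𝒵.obj} (φ : c ⟶ a), W (𝒵.p.map φ) → (c ⟶ b))
    (hm : ∀ {c : 𝒵.obj} (φ : c ⟶ a) (h : W (𝒵.p.map φ)), 𝒵.p.map (m φ h) = 𝒵.p.map φ ≫ f)
    (nat : ∀ {c c' : 𝒵.obj} (ψ : c' ⟶ c) (φ : c ⟶ a) (h : W (𝒵.p.map φ))
      (h' : W (𝒵.p.map (ψ ≫ φ))), m (ψ ≫ φ) h' = ψ ≫ m φ h) :
    ∃ m' : a ⟶ b, 𝒵.p.map m' = f ∧
      ∀ {c : 𝒵.obj} (φ : c ⟶ a) (h : W (𝒵.p.map φ)), φ ≫ m' = m φ h := by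
  have h := h𝒵.fibered
  have := h𝒵.descent _ W hW
  let A := pullFunctor h a (A := yoneda.obj (𝒵.p.obj a)) (fun k => k) (fun g e => e)
  let B := pullFunctor h b (A := yoneda.obj (𝒵.p.obj a)) (fun k => k ≫ f)
        (fun g e => by rw [← e]; exact (Category.assoc _ _ _).symm)
  have hmem {T : C} (k : T ⟶ 𝒵.p.obj a) (hk : W k) : W (𝒵.p.map (h.pullMap a k)) :=
    mem_of_isHomLift (h.pullMap_isHomLift a k) W hk
  let α : (precomp W.functorInclusion 𝒵).obj A ⟶ (precomp W.functorInclusion 𝒵).obj B :=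
    pullNatTrans h (A := W.functor) (fun k => k.1) (fun g e => congrArg Subtype.val e)
      (fun k => k.1 ≫ f) (fun g e => by rw [← e]; exact (Category.assoc _ _ _).symm)
      (fun k => m (h.pullMap a k.1) (hmem k.1 k.2))
      (fun k => by
        have := h.pullMap_isHomLift a k.1
        apply IsHomLift.of_fac' 𝒵.p _ _ (h.pull_obj a k.1) rfl
        rw [hm, IsHomLift.fac' 𝒵.p k.1 (h.pullMap a k.1)]
        simp)
      (fun {T T' k k'} g e => by
        have e' : g ≫ k.1 = k'.1 := congrArg Subtype.val e
        have e2 := h.pullLift_pullMap a k'.1 k.1 g e'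
        rw [← nat _ _ _ (by rw [e2]; exact hmem _ k'.2)]
        congr 1)
  have hα {T : C} (k : W.functor.obj (op T)) :
      α.toNatTrans.app (elt k) ≫ h.pullMap b (k.1 ≫ f) = m (h.pullMap a k.1) (hmem k.1 k.2) :=
    pullNatTrans_app_pullMap h _ _ _ _ _ _ _ _
  obtain ⟨β, hβ⟩ := (precomp W.functorInclusion 𝒵).map_surjective α
  have hβα {T : C} (k : W.functor.obj (op T)) :
      β.toNatTrans.app (elt k.1) = α.toNatTrans.app (elt k) := by
    rw [← hβ]; rfl
  have hi := h.pullMap_isHomLift a (𝟙 _)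
  have : IsIso (h.pullMap a (𝟙 _)) := isIso_of_isFiberedInGroupoids h (S := 𝒵.p.obj a) _
  have hinv := IsIso.hom_inv_id (h.pullMap a (𝟙 _))
  have hβ1 : 𝒵.p.IsHomLift (𝟙 _) (β.toNatTrans.app (elt (𝟙 (𝒵.p.obj a)))) :=
    natTrans_app_isHomLift _ _
  let m' : a ⟶ b := inv (h.pullMap a (𝟙 _)) ≫ β.toNatTrans.app (elt (𝟙 (𝒵.p.obj a))) ≫
    h.pullMap b (𝟙 _ ≫ f)
  have hm' : 𝒵.p.IsHomLift f m' :=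
    isHomLift_id_comp (IsHomLift.lift_id_inv_isIso 𝒵.p _ _)
      (isHomLift_comp hβ1 (h.pullMap_isHomLift b (𝟙 _ ≫ f)) (by
        exact (Category.id_comp _).trans (Category.id_comp f)))
  refine ⟨m', (IsHomLift.eq_of_isHomLift 𝒵.p f m').symm, fun {c} φ hφ => ?_⟩
  -- `φ` factors through `k^* a` for `k = p(φ)`
  obtain ⟨χ, hχ, hχφ⟩ := h.exists_lift (𝒵.p.map φ) (𝟙 _) (h.pullMap a (𝒵.p.map φ)) φ
    (h.pullMap_isHomLift _ _) inferInstance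
  let g : (elt (𝒵.p.map φ) : (elts (yoneda.obj (𝒵.p.obj a))).obj) ⟶ elt (𝟙 (𝒵.p.obj a)) :=
    eltHom (𝒵.p.map φ) (Category.comp_id _)
  have h1 : A.map g ≫ h.pullMap a (𝟙 _) = h.pullMap a (𝒵.p.map φ) :=
    h.pullLift_pullMap _ _ _ (𝒵.p.map φ) (Category.comp_id _)
  have h2 : B.map g ≫ h.pullMap b (𝟙 _ ≫ f) = h.pullMap b (𝒵.p.map φ ≫ f) :=
    h.pullLift_pullMap _ _ _ (𝒵.p.map φ) (by simp)
  have h4 : h.pullMap a (𝒵.p.map φ) ≫ m' = m (h.pullMap a (𝒵.p.map φ)) (hmem _ hφ) :=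
    (comp_comp_comp_eq hinv h1 h2 (natTrans_naturality β g)).trans
      ((congrArg (· ≫ h.pullMap b (𝒵.p.map φ ≫ f)) (hβα ⟨𝒵.p.map φ, hφ⟩)).trans
        (hα ⟨𝒵.p.map φ, hφ⟩))
  have h5 := nat χ (h.pullMap a (𝒵.p.map φ)) (hmem _ hφ) (by rw [hχφ]; exact hφ)
  rw [← h4, ← Category.assoc] at h5
  simp only [hχφ] at h5
  exact h5.symm

/-- Effectiveness of descent: the glued object is the value of the extended morphism at the
identity. -/
lemma IsStack.exists_obj (h𝒵 : IsStack J 𝒵) {S : C} (R : Sieve S) (hR : R ∈ J S)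
    (D : elts R.functor ⥤ᵇ 𝒵) :
    ∃ (a : 𝒵.obj) (i : ∀ {T : C} (x : R.functor.obj (op T)), D.obj (elt x) ⟶ a),
      𝒵.p.obj a = S ∧ (∀ {T : C} (x : R.functor.obj (op T)), 𝒵.p.IsHomLift x.1 (i x)) ∧
      ∀ {T T' : C} {x : R.functor.obj (op T)} {x' : R.functor.obj (op T')} (g : T' ⟶ T)
        (h : R.functor.map g.op x = x'), D.map (eltHom g h) ≫ i x = i x' := by
  have := h𝒵.descent S R hR
  let F := (precomp R.functorInclusion 𝒵).objPreimage D
  let e : D ⟶ (precomp R.functorInclusion 𝒵).obj F :=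
    ((precomp R.functorInclusion 𝒵).objObjPreimageIso D).inv
  let r {T : C} (x : T ⟶ S) : (elt x : (elts (yoneda.obj S)).obj) ⟶ elt (𝟙 S) :=
    eltHom x (Category.comp_id x)
  refine ⟨F.obj (elt (𝟙 S)), fun x => e.toNatTrans.app (elt x) ≫ F.map (r x.1), p_obj_elt F _,
    fun x => isHomLift_id_comp (natTrans_app_isHomLift e x) (map_eltHom_isHomLift _ _ _), ?_⟩
  intro T T' x x' g h
  have h' : g ≫ x.1 = x'.1 := congrArg Subtype.val h
  have h2 : F.map (eltHom g h') ≫ F.map (r x.1) = F.map (r x'.1) := by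
    rw [← Functor.map_comp]; congr 1
    exact Quiver.Hom.unop_inj (Subtype.ext (congrArg Quiver.Hom.op h'))
  exact comp_comp_eq h2 (natTrans_nat e g h)

lemma IsStack.hasDescent (h𝒵 : IsStack J 𝒵) : HasDescent J 𝒵 where
  hom_ext := h𝒵.hom_ext
  exists_hom := h𝒵.exists_hom
  exists_obj := h𝒵.exists_obj

/-- Arrows over `f` out of `a` agree if they agree after composition with arrows `i s` into `a` over
the arrows `s` of a covering sieve. -/
lemma HasDescent.ext_of_legs (hd : HasDescent J 𝒵) (h : IsFiberedInGroupoids 𝒵) {S S' : C}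
    {f : S ⟶ S'} {a b : 𝒵.obj} {W : Sieve S} (hW : W ∈ J S)
    {c : ∀ {T : C} (s : T ⟶ S), W s → 𝒵.obj} {i : ∀ {T : C} (s : T ⟶ S) (hs : W s), c s hs ⟶ a}
    (hi : ∀ {T : C} (s : T ⟶ S) (hs : W s), 𝒵.p.IsHomLift s (i s hs)) {m m' : a ⟶ b}
    (hm : 𝒵.p.IsHomLift f m) (hm' : 𝒵.p.IsHomLift f m')
    (e : ∀ {T : C} (s : T ⟶ S) (hs : W s), i s hs ≫ m = i s hs ≫ m') : m = m' := by
  obtain rfl := IsHomLift.domain_eq 𝒵.p f m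
  obtain rfl := IsHomLift.codomain_eq 𝒵.p f m
  have h1 := IsHomLift.eq_of_isHomLift 𝒵.p f m
  have h2 := IsHomLift.eq_of_isHomLift 𝒵.p f m'
  refine hd.hom_ext W hW m m' (h1.symm.trans h2) fun {c'} φ hφ => ?_
  obtain ⟨χ, -, hχ⟩ := h.exists_lift (𝒵.p.map φ) (𝟙 _) (i _ hφ) φ (hi _ hφ) inferInstance
  rw [← hχ, Category.assoc, Category.assoc, e]

/-- Gluing of an arrow over `f` from its compositions `m s` with arrows `i s` into `a` over the
arrows `s` of a covering sieve. -/
lemma HasDescent.glue (hd : HasDescent J 𝒵) (h : IsFiberedInGroupoids 𝒵) {S S' : C}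
    (f : S ⟶ S') {a b : 𝒵.obj} (ha : 𝒵.p.obj a = S) (hb : 𝒵.p.obj b = S') {W : Sieve S}
    (hW : W ∈ J S) (c : ∀ {T : C} (s : T ⟶ S), W s → 𝒵.obj)
    (i : ∀ {T : C} (s : T ⟶ S) (hs : W s), c s hs ⟶ a)
    (hi : ∀ {T : C} (s : T ⟶ S) (hs : W s), 𝒵.p.IsHomLift s (i s hs))
    (m : ∀ {T : C} (s : T ⟶ S) (hs : W s), c s hs ⟶ b)
    (hm : ∀ {T : C} (s : T ⟶ S) (hs : W s), 𝒵.p.IsHomLift (s ≫ f) (m s hs))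
    (nat : ∀ {T T' : C} (s : T ⟶ S) (hs : W s) (g : T' ⟶ T) (hs' : W (g ≫ s)),
      ∃ ψ : c (g ≫ s) hs' ⟶ c s hs, 𝒵.p.IsHomLift g ψ ∧ ψ ≫ i s hs = i (g ≫ s) hs' ∧
        ψ ≫ m s hs = m (g ≫ s) hs') :
    ∃ m' : a ⟶ b, 𝒵.p.IsHomLift f m' ∧
      ∀ {T : C} (s : T ⟶ S) (hs : W s), i s hs ≫ m' = m s hs := by
  subst ha hb
  have hl {c' : 𝒵.obj} (φ : c' ⟶ a) (hφ : W (𝒵.p.map φ)) :=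
    h.exists_lift (𝒵.p.map φ) (𝟙 _) (i _ hφ) φ (hi _ hφ) inferInstance
  let l {c' : 𝒵.obj} (φ : c' ⟶ a) (hφ : W (𝒵.p.map φ)) : c' ⟶ c (𝒵.p.map φ) hφ :=
    (hl φ hφ).choose
  have l1 {c' : 𝒵.obj} (φ : c' ⟶ a) (hφ : W (𝒵.p.map φ)) : 𝒵.p.IsHomLift (𝟙 _) (l φ hφ) :=
    (hl φ hφ).choose_spec.1
  have l2 {c' : 𝒵.obj} (φ : c' ⟶ a) (hφ : W (𝒵.p.map φ)) : l φ hφ ≫ i _ hφ = φ :=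
    (hl φ hφ).choose_spec.2
  have hlm {c' : 𝒵.obj} (φ : c' ⟶ a) (hφ : W (𝒵.p.map φ)) :
      𝒵.p.map (l φ hφ ≫ m _ hφ) = 𝒵.p.map φ ≫ f :=
    have := isHomLift_id_comp (l1 φ hφ) (hm _ hφ)
    (IsHomLift.eq_of_isHomLift 𝒵.p _ _).symm
  obtain ⟨m', hm', hmm'⟩ := hd.exists_hom f W hW (fun φ hφ => l φ hφ ≫ m _ hφ) hlm (by
    intro c₁ c₂ ψ φ hφ hφ'
    obtain ⟨χ, hχ, hχi, hχm⟩ := nat (𝒵.p.map φ) hφ (𝒵.p.map ψ) (by simpa using hφ')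
    have key : ∀ (k : 𝒵.p.obj c₂ ⟶ 𝒵.p.obj a) (hk : W k) (_ : k = 𝒵.p.map ψ ≫ 𝒵.p.map φ)
        (lk : c₂ ⟶ c k hk) (_ : 𝒵.p.IsHomLift (𝟙 (𝒵.p.obj c₂)) lk) (_ : lk ≫ i k hk = ψ ≫ φ),
        lk ≫ m k hk = ψ ≫ l φ hφ ≫ m _ hφ := by
      rintro k hk rfl lk h1 h2
      rw [← hχm, ← Category.assoc, ← Category.assoc]
      congr 1
      refine h.cancel (𝒵.p.map ψ) (i _ hφ) (isHomLift_id_comp h1 hχ)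
        (isHomLift_comp_id inferInstance (l1 _ _)) ?_
      rw [Category.assoc, hχi, h2, Category.assoc, l2]
    exact key _ _ (𝒵.p.map_comp _ _) _ (l1 _ _) (l2 _ _))
  refine ⟨m', hm' ▸ inferInstance, fun {T} s hs => ?_⟩
  have hi' := hi s hs
  have hs' : W (𝒵.p.map (i s hs)) := mem_of_isHomLift hi' W hs
  rw [hmm' (i s hs) hs']
  -- `p(i s)` is `s` up to the identification of `p(c s)` with `T`
  have hT : 𝒵.p.obj (c s hs) = T := IsHomLift.domain_eq 𝒵.p s (i s hs)
  obtain ⟨ψ, hψ, hψi, hψm⟩ := nat s hs (eqToHom hT) (W.downward_closed hs _)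
  have key : ∀ (k : 𝒵.p.obj (c s hs) ⟶ 𝒵.p.obj a) (hk : W k) (_ : k = eqToHom hT ≫ s)
      (lk : c s hs ⟶ c k hk) (_ : 𝒵.p.IsHomLift (𝟙 (𝒵.p.obj (c s hs))) lk)
      (_ : lk ≫ i k hk = i s hs), lk ≫ m k hk = m s hs := by
    rintro k hk rfl lk h1 h2
    have : lk ≫ ψ = 𝟙 _ := h.cancel (eqToHom hT) (i s hs) (isHomLift_id_comp h1 hψ)
      (IsHomLift.id_lift_eqToHom_domain hT rfl) (by rw [Category.assoc, hψi, h2, Category.id_comp])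
    rw [← hψm, ← Category.assoc, this, Category.id_comp]
  exact key _ _ (by simpa using IsHomLift.fac' 𝒵.p s (i s hs)) _ (l1 _ _) (l2 _ _)

/-- A category fibered in groupoids with effective descent in the total category is a stack. -/
lemma HasDescent.isStack (hd : HasDescent J 𝒵) (h : IsFiberedInGroupoids 𝒵) : IsStack J 𝒵 where
  fibered := h
  descent S R hR := by
    let r {T T' : C} (x : T ⟶ S) (s : T' ⟶ T) :
        (elt (s ≫ x) : (elts (yoneda.obj S)).obj) ⟶ elt x := eltHom s rfl
    have hr (F : elts (yoneda.obj S) ⥤ᵇ 𝒵) {T T' : C} (x : T ⟶ S) (s : T' ⟶ T) :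
        𝒵.p.IsHomLift s (F.map (r x s)) := map_eltHom_isHomLift F s _
    have hext {F F' : elts (yoneda.obj S) ⥤ᵇ 𝒵} {T T' : C} (x : T ⟶ S) (x' : T' ⟶ S) (g : T ⟶ T')
        {m m' : F.obj (elt x) ⟶ F'.obj (elt x')} (hm : 𝒵.p.IsHomLift g m)
        (hm' : 𝒵.p.IsHomLift g m')
        (e : ∀ {T'' : C} (s : T'' ⟶ T), R (s ≫ x) → F.map (r x s) ≫ m = F.map (r x s) ≫ m') :
        m = m' :=
      hd.ext_of_legs h (J.pullback_stable x hR) (i := fun s _ => F.map (r x s))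
        (fun s _ => hr F x s) hm hm' fun s hs => e s hs
    refine { faithful := ⟨?_⟩, full := ⟨?_⟩, essSurj := ⟨?_⟩ }
    · intro F F' α β hαβ
      refine natTrans_ext fun e => ?_
      have key {T : C} (x : T ⟶ S) : α.toNatTrans.app (elt x) = β.toNatTrans.app (elt x) := by
        refine hext x x (𝟙 _) (natTrans_app_isHomLift _ _) (natTrans_app_isHomLift _ _) ?_
        intro T' s hs
        rw [natTrans_naturality, natTrans_naturality]
        congr 1
        exact congrArg (fun γ => γ.toNatTrans.app (elt (⟨s ≫ x, hs⟩ : R.functor.obj (op T')))) hαβ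
      exact key e.unop.2
    · intro F F' α
      have hex {T : C} (x : T ⟶ S) := hd.glue h (𝟙 T) (p_obj_elt F x) (p_obj_elt F' x)
        (J.pullback_stable x hR) (fun s _ => F.obj (elt (s ≫ x))) (fun s _ => F.map (r x s))
        (fun s _ => hr F x s)
        (fun {T'} s hs => α.toNatTrans.app (elt (⟨s ≫ x, hs⟩ : R.functor.obj (op T'))) ≫
          F'.map (r x s))
        (fun s hs => isHomLift_comp (natTrans_app_isHomLift α _) (hr F' x s) (by simp))
        (fun {T₁ T₂} s hs g hs' => by
          have e : (yoneda.obj S).map g.op (s ≫ x) = (g ≫ s) ≫ x := (Category.assoc _ _ _).symm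
          have e1 (E : elts (yoneda.obj S) ⥤ᵇ 𝒵) :
              E.map (eltHom g e) ≫ E.map (r x s) = E.map (r x (g ≫ s)) :=
            (map_eltHom_comp E s rfl g e rfl).symm
          exact ⟨F.map (eltHom g e), map_eltHom_isHomLift F g e, e1 F,
            comp_comp_eq (e1 F') (natTrans_nat α (x := ⟨s ≫ x, hs⟩) (x' := ⟨(g ≫ s) ≫ x, hs'⟩)
              g (Subtype.ext e))⟩)
      choose m hm hmr using @hex
      have hmr' {T T' : C} (x : T ⟶ S) (s : T' ⟶ T) (y : T' ⟶ S) (hy : R y)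
          (e : (yoneda.obj S).map s.op x = y) : F.map (eltHom s e) ≫ m x =
          α.toNatTrans.app (elt (⟨y, hy⟩ : R.functor.obj (op T'))) ≫ F'.map (eltHom s e) := by
        obtain rfl : s ≫ x = y := e
        exact hmr x s hy
      refine ⟨mkEltsNatTrans m hm fun {T T' x x'} g e => ?_, natTrans_ext fun e => ?_⟩
      · obtain rfl : g ≫ x = x' := e
        refine hext (g ≫ x) x g (isHomLift_comp_id (map_eltHom_isHomLift _ _ _) (hm x))
          (isHomLift_id_comp (hm _) (map_eltHom_isHomLift _ _ _)) fun s hs => ?_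
        have e' : (yoneda.obj S).map (s ≫ g).op x = s ≫ g ≫ x := Category.assoc _ _ _
        have e1 (E : elts (yoneda.obj S) ⥤ᵇ 𝒵) : E.map (r (g ≫ x) s) ≫ E.map (eltHom g rfl) =
            E.map (eltHom (s ≫ g) e') := (map_eltHom_comp E g rfl s rfl e').symm
        refine (Category.assoc _ _ _).symm.trans ((congrArg (· ≫ m x) (e1 F)).trans ?_)
        refine (hmr' x (s ≫ g) _ hs e').trans (Eq.trans ?_ (Category.assoc _ _ _))
        refine Eq.trans ?_ (congrArg (· ≫ F'.map (eltHom g rfl)) (hmr' (g ≫ x) s _ hs rfl).symm)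
        exact (congrArg (_ ≫ ·) (e1 F').symm).trans (Category.assoc _ _ _).symm
      · have key {T : C} (x : R.functor.obj (op T)) : m x.1 = α.toNatTrans.app (elt x) := by
          have e : (yoneda.obj S).map (𝟙 T : T ⟶ T).op x.1 = x.1 := Category.id_comp _
          have h1 := hmr' x.1 (𝟙 T) x.1 x.2 e
          rw [map_eltHom_id F x.1 e] at h1
          exact (Category.id_comp _).symm.trans (h1.trans
            ((congrArg (_ ≫ ·) (map_eltHom_id F' x.1 e)).trans (Category.comp_id _)))
        exact key e.unop.2
    · intro D
      obtain ⟨a, i, rfl, hi, hi'⟩ := hd.exists_obj R hR D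
      let F := pullFunctor h a (A := yoneda.obj (𝒵.p.obj a)) (fun k => k) (fun g e => e)
      let α : D ⟶ (precomp R.functorInclusion 𝒵).obj F :=
        mkEltsNatTrans (fun {T} x => h.lift x.1 (𝟙 T) x.1 (h.pullMap a x.1) (i x)
            (h.pullMap_isHomLift _ _) (hi x) (Category.id_comp _).symm)
          (fun x => h.lift_isHomLift _ _ _ _ _ _ _ _)
          (fun {T T' x x'} g e => h.comm_of_comp g (h.pullMap a x.1) (map_eltHom_isHomLift D g e)
            (h.lift_isHomLift _ _ _ _ _ _ _ _) (h.lift_isHomLift _ _ _ _ _ _ _ _)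
            (h.pullLift_isHomLift a x'.1 x.1 g (congrArg Subtype.val e)) (by
              exact (congrArg (D.map (eltHom g e) ≫ ·) (h.lift_comp _ _ _ _ _ _ _ _)).trans
                ((hi' g e).trans ((h.lift_comp _ _ _ _ _ _ _ _).symm.trans
                  (congrArg (_ ≫ ·) (h.pullLift_pullMap a x'.1 x.1 g
                    (congrArg Subtype.val e)).symm)))))
      have : IsIso α := isIso_basedNatTrans h α
      exact ⟨F, ⟨(asIso α).symm⟩⟩

end Descent

/-! ### Arrows of the stackification -/

section LocalArrows

/-- Arrows of pairs agree if their components do. As the underlying maps are only known to agree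
pointwise, the components are compared through the arrow of `B` over the identity. -/
lemma Probe.hom_ext_of_app {𝒳 : BasedCategory.{v₂, u₂} C} {A B : Probe 𝒳} {α β : A ⟶ B}
    (hu : ∀ {T : C} (x : A.psh.obj (op T)), B.psh.map (𝟙 T : T ⟶ T).op (β.u.app _ x) = α.u.app _ x)
    (hγ : ∀ {T : C} (x : A.psh.obj (op T)),
      α.γ.toNatTrans.app (elt x) ≫ B.map.map (eltHom (𝟙 T) (hu x)) = β.γ.toNatTrans.app (elt x)) :
    α = β := by
  obtain ⟨u, γ⟩ := α
  obtain ⟨u', γ'⟩ := β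
  have h1 : u = u' := psh_hom_ext fun S x => (hu x).symm.trans (Functor.map_id_apply B.psh _ _)
  subst h1
  refine Probe.Hom.ext rfl (heq_of_eq (natTrans_ext fun e => ?_))
  exact (Category.comp_id _).symm.trans
    ((congrArg (_ ≫ ·) (map_eltHom_id B.map _ (hu e.unop.2)).symm).trans (hγ e.unop.2))

variable {J : GrothendieckTopology C} {𝒴 : BasedCategory.{v₂, u₂} C}

/-- The value of a descent datum at an arrow of its covering sieve. -/
def LocObj.val (X : LocObj J 𝒴) {T : C} (s : T ⟶ X.base) (hs : X.cover s) : 𝒴.obj :=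
  X.datum.obj (elt (⟨s, hs⟩ : X.cover.functor.obj (op T)))

/-- The restriction arrow of a descent datum. -/
def LocObj.res (X : LocObj J 𝒴) {T T' : C} {s : T ⟶ X.base} {hs : X.cover s} {s' : T' ⟶ X.base}
    {hs' : X.cover s'} (g : T' ⟶ T) (e : g ≫ s = s') : X.val s' hs' ⟶ X.val s hs :=
  X.datum.map (eltHom (A := X.cover.functor) (x := ⟨s, hs⟩) (x' := ⟨s', hs'⟩) g (Subtype.ext e))

lemma LocObj.p_val (X : LocObj J 𝒴) {T : C} (s : T ⟶ X.base) (hs : X.cover s) :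
    𝒴.p.obj (X.val s hs) = T :=
  p_obj_elt X.datum _

lemma LocObj.res_isHomLift (X : LocObj J 𝒴) {T T' : C} {s : T ⟶ X.base} {hs : X.cover s}
    {s' : T' ⟶ X.base} {hs' : X.cover s'} (g : T' ⟶ T) (e : g ≫ s = s') :
    𝒴.p.IsHomLift g (X.res (hs := hs) (hs' := hs') g e) :=
  map_eltHom_isHomLift X.datum _ _

lemma LocObj.res_id (X : LocObj J 𝒴) {T : C} {s : T ⟶ X.base} {hs : X.cover s} (e : 𝟙 T ≫ s = s) :
    X.res (hs := hs) (hs' := hs) (𝟙 T) e = 𝟙 _ :=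
  map_eltHom_id X.datum _ _

lemma LocObj.res_res (X : LocObj J 𝒴) {T T' T'' : C} {s : T ⟶ X.base} {hs : X.cover s}
    {s' : T' ⟶ X.base} {hs' : X.cover s'} {s'' : T'' ⟶ X.base} {hs'' : X.cover s''} (g : T' ⟶ T)
    (e : g ≫ s = s') (g' : T'' ⟶ T') (e' : g' ≫ s' = s'') :
    X.res (hs := hs') (hs' := hs'') g' e' ≫ X.res (hs := hs) g e =
      X.res (g' ≫ g) (by rw [Category.assoc, e, e']) :=
  (map_eltHom_comp X.datum _ _ _ _ _).symm

lemma LocObj.res_congr (X : LocObj J 𝒴) {T T' : C} {s : T ⟶ X.base} {hs : X.cover s}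
    {s' : T' ⟶ X.base} {hs' : X.cover s'} {g g' : T' ⟶ T} (h : g = g') {e : g ≫ s = s'}
    {e' : g' ≫ s = s'} : X.res (hs := hs) (hs' := hs') g e = X.res g' e' := by
  subst h; rfl

variable {X Y Z : LocObj J 𝒴}

/-- The component of a representative at an arrow `s` of its domain, with values in the descent
datum `Y` at the arrow `l = s ≫ φ.base`. -/
def LocObj.PreHom.at (φ : PreHom X Y) {T : C} (s : T ⟶ X.base) (hs : φ.dom s) (l : T ⟶ Y.base)
    (hl : Y.cover l) (e : s ≫ φ.base = l) : X.val s (φ.dom_le _ hs) ⟶ Y.val l hl :=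
  φ.hom.γ.toNatTrans.app (elt (⟨s, hs⟩ : φ.dom.functor.obj (op T))) ≫
    Y.datum.map (eltHom (A := Y.cover.functor) (x := ⟨l, hl⟩)
      (x' := φ.hom.u.app (op T) (⟨s, hs⟩ : φ.dom.functor.obj (op T))) (𝟙 T)
      (Subtype.ext ((Category.id_comp l).trans (e.symm.trans
        (φ.hom_u (⟨s, hs⟩ : φ.dom.functor.obj (op T))).symm))))

lemma LocObj.PreHom.cover_of_dom (φ : PreHom X Y) {T : C} (s : T ⟶ X.base) (hs : φ.dom s) :
    Y.cover (s ≫ φ.base) := by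
  have h1 : (φ.hom.u.app (op T) (⟨s, hs⟩ : φ.dom.functor.obj (op T))).1 = s ≫ φ.base :=
    φ.hom_u (⟨s, hs⟩ : φ.dom.functor.obj (op T))
  have h2 := (φ.hom.u.app (op T) (⟨s, hs⟩ : φ.dom.functor.obj (op T))).2
  exact h1 ▸ h2

lemma LocObj.PreHom.at_isHomLift (φ : PreHom X Y) {T : C} (s : T ⟶ X.base) (hs : φ.dom s)
    (l : T ⟶ Y.base) (hl : Y.cover l) (e : s ≫ φ.base = l) :
    𝒴.p.IsHomLift (𝟙 T) (φ.at s hs l hl e) :=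
  isHomLift_comp_id (natTrans_app_isHomLift φ.hom.γ _) (map_eltHom_isHomLift _ _ _)

lemma LocObj.PreHom.at_nat (φ : PreHom X Y) {T T' : C} (s : T ⟶ X.base) (hs : φ.dom s)
    (l : T ⟶ Y.base) (hl : Y.cover l) (e : s ≫ φ.base = l) (s' : T' ⟶ X.base) (hs' : φ.dom s')
    (l' : T' ⟶ Y.base) (hl' : Y.cover l') (e' : s' ≫ φ.base = l') (g : T' ⟶ T) (h : g ≫ s = s') :
    X.res g h ≫ φ.at s hs l hl e =
      φ.at s' hs' l' hl' e' ≫ Y.res g (by rw [← e, ← e', ← h, Category.assoc]) := by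
  have h' : φ.dom.functor.map g.op (⟨s, hs⟩ : φ.dom.functor.obj (op T)) = ⟨s', hs'⟩ :=
    Subtype.ext h
  have h1 := natTrans_nat φ.hom.γ g h'
  refine (comp_comp_eq rfl h1).trans ((congrArg (_ ≫ ·) ?_).trans (Category.assoc _ _ _).symm)
  refine (Y.datum.map_comp _ _).symm.trans (Eq.trans ?_ (Y.datum.map_comp _ _))
  refine congrArg (fun m => Y.datum.map m) ?_
  refine Quiver.Hom.unop_inj (Subtype.ext (congrArg Quiver.Hom.op ?_))
  exact (Category.comp_id g).trans (Category.id_comp g).symm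

lemma LocObj.PreHom.at_eq_of_restrict_eq {φ ψ : PreHom X Y} {W : Sieve X.base} {hφ : W ≤ φ.dom}
    {hψ : W ≤ ψ.dom} (h : φ.restrict hφ = ψ.restrict hψ) {T : C} (s : T ⟶ X.base) (hs : W s)
    (l : T ⟶ Y.base) (hl : Y.cover l) (e : s ≫ φ.base = l) (e' : s ≫ ψ.base = l) :
    φ.at s (hφ _ hs) l hl e = ψ.at s (hψ _ hs) l hl e' := by
  -- the component of an arrow of pairs into `Y`
  let c (α : X.restrict (hφ.trans φ.dom_le) ⟶ Y.probe)
      (e : Y.cover.functor.map (𝟙 T : T ⟶ T).op (⟨l, hl⟩ : Y.cover.functor.obj (op T)) =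
        α.u.app (op T) (⟨s, hs⟩ : W.functor.obj (op T))) :=
    α.γ.toNatTrans.app (elt (⟨s, hs⟩ : W.functor.obj (op T))) ≫
      Y.datum.map (eltHom (A := Y.cover.functor) (x := ⟨l, hl⟩) (𝟙 T) e)
  have hc : ∀ α β (_ : α = β) e e', c α e = c β e' := by
    rintro α _ rfl e e'; rfl
  have e1 {χ : PreHom X Y} (hχ : W ≤ χ.dom) (e : s ≫ χ.base = l) :
      Y.cover.functor.map (𝟙 T : T ⟶ T).op (⟨l, hl⟩ : Y.cover.functor.obj (op T)) =
        (χ.restrict hχ).u.app (op T) (⟨s, hs⟩ : W.functor.obj (op T)) :=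
    Subtype.ext ((Category.id_comp l).trans (e.symm.trans
      (χ.restrict_u hχ (⟨s, hs⟩ : W.functor.obj (op T))).symm))
  have h1 := hc _ _ h (e1 hφ e) (e1 hψ e')
  have h2 {χ : PreHom X Y} (hχ : W ≤ χ.dom) (e : s ≫ χ.base = l) :
      c (χ.restrict hχ) (e1 hχ e) = χ.at s (hχ _ hs) l hl e :=
    congrArg (· ≫ _) (Category.id_comp _)
  exact (h2 hφ e).symm.trans (h1.trans (h2 hψ e'))

/-- A representative from its components. -/
def LocObj.PreHom.ofAt (base : X.base ⟶ Y.base) (dom : Sieve X.base) (dom_mem : dom ∈ J X.base)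
    (dom_le : dom ≤ X.cover) (hY : dom ≤ Y.cover.pullback base)
    (m : ∀ {T : C} (s : T ⟶ X.base) (hs : dom s), X.val s (dom_le _ hs) ⟶
      Y.val (s ≫ base) (hY _ hs))
    (hm : ∀ {T : C} (s : T ⟶ X.base) (hs : dom s), 𝒴.p.IsHomLift (𝟙 T) (m s hs))
    (nat : ∀ {T T' : C} (s : T ⟶ X.base) (hs : dom s) (s' : T' ⟶ X.base) (hs' : dom s')
      (g : T' ⟶ T) (e : g ≫ s = s'),
      X.res g e ≫ m s hs = m s' hs' ≫ Y.res g (by rw [← e, Category.assoc])) : PreHom X Y where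
  base := base
  dom := dom
  dom_mem := dom_mem
  dom_le := dom_le
  hom :=
    { u :=
        { app := fun S => ↾fun k => ⟨k.1 ≫ base, hY _ k.2⟩
          naturality := fun S S' s => by
            refine ConcreteCategory.hom_ext (C := Type v) _ _ fun x => Subtype.ext ?_
            exact Category.assoc _ _ _ }
      γ := mkEltsNatTrans (fun x => m x.1 x.2) (fun x => hm x.1 x.2)
        (fun {T T' x x'} g h => nat x.1 x.2 x'.1 x'.2 g (congrArg Subtype.val h)) }
  hom_u _ := rfl

/-- The arrow of the stackification which a representative defines. -/
def LocObj.PreHom.toHom (φ : PreHom X Y) :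
    (show (stackification J 𝒴).obj from X) ⟶ (show (stackification J 𝒴).obj from Y) :=
  Quotient.mk (PreHom.setoid X Y) φ

lemma LocObj.PreHom.exists_toHom_eq {X Y : (stackification J 𝒴).obj} (f : X ⟶ Y) :
    ∃ φ : LocObj.PreHom X Y, φ.toHom = f :=
  Quotient.exists_rep f

lemma LocObj.PreHom.p_map_toHom (φ : PreHom X Y) : (stackification J 𝒴).p.map φ.toHom = φ.base :=
  rfl

/-- Representatives whose components agree on a covering sieve define the same arrow. -/
lemma LocObj.PreHom.toHom_eq_of_at (φ ψ : PreHom X Y) (hb : φ.base = ψ.base) (W : Sieve X.base)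
    (hW : W ∈ J X.base) (hφ : W ≤ φ.dom) (hψ : W ≤ ψ.dom)
    (h : ∀ {T : C} (s : T ⟶ X.base) (hs : W s) (l : T ⟶ Y.base) (hl : Y.cover l)
      (e : s ≫ φ.base = l) (e' : s ≫ ψ.base = l),
      φ.at s (hφ _ hs) l hl e = ψ.at s (hψ _ hs) l hl e') : φ.toHom = ψ.toHom := by
  refine Quotient.sound ⟨hb, W, hW, hφ, hψ, Probe.hom_ext_of_app (fun {T} x => ?_) fun {T} x => ?_⟩
  · exact Subtype.ext ((Category.id_comp _).trans ((ψ.restrict_u hψ x).trans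
      ((congrArg (x.1 ≫ ·) hb.symm).trans (φ.restrict_u hφ x).symm)))
  · let l := ψ.hom.u.app (op T) (⟨x.1, hψ _ x.2⟩ : ψ.dom.functor.obj (op T))
    have e' : x.1 ≫ ψ.base = l.1 := (ψ.restrict_u hψ x).symm
    have h1 := h x.1 x.2 l.1 l.2 (hb ▸ e') e'
    refine (congrArg (· ≫ _) (Category.id_comp _)).trans (h1.trans (Eq.trans ?_
      (Category.id_comp _).symm))
    exact (congrArg (_ ≫ ·) (map_eltHom_id Y.datum l _)).trans (Category.comp_id _)

lemma LocObj.PreHom.at_eq_of_toHom_eq {φ ψ : PreHom X Y} (e : φ.toHom = ψ.toHom) :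
    φ.base = ψ.base ∧ ∃ W ∈ J X.base, W ≤ φ.dom ∧ W ≤ ψ.dom ∧
      ∀ {T : C} (s : T ⟶ X.base) (_ : W s) (hs : φ.dom s) (hs' : ψ.dom s) (l : T ⟶ Y.base)
        (hl : Y.cover l) (e : s ≫ φ.base = l) (e' : s ≫ ψ.base = l),
        φ.at s hs l hl e = ψ.at s hs' l hl e' := by
  obtain ⟨hb, W, hW, hφ, hψ, h⟩ := Quotient.exact e
  exact ⟨hb, W, hW, hφ, hψ, fun s hs _ _ l hl e e' => at_eq_of_restrict_eq h s hs l hl e e'⟩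

lemma LocObj.PreHom.at_comp (φ : PreHom X Y) (ψ : PreHom Y Z) {T : C} (s : T ⟶ X.base)
    (hs : (φ.comp ψ).dom s) (m : T ⟶ Y.base) (hm : ψ.dom m) (hm' : Y.cover m)
    (em : s ≫ φ.base = m) (l : T ⟶ Z.base)
    (hl : Z.cover l) (e : s ≫ φ.base ≫ ψ.base = l) :
    (φ.comp ψ).at s hs l hl e = φ.at s hs.1 m hm' em ≫
      ψ.at m hm l hl (by rw [← em, Category.assoc, e]) := by
  let k : Y.cover.functor.obj (op T) :=
    φ.hom.u.app (op T) (⟨s, hs.1⟩ : φ.dom.functor.obj (op T))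
  have hk : k.1 = m := (φ.hom_u (⟨s, hs.1⟩ : φ.dom.functor.obj (op T))).trans em
  have e' : m ≫ ψ.base = l := by rw [← em, Category.assoc, e]
  have h1 := ψ.at_nat m hm l hl e' k.1 (hk ▸ hm) l hl (by rw [hk, e']) (𝟙 T) (by rw [hk]; simp)
  let γ := φ.hom.γ.toNatTrans.app (elt (⟨s, hs.1⟩ : φ.dom.functor.obj (op T)))
  have h2 : φ.at s hs.1 m hm' em ≫ ψ.at m hm l hl e' =
      γ ≫ ψ.at k.1 (hk ▸ hm) l hl (by rw [hk, e']) :=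
    (Category.assoc _ _ _).trans ((congrArg (γ ≫ ·) h1).trans
      (congrArg (γ ≫ ·) ((congrArg (_ ≫ ·) (Z.res_id _)).trans (Category.comp_id _))))
  refine Eq.trans ?_ h2.symm
  exact (Category.assoc _ _ _).trans (congrArg (· ≫ _) (Category.id_comp γ))

lemma LocObj.PreHom.at_id {T : C} (s : T ⟶ X.base) (hs : X.cover s) (l : T ⟶ X.base)
    (hl : X.cover l) (e : s ≫ 𝟙 _ = l) :
    (PreHom.id X).at s hs l hl e = X.res (𝟙 T) (by simpa using e.symm) :=
  Category.id_comp _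

end LocalArrows

/-! ### Arrows from the unit to the stackification -/

section UnitArrows

variable {J : GrothendieckTopology C} {𝒴 : BasedCategory.{v₂, u₂} C} {X Y : LocObj J 𝒴}

lemma LocObj.comp_res_injective (h : IsFiberedInGroupoids 𝒴) {T T' : C} {s : T ⟶ X.base}
    {hs : X.cover s} {s' : T' ⟶ X.base} {hs' : X.cover s'} (g : T' ⟶ T) (e : g ≫ s = s')
    {a : 𝒴.obj} {α β : a ⟶ X.val s' hs'} (hα : 𝒴.p.IsHomLift (𝟙 T') α)
    (hβ : 𝒴.p.IsHomLift (𝟙 T') β)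
    (hαβ : α ≫ X.res (hs := hs) g e = β ≫ X.res (hs := hs) g e) : α = β :=
  h.cancel (𝟙 T') (X.res g e) hα hβ hαβ

lemma unitHom_at_pullMap (h : IsFiberedInGroupoids 𝒴) {y y' : 𝒴.obj} (ψ : y ⟶ y') {T : C}
    (s : T ⟶ 𝒴.p.obj y) (l : T ⟶ 𝒴.p.obj y') (e : s ≫ 𝒴.p.map ψ = l) :
    (unitHom J h ψ).at s trivial l trivial e ≫ h.pullMap y' l = h.pullMap y s ≫ ψ := by
  subst e
  refine (Category.assoc _ _ _).trans (Eq.trans ?_ (h.pullHom_pullMap ψ s))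
  exact congrArg (_ ≫ ·) (h.pullLift_pullMap _ _ _ _ (Category.id_comp _))

/-- A representative `φ` of an arrow `ι(y) ⟶ X` into the stackification classifies `α : y ⟶ X(l)`
over `g` if it is given by restrictions of `α`. -/
structure Classifies (h : IsFiberedInGroupoids 𝒴) {y : 𝒴.obj} {T : C} {l : T ⟶ X.base}
    {hl : X.cover l} (φ : LocObj.PreHom (unitObj J h y) X) (g : 𝒴.p.obj y ⟶ T)
    (α : y ⟶ X.val l hl) : Prop where
  base : φ.base = g ≫ l
  at_res : ∀ {T' : C} (s : T' ⟶ 𝒴.p.obj y) (hs : φ.dom s) (l' : T' ⟶ X.base) (hl' : X.cover l')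
    (e : s ≫ φ.base = l') (e' : (s ≫ g) ≫ l = l'),
    φ.at s hs l' hl' e ≫ X.res (s ≫ g) e' = h.pullMap y s ≫ α

lemma Classifies.toHom_eq {h : IsFiberedInGroupoids 𝒴} {y : 𝒴.obj} {T : C} {l : T ⟶ X.base}
    {hl : X.cover l} {φ ψ : LocObj.PreHom (unitObj J h y) X} {g : 𝒴.p.obj y ⟶ T}
    {α : y ⟶ X.val l hl} (hφ : Classifies h φ g α) (hψ : Classifies h ψ g α) :
    φ.toHom = ψ.toHom := by
  refine LocObj.PreHom.toHom_eq_of_at φ ψ (hφ.base.trans hψ.base.symm) (φ.dom ⊓ ψ.dom)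
    (J.intersection_covering φ.dom_mem ψ.dom_mem) inf_le_left inf_le_right ?_
  intro T' s hs l' hl' e e'
  have e₁ : (s ≫ g) ≫ l = l' :=
    (Category.assoc _ _ _).trans ((congrArg (s ≫ ·) hφ.base.symm).trans e)
  exact LocObj.comp_res_injective h (s ≫ g) e₁ (φ.at_isHomLift _ _ _ _ _) (ψ.at_isHomLift _ _ _ _ _)
    ((hφ.at_res s hs.1 l' hl' e e₁).trans (hψ.at_res s hs.2 l' hl' e' e₁).symm)

/-- Every arrow `y ⟶ X(l)` is classified by an arrow `ι(y) ⟶ X`: its component at `s` is the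
factorization of `s^* y ⟶ y ⟶ X(l)` through the restriction of `X(l)` along `s ≫ g`. -/
lemma exists_classifies (h : IsFiberedInGroupoids 𝒴) {y : 𝒴.obj} {T : C} {l : T ⟶ X.base}
    {hl : X.cover l} (g : 𝒴.p.obj y ⟶ T) (α : y ⟶ X.val l hl) (hα : 𝒴.p.IsHomLift g α) :
    ∃ φ : LocObj.PreHom (unitObj J h y) X, Classifies h φ g α := by
  have hc {T' : C} (s : T' ⟶ 𝒴.p.obj y) : X.cover (s ≫ g ≫ l) :=
    X.cover.downward_closed (X.cover.downward_closed hl _) _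
  have hex {T' : C} (s : T' ⟶ 𝒴.p.obj y) := h.exists_lift (c := h.pull y s) (s ≫ g) (𝟙 T')
    (X.res (hs := hl) (hs' := hc s) (s ≫ g) (Category.assoc _ _ _))
    (h.pullMap y s ≫ α) (X.res_isHomLift _ _)
    (isHomLift_comp (h.pullMap_isHomLift y s) hα (by simp))
  choose m hm hmr using @hex
  refine ⟨LocObj.PreHom.ofAt (X := unitObj J h y) (g ≫ l) ⊤ (J.top_mem _) le_rfl (fun _ s _ => hc s)
    (fun s _ => m s) (fun s _ => hm s) ?_, rfl, ?_⟩
  · intro T₁ T₂ s _ s' _ k e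
    refine h.comm_of_comp k (X.res (hs := hl) (s ≫ g) (Category.assoc _ _ _))
      (h.pullLift_isHomLift y s' s k e)
      (hm s) (hm s') (X.res_isHomLift _ _) ?_
    have e2 : k ≫ s ≫ g = s' ≫ g := (Category.assoc _ _ _).symm.trans (congrArg (· ≫ g) e)
    have h1 : X.res (hs := hc s) (hs' := hc s') k
        ((Category.assoc _ _ _).symm.trans (congrArg (· ≫ g ≫ l) e)) ≫
        X.res (hs := hl) (s ≫ g) (Category.assoc _ _ _) =
        X.res (hs := hl) (s' ≫ g) (Category.assoc _ _ _) :=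
      (X.res_res _ _ _ _).trans (X.res_congr e2)
    refine (congrArg (h.pullLift y s' s k e ≫ ·) (hmr s)).trans ((Category.assoc _ _ _).symm.trans
      ((congrArg (· ≫ α) (h.pullLift_pullMap y s' s k e)).trans ((hmr s').symm.trans ?_)))
    exact congrArg (m s' ≫ ·) h1.symm
  · intro T' s hs l' hl' e e'
    subst e
    refine Eq.trans ?_ (hmr s)
    exact congrArg (· ≫ _) ((congrArg (m s ≫ ·) (X.res_id (Category.id_comp _))).trans
      (Category.comp_id _))

/-- The arrow `ι(X(k)) ⟶ X` over `k` of the stackification, for `k` in the covering sieve of `X`. -/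
noncomputable def LocObj.leg (h : IsFiberedInGroupoids 𝒴) (X : LocObj J 𝒴) {T : C} (k : T ⟶ X.base)
    (hk : X.cover k) : LocObj.PreHom (unitObj J h (X.val k hk)) X :=
  (exists_classifies h (eqToHom (X.p_val k hk)) (𝟙 _)
    (IsHomLift.id_lift_eqToHom_domain (X.p_val k hk) rfl)).choose

lemma LocObj.leg_classifies (h : IsFiberedInGroupoids 𝒴) (X : LocObj J 𝒴) {T : C} (k : T ⟶ X.base)
    (hk : X.cover k) : Classifies h (X.leg h k hk) (eqToHom (X.p_val k hk)) (𝟙 (X.val k hk)) :=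
  (exists_classifies h (eqToHom (X.p_val k hk)) (𝟙 _)
    (IsHomLift.id_lift_eqToHom_domain (X.p_val k hk) rfl)).choose_spec

lemma LocObj.leg_isHomLift (h : IsFiberedInGroupoids 𝒴) (X : LocObj J 𝒴) {T : C} (k : T ⟶ X.base)
    (hk : X.cover k) : (stackification J 𝒴).p.IsHomLift k (X.leg h k hk).toHom := by
  refine IsHomLift.of_fac' _ _ _ (X.p_val k hk) rfl ?_
  rw [LocObj.PreHom.p_map_toHom, (X.leg_classifies h k hk).base]
  exact congrArg (_ ≫ ·) (Category.comp_id k).symm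

/-- The arrows `ι(X(k)) ⟶ X` are natural in `X`. -/
lemma LocObj.leg_comp (h : IsFiberedInGroupoids 𝒴) (φ : PreHom X Y) {T : C} (k : T ⟶ X.base)
    (hk : φ.dom k) (l : T ⟶ Y.base) (hl : Y.cover l) (e : k ≫ φ.base = l) :
    (X.leg h k (φ.dom_le _ hk)).toHom ≫ φ.toHom =
      (toStackification J h).map (φ.at k hk l hl e) ≫ (Y.leg h l hl).toHom := by
  have hX := X.leg_classifies h k (φ.dom_le _ hk)
  have hY := Y.leg_classifies h l hl
  have hat := φ.at_isHomLift k hk l hl e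
  have hp : 𝒴.p.map (φ.at k hk l hl e) ≫ eqToHom (Y.p_val l hl) = eqToHom (X.p_val k _) := by
    rw [IsHomLift.fac' 𝒴.p (𝟙 T) (φ.at k hk l hl e)]; simp
  refine Classifies.toHom_eq (φ := (X.leg h k (φ.dom_le _ hk)).comp φ)
    (ψ := (unitHom J h (φ.at k hk l hl e)).comp (Y.leg h l hl)) (α := φ.at k hk l hl e)
    (g := eqToHom (X.p_val k _)) ⟨?_, ?_⟩ ⟨?_, ?_⟩
  · exact (congrArg (· ≫ φ.base) hX.base).trans ((Category.assoc _ _ _).trans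
      (congrArg (_ ≫ ·) e))
  · intro T' s hs l' hl' e₁ e₂
    let m : T' ⟶ X.base := s ≫ (X.leg h k (φ.dom_le _ hk)).base
    have hm : φ.dom m := hs.2
    have e₃ : (s ≫ eqToHom (X.p_val k _)) ≫ k = m :=
      (Category.assoc _ _ _).trans (congrArg (s ≫ ·) hX.base.symm)
    have h1 := LocObj.PreHom.at_comp (X.leg h k (φ.dom_le _ hk)) φ s hs m hm (φ.dom_le _ hm) rfl
      l' hl' e₁
    have h2 := φ.at_nat k hk l hl e m hm l' hl' ((Category.assoc _ _ _).trans e₁) _ e₃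
    refine (congrArg (· ≫ _) h1).trans ((Category.assoc _ _ _).trans
      ((congrArg (_ ≫ ·) h2.symm).trans ((Category.assoc _ _ _).symm.trans ?_)))
    exact congrArg (· ≫ φ.at k hk l hl e) ((hX.at_res s hs.1 m (φ.dom_le _ hm) rfl e₃).trans
      (Category.comp_id _))
  · exact (congrArg (_ ≫ ·) hY.base).trans ((Category.assoc _ _ _).symm.trans
      (congrArg (· ≫ l) hp))
  · intro T' s hs l' hl' e₁ e₂
    let m : T' ⟶ 𝒴.p.obj (Y.val l hl) := s ≫ 𝒴.p.map (φ.at k hk l hl e)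
    have e₃ : s ≫ eqToHom (X.p_val k _) = m ≫ eqToHom (Y.p_val l hl) :=
      (congrArg (s ≫ ·) hp.symm).trans (Category.assoc _ _ _).symm
    have h1 := LocObj.PreHom.at_comp (unitHom J h (φ.at k hk l hl e)) (Y.leg h l hl) s hs m hs.2
      trivial rfl l' hl' e₁
    have h2 := hY.at_res m hs.2 l' hl' ((Category.assoc _ _ _).trans e₁) (e₃ ▸ e₂)
    have h3 := unitHom_at_pullMap (J := J) h (φ.at k hk l hl e) s m rfl
    refine (congrArg₂ (· ≫ ·) h1 (Y.res_congr e₃ (e' := e₃ ▸ e₂))).trans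
      ((Category.assoc _ _ _).trans ((congrArg (_ ≫ ·) (h2.trans (Category.comp_id _))).trans h3))

/-- The arrows `ι(X(k)) ⟶ X` are compatible with restriction. -/
lemma LocObj.map_res_leg (h : IsFiberedInGroupoids 𝒴) (X : LocObj J 𝒴) {T T' : C} {k : T ⟶ X.base}
    {hk : X.cover k} {k' : T' ⟶ X.base} {hk' : X.cover k'} (g : T' ⟶ T) (e : g ≫ k = k') :
    (toStackification J h).map (X.res (hs := hk) (hs' := hk') g e) ≫ (X.leg h k hk).toHom =
      (X.leg h k' hk').toHom := by
  have hX := X.leg_classifies h k hk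
  have hX' := X.leg_classifies h k' hk'
  have hres := X.res_isHomLift (hs := hk) (hs' := hk') g e
  have hp : 𝒴.p.map (X.res (hs := hk) (hs' := hk') g e) ≫ eqToHom (X.p_val k hk) =
      eqToHom (X.p_val k' hk') ≫ g := by
    rw [IsHomLift.fac' 𝒴.p g (X.res (hs := hk) (hs' := hk') g e)]; simp
  refine Classifies.toHom_eq (φ := (unitHom J h (X.res g e)).comp (X.leg h k hk))
    (ψ := X.leg h k' hk') (α := X.res (hs := hk) g e) (g := eqToHom (X.p_val k' hk') ≫ g)
    ⟨?_, ?_⟩ ⟨?_, ?_⟩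
  · exact (congrArg (_ ≫ ·) hX.base).trans ((Category.assoc _ _ _).symm.trans (congrArg (· ≫ k) hp))
  · intro T'' s hs l' hl' e₁ e₂
    let m : T'' ⟶ 𝒴.p.obj (X.val k hk) := s ≫ 𝒴.p.map (X.res (hs := hk) (hs' := hk') g e)
    have e₃ : s ≫ eqToHom (X.p_val k' hk') ≫ g = m ≫ eqToHom (X.p_val k hk) :=
      (congrArg (s ≫ ·) hp.symm).trans (Category.assoc _ _ _).symm
    have h1 := LocObj.PreHom.at_comp (unitHom J h (X.res (hs := hk) (hs' := hk') g e))
      (X.leg h k hk) s hs m hs.2 trivial rfl l' hl' e₁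
    have h2 := hX.at_res m hs.2 l' hl' ((Category.assoc _ _ _).trans e₁) (e₃ ▸ e₂)
    have h3 := unitHom_at_pullMap (J := J) h (X.res (hs := hk) (hs' := hk') g e) s m rfl
    refine (congrArg₂ (· ≫ ·) h1 (X.res_congr e₃ (e' := e₃ ▸ e₂))).trans
      ((Category.assoc _ _ _).trans ((congrArg (_ ≫ ·) (h2.trans (Category.comp_id _))).trans h3))
  · exact hX'.base.trans ((congrArg (_ ≫ ·) e.symm).trans (Category.assoc _ _ _).symm)
  · intro T'' s hs l' hl' e₁ e₂
    have e₃ : (s ≫ eqToHom (X.p_val k' hk')) ≫ k' = l' :=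
      (congrArg (_ ≫ ·) e.symm).trans ((Category.assoc _ _ _).symm.trans
        ((congrArg (· ≫ k) (Category.assoc _ _ _)).trans e₂))
    have h1 := hX'.at_res s hs l' hl' e₁ e₃
    have h2 : X.res (hs := hk') (hs' := hl') (s ≫ eqToHom (X.p_val k' hk')) e₃ ≫
        X.res (hs := hk) g e = X.res (s ≫ eqToHom (X.p_val k' hk') ≫ g) e₂ :=
      (X.res_res _ _ _ _).trans (X.res_congr (Category.assoc _ _ _))
    rw [← h2]
    exact (Category.assoc _ _ _).symm.trans (congrArg (· ≫ _) (h1.trans (Category.comp_id _)))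

/-- For the descent datum of an object `y`, the arrow `ι(k^* y) ⟶ ι(y)` is the canonical one. -/
lemma leg_unitObj (h : IsFiberedInGroupoids 𝒴) (y : 𝒴.obj) {T : C} (k : T ⟶ 𝒴.p.obj y) :
    ((unitObj J h y).leg h k trivial).toHom = (toStackification J h).map (h.pullMap y k) := by
  have hX := (unitObj J h y).leg_classifies h k trivial
  have hl := h.pullMap_isHomLift y k
  have hp : 𝒴.p.map (h.pullMap y k) = eqToHom ((unitObj J h y).p_val k trivial) ≫ k := by
    rw [IsHomLift.fac' 𝒴.p k (h.pullMap y k)]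
    exact congrArg (_ ≫ ·) (Category.comp_id k)
  refine Classifies.toHom_eq (ψ := unitHom J h (h.pullMap y k)) hX ⟨hp, ?_⟩
  intro T' s hs l' hl' e₁ e₂
  refine h.cancel (s ≫ eqToHom (h.pull_obj y k)) (h.pullMap y k) ?_ ?_ ?_
  · exact isHomLift_id_comp (LocObj.PreHom.at_isHomLift _ _ _ _ _ _) (LocObj.res_isHomLift _ _ _)
  · exact isHomLift_comp (h.pullMap_isHomLift _ s)
      (IsHomLift.id_lift_eqToHom_domain (h.pull_obj y k) rfl) rfl
  · refine (Category.assoc _ _ _).trans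
      ((congrArg (_ ≫ ·) (h.pullLift_pullMap y l' k _ e₂)).trans ?_)
    refine (unitHom_at_pullMap (J := J) h (h.pullMap y k) s l' e₁).trans ?_
    exact congrArg (· ≫ _) (Category.comp_id _).symm

end UnitArrows

/-! ### Extension of morphisms to the stackification -/

section Extension

lemma isHomLift_fac {𝒵 : BasedCategory.{v₃, u₃} C} {R S : C} {a b : 𝒵.obj} {f : R ⟶ S}
    {φ : a ⟶ b} (h : 𝒵.p.IsHomLift f φ) :
    𝒵.p.map φ = eqToHom (IsHomLift.domain_eq 𝒵.p f φ) ≫ f ≫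
      eqToHom (IsHomLift.codomain_eq 𝒵.p f φ).symm :=
  IsHomLift.fac' 𝒵.p f φ

variable {J : GrothendieckTopology C} {𝒴 : BasedCategory.{v₂, u₂} C} {𝒵 : BasedCategory.{v₃, u₃} C}

/-- The object of a stack `𝒵` glued from the image of a descent datum of `𝒴`. -/
noncomputable def extObj (h𝒵 : IsStack J 𝒵) (F : 𝒴 ⥤ᵇ 𝒵) (X : LocObj J 𝒴) : 𝒵.obj :=
  (h𝒵.exists_obj X.cover X.cover_mem (X.datum.comp F)).choose

/-- The legs of the glued object. -/
noncomputable def extLeg (h𝒵 : IsStack J 𝒵) (F : 𝒴 ⥤ᵇ 𝒵) (X : LocObj J 𝒴) {T : C}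
    (k : T ⟶ X.base) (hk : X.cover k) : F.obj (X.val k hk) ⟶ extObj h𝒵 F X :=
  (h𝒵.exists_obj X.cover X.cover_mem (X.datum.comp F)).choose_spec.choose
    (⟨k, hk⟩ : X.cover.functor.obj (op T))

lemma p_extObj (h𝒵 : IsStack J 𝒵) (F : 𝒴 ⥤ᵇ 𝒵) (X : LocObj J 𝒴) :
    𝒵.p.obj (extObj h𝒵 F X) = X.base :=
  (h𝒵.exists_obj X.cover X.cover_mem (X.datum.comp F)).choose_spec.choose_spec.1

lemma extLeg_isHomLift (h𝒵 : IsStack J 𝒵) (F : 𝒴 ⥤ᵇ 𝒵) (X : LocObj J 𝒴) {T : C}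
    (k : T ⟶ X.base) (hk : X.cover k) : 𝒵.p.IsHomLift k (extLeg h𝒵 F X k hk) :=
  (h𝒵.exists_obj X.cover X.cover_mem (X.datum.comp F)).choose_spec.choose_spec.2.1
    (⟨k, hk⟩ : X.cover.functor.obj (op T))

lemma map_res_extLeg (h𝒵 : IsStack J 𝒵) (F : 𝒴 ⥤ᵇ 𝒵) (X : LocObj J 𝒴) {T T' : C}
    {k : T ⟶ X.base} {hk : X.cover k} {k' : T' ⟶ X.base} {hk' : X.cover k'} (g : T' ⟶ T)
    (e : g ≫ k = k') : F.map (X.res (hs := hk) (hs' := hk') g e) ≫ extLeg h𝒵 F X k hk =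
      extLeg h𝒵 F X k' hk' :=
  (h𝒵.exists_obj X.cover X.cover_mem (X.datum.comp F)).choose_spec.choose_spec.2.2 g
    (x := (⟨k, hk⟩ : X.cover.functor.obj (op T)))
    (x' := (⟨k', hk'⟩ : X.cover.functor.obj (op T'))) (Subtype.ext e)

/-- The arrow `m` between glued objects is glued from the representative `φ`. -/
structure IsExtMap (h𝒵 : IsStack J 𝒵) (F : 𝒴 ⥤ᵇ 𝒵) {X Y : LocObj J 𝒴} (φ : LocObj.PreHom X Y)
    (m : extObj h𝒵 F X ⟶ extObj h𝒵 F Y) : Prop where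
  isHomLift : 𝒵.p.IsHomLift φ.base m
  leg_comp : ∀ {T : C} (s : T ⟶ X.base) (hs : φ.dom s) (l : T ⟶ Y.base) (hl : Y.cover l)
    (e : s ≫ φ.base = l),
    extLeg h𝒵 F X s (φ.dom_le _ hs) ≫ m = F.map (φ.at s hs l hl e) ≫ extLeg h𝒵 F Y l hl

variable (h𝒵 : IsStack J 𝒵) (F : 𝒴 ⥤ᵇ 𝒵)

lemma exists_isExtMap {X Y : LocObj J 𝒴} (φ : LocObj.PreHom X Y) :
    ∃ m, IsExtMap h𝒵 F φ m := by
  obtain ⟨m, hm, hm'⟩ := h𝒵.hasDescent.glue h𝒵.fibered φ.base (p_extObj h𝒵 F X) (p_extObj h𝒵 F Y)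
    φ.dom_mem (fun s hs => F.obj (X.val s (φ.dom_le _ hs)))
    (fun s hs => extLeg h𝒵 F X s (φ.dom_le _ hs))
    (fun s hs => extLeg_isHomLift h𝒵 F X s _)
    (fun s hs => F.map (φ.at s hs (s ≫ φ.base) (φ.cover_of_dom s hs) rfl) ≫
      extLeg h𝒵 F Y (s ≫ φ.base) (φ.cover_of_dom s hs))
    (fun s hs => isHomLift_id_comp
      (have := φ.at_isHomLift s hs (s ≫ φ.base) (φ.cover_of_dom s hs) rfl; inferInstance)
      (extLeg_isHomLift h𝒵 F Y _ _))
    (fun s hs g hs' => ⟨F.map (X.res g rfl),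
      (have := X.res_isHomLift (hs := φ.dom_le _ hs) (hs' := φ.dom_le _ hs') g rfl; inferInstance),
      map_res_extLeg h𝒵 F X g rfl, by
        rw [← Category.assoc, ← F.map_comp, φ.at_nat s hs _ (φ.cover_of_dom s hs) rfl _ hs' _
          (φ.cover_of_dom _ hs') rfl g rfl, F.map_comp, Category.assoc, map_res_extLeg]⟩)
  exact ⟨m, hm, fun s hs l hl e => by subst e; exact hm' s hs⟩

variable {h𝒵 F}

/-- The glued arrow depends only on the arrow of the stackification. -/
lemma IsExtMap.eq_of_toHom_eq {X Y : LocObj J 𝒴} {φ ψ : LocObj.PreHom X Y} {m m'}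
    (hm : IsExtMap h𝒵 F φ m) (hm' : IsExtMap h𝒵 F ψ m') (e : φ.toHom = ψ.toHom) : m = m' := by
  obtain ⟨hb, W, hW, hφ, hψ, hat⟩ := LocObj.PreHom.at_eq_of_toHom_eq e
  refine h𝒵.hasDescent.ext_of_legs h𝒵.fibered hW
    (i := fun s hs => extLeg h𝒵 F X s (φ.dom_le _ (hφ _ hs)))
    (fun s hs => extLeg_isHomLift h𝒵 F X s _) hm.isHomLift (hb ▸ hm'.isHomLift) fun s hs => ?_
  have hl := φ.cover_of_dom s (hφ _ hs)
  rw [hm.leg_comp s (hφ _ hs) _ hl rfl, hm'.leg_comp s (hψ _ hs) _ hl (by rw [hb]),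
    hat s hs (hφ _ hs) (hψ _ hs)]

lemma IsExtMap.id (X : LocObj J 𝒴) : IsExtMap h𝒵 F (LocObj.PreHom.id X) (𝟙 _) where
  isHomLift := IsHomLift.id (p_extObj h𝒵 F X)
  leg_comp s hs l hl e := by
    exact (Category.comp_id _).trans ((map_res_extLeg h𝒵 F X (hk := hl) (hk' := hs) (𝟙 _)
      ((Category.id_comp l).trans (e.symm.trans (Category.comp_id s)))).symm.trans
        (congrArg (fun m => F.map m ≫ extLeg h𝒵 F X l hl)
        (LocObj.PreHom.at_id s hs l hl e).symm))

lemma IsExtMap.comp {X Y Z : LocObj J 𝒴} {φ : LocObj.PreHom X Y} {ψ : LocObj.PreHom Y Z} {m m'}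
    (hm : IsExtMap h𝒵 F φ m) (hm' : IsExtMap h𝒵 F ψ m') : IsExtMap h𝒵 F (φ.comp ψ) (m ≫ m') where
  isHomLift := isHomLift_comp hm.isHomLift hm'.isHomLift rfl
  leg_comp s hs l hl e := by
    have hk : ψ.dom (s ≫ φ.base) := hs.2
    rw [LocObj.PreHom.at_comp φ ψ s hs _ hk (ψ.dom_le _ hk) rfl l hl e, ← Category.assoc,
      hm.leg_comp s hs.1 _ (ψ.dom_le _ hk) rfl, F.map_comp, Category.assoc, Category.assoc,
      hm'.leg_comp _ hk l hl]

variable (h𝒵 F)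

/-- The extension to the stackification of a morphism from `𝒴` to a stack. -/
noncomputable def extFunctor : stackification J 𝒴 ⥤ᵇ 𝒵 where
  obj X := extObj h𝒵 F X
  map f := (exists_isExtMap h𝒵 F (LocObj.PreHom.exists_toHom_eq f).choose).choose
  map_id X := by
    have e := (LocObj.PreHom.exists_toHom_eq (𝟙 X)).choose_spec
    exact (exists_isExtMap h𝒵 F _).choose_spec.eq_of_toHom_eq (IsExtMap.id X) e
  map_comp f g := by
    have ef := (LocObj.PreHom.exists_toHom_eq f).choose_spec
    have eg := (LocObj.PreHom.exists_toHom_eq g).choose_spec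
    have e := (LocObj.PreHom.exists_toHom_eq (f ≫ g)).choose_spec
    refine (exists_isExtMap h𝒵 F _).choose_spec.eq_of_toHom_eq (IsExtMap.comp
      (exists_isExtMap h𝒵 F _).choose_spec (exists_isExtMap h𝒵 F _).choose_spec) (e.trans ?_)
    exact (congrArg₂ (· ≫ ·) ef eg).symm
  w := by
    refine CategoryTheory.Functor.ext (fun X => p_extObj h𝒵 F X) fun X Y f => ?_
    obtain ⟨hm, -⟩ := (exists_isExtMap h𝒵 F (LocObj.PreHom.exists_toHom_eq f).choose).choose_spec
    have e : (LocObj.PreHom.exists_toHom_eq f).choose.base = (stackification J 𝒴).p.map f :=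
      congrArg (stackification J 𝒴).p.map (LocObj.PreHom.exists_toHom_eq f).choose_spec
    rw [e] at hm
    exact isHomLift_fac hm

lemma extFunctor_isExtMap {X Y : LocObj J 𝒴} (φ : LocObj.PreHom X Y) :
    IsExtMap h𝒵 F φ ((extFunctor h𝒵 F).map φ.toHom) := by
  have e := (LocObj.PreHom.exists_toHom_eq φ.toHom).choose_spec
  have h1 := (exists_isExtMap h𝒵 F (LocObj.PreHom.exists_toHom_eq φ.toHom).choose).choose_spec
  obtain ⟨m, hm⟩ := exists_isExtMap h𝒵 F φ
  have h2 : m = (extFunctor h𝒵 F).map φ.toHom := hm.eq_of_toHom_eq h1 e.symm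
  exact h2 ▸ hm

lemma extFunctor_map_eq {X Y : LocObj J 𝒴} {φ : LocObj.PreHom X Y} {m} (hm : IsExtMap h𝒵 F φ m) :
    (extFunctor h𝒵 F).map φ.toHom = m :=
  (extFunctor_isExtMap h𝒵 F φ).eq_of_toHom_eq hm rfl

/-- The extension restricts to the given morphism along the unit. -/
lemma nonempty_extFunctor_iso (h : IsFiberedInGroupoids 𝒴) :
    Nonempty ((toStackification J h).comp (extFunctor h𝒵 F) ≅ F) := by
  have hF (y : 𝒴.obj) {T : C} (k : T ⟶ 𝒴.p.obj y) : 𝒵.p.IsHomLift k (F.map (h.pullMap y k)) :=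
    have := h.pullMap_isHomLift y k; inferInstance
  have hex (y : 𝒴.obj) := h𝒵.hasDescent.glue h𝒵.fibered (𝟙 (𝒴.p.obj y))
    (p_extObj h𝒵 F (unitObj J h y)) (F.w_obj y) (J.top_mem _)
    (fun k _ => F.obj (h.pull y k)) (fun k _ => extLeg h𝒵 F (unitObj J h y) k trivial)
    (fun k _ => extLeg_isHomLift h𝒵 F (unitObj J h y) k trivial)
    (fun k _ => F.map (h.pullMap y k)) (fun k _ =>
      (Category.comp_id k).symm ▸ hF y k)
    (fun k _ g _ => ⟨F.map (h.pullLift y (g ≫ k) k g rfl),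
      (have := h.pullLift_isHomLift y (g ≫ k) k g rfl; inferInstance),
      map_res_extLeg h𝒵 F (unitObj J h y) (hk := trivial) (hk' := trivial) g rfl, by
        rw [← F.map_comp, h.pullLift_pullMap]⟩)
  choose t ht htl using hex
  have ht' (y : 𝒴.obj) {T : C} (k : T ⟶ 𝒴.p.obj y) :
      extLeg h𝒵 F (unitObj J h y) k trivial ≫ t y = F.map (h.pullMap y k) := htl y k trivial
  let α : (toStackification J h).comp (extFunctor h𝒵 F) ⟶ F :=
    { app := t
      naturality := fun y y' ψ => by
        have hm := extFunctor_isExtMap h𝒵 F (unitHom J h ψ)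
        refine h𝒵.hasDescent.ext_of_legs h𝒵.fibered (J.top_mem _)
          (i := fun k _ => extLeg h𝒵 F (unitObj J h y) k trivial)
          (fun k _ => extLeg_isHomLift h𝒵 F (unitObj J h y) k trivial) (f := 𝒴.p.map ψ)
          (isHomLift_comp_id hm.isHomLift (ht y')) (isHomLift_id_comp (ht y) inferInstance) ?_
        intro T k hk
        have h1 := hm.leg_comp k trivial _ trivial rfl
        refine (Category.assoc _ _ _).symm.trans ((congrArg (· ≫ t y') h1).trans ?_)
        refine (Category.assoc _ _ _).trans ((congrArg (_ ≫ ·) (ht' y' _)).trans ?_)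
        refine (F.map_comp _ _).symm.trans ((congrArg (fun m => F.map m)
          (unitHom_at_pullMap h ψ k _ rfl)).trans ((F.map_comp _ _).trans ?_))
        exact (congrArg (· ≫ F.map ψ) (ht' y k).symm).trans (Category.assoc _ _ _)
      isHomLift' := ht }
  have : IsIso α := isIso_basedNatTrans h𝒵.fibered α
  exact ⟨asIso α⟩

/-- 2-morphisms out of the stackification are determined by their restriction along the unit, and
every 2-morphism between restrictions extends: the component at `X` is glued from the components at
the objects `X(k)`, along the arrows `ι(X(k)) ⟶ X`. -/
lemma existsUnique_whiskerLeft (h𝒵 : IsStack J 𝒵) (h : IsFiberedInGroupoids 𝒴)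
    {Φ Φ' : stackification J 𝒴 ⥤ᵇ 𝒵}
    (β : (toStackification J h).comp Φ ⟶ (toStackification J h).comp Φ') :
    ∃! θ : Φ ⟶ Φ', BasedCategory.whiskerLeft (toStackification J h) θ = β := by
  have hl (Ψ : stackification J 𝒴 ⥤ᵇ 𝒵) (X : LocObj J 𝒴) {T : C} (k : T ⟶ X.base)
      (hk : X.cover k) : 𝒵.p.IsHomLift k (Ψ.map (X.leg h k hk).toHom) :=
    have := X.leg_isHomLift h k hk
    Ψ.preserves_isHomLift k _
  have hβ (y : 𝒴.obj) {T : C} (e : 𝒴.p.obj y = T) : 𝒵.p.IsHomLift (𝟙 T) (β.toNatTrans.app y) :=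
    β.isHomLift e
  have hex (X : LocObj J 𝒴) := h𝒵.hasDescent.glue h𝒵.fibered (𝟙 X.base)
    (a := Φ.obj X) (b := Φ'.obj X) (Φ.w_obj X) (Φ'.w_obj X) X.cover_mem
    (fun k hk => Φ.obj (unitObj J h (X.val k hk))) (fun k hk => Φ.map (X.leg h k hk).toHom)
    (fun k hk => hl Φ X k hk)
    (fun k hk => β.toNatTrans.app (X.val k hk) ≫ Φ'.map (X.leg h k hk).toHom)
    (fun k hk => (Category.comp_id k).symm ▸
      isHomLift_id_comp (hβ _ (X.p_val k hk)) (hl Φ' X k hk))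
    (fun {T T'} k hk g hk' => by
      have hr (Ψ : stackification J 𝒴 ⥤ᵇ 𝒵) := (Ψ.map_comp _ _).symm.trans (congrArg (Ψ.map ·)
        (X.map_res_leg h (hk := hk) (hk' := hk') g rfl))
      exact ⟨((toStackification J h).comp Φ).map (X.res g rfl),
        (have := X.res_isHomLift (hs := hk) (hs' := hk') g rfl
         ((toStackification J h).comp Φ).preserves_isHomLift g _), hr Φ,
        comp_comp_eq (hr Φ') (natTrans_naturality β _)⟩)
  choose t ht htl using hex
  have hnat {X Y : LocObj J 𝒴} (φ : LocObj.PreHom X Y) :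
      Φ.map φ.toHom ≫ t Y = t X ≫ Φ'.map φ.toHom := by
    have hφ (Ψ : stackification J 𝒴 ⥤ᵇ 𝒵) : 𝒵.p.IsHomLift φ.base (Ψ.map φ.toHom) :=
      have : (stackification J 𝒴).p.IsHomLift φ.base φ.toHom :=
        IsHomLift.map (p := (stackification J 𝒴).p) φ.toHom
      Ψ.preserves_isHomLift _ _
    refine h𝒵.hasDescent.ext_of_legs h𝒵.fibered φ.dom_mem
      (i := fun k hk => Φ.map (X.leg h k (φ.dom_le _ hk)).toHom)
      (fun k hk => hl Φ X k _) (isHomLift_comp_id (hφ Φ) (ht Y)) (isHomLift_id_comp (ht X) (hφ Φ'))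
      fun k hk => ?_
    have hY := φ.cover_of_dom k hk
    have hr (Ψ : stackification J 𝒴 ⥤ᵇ 𝒵) := (Ψ.map_comp _ _).symm.trans ((congrArg (Ψ.map ·)
      (LocObj.leg_comp h φ k hk _ hY rfl)).trans (Ψ.map_comp _ _))
    have h1 := natTrans_naturality β (φ.at k hk _ hY rfl)
    have e1 := (Category.assoc _ _ _).symm.trans ((congrArg (· ≫ t Y) (hr Φ)).trans
      ((Category.assoc _ _ _).trans (congrArg (_ ≫ ·) (htl Y _ hY))))
    have e2 := (Category.assoc _ _ _).symm.trans ((congrArg (· ≫ Φ'.map φ.toHom)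
      (htl X k (φ.dom_le _ hk))).trans ((Category.assoc _ _ _).trans (congrArg (_ ≫ ·) (hr Φ'))))
    exact e1.trans ((comp_comp_eq rfl h1).trans e2.symm)
  let θ : Φ ⟶ Φ' :=
    { app := t
      naturality := fun X Y f => by
        obtain ⟨φ, rfl⟩ := LocObj.PreHom.exists_toHom_eq f
        exact hnat φ
      isHomLift' := ht }
  refine ⟨θ, natTrans_ext fun y => ?_, fun θ' hθ' => natTrans_ext fun X => ?_⟩
  · refine h𝒵.hasDescent.ext_of_legs h𝒵.fibered (J.top_mem _) (f := 𝟙 (𝒴.p.obj y))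
      (i := fun k _ => Φ.map ((unitObj J h y).leg h k trivial).toHom)
      (fun k _ => hl Φ (unitObj J h y) k trivial) (ht (unitObj J h y)) (hβ y rfl) fun k _ => ?_
    have hr (Ψ : stackification J 𝒴 ⥤ᵇ 𝒵) := congrArg (Ψ.map ·) (leg_unitObj (J := J) h y k)
    refine (htl (unitObj J h y) k trivial).trans ((congrArg (_ ≫ ·) (hr Φ')).trans ?_)
    exact (natTrans_naturality β (h.pullMap y k)).symm.trans
      (congrArg (· ≫ β.toNatTrans.app y) (hr Φ).symm)
  · refine h𝒵.hasDescent.ext_of_legs h𝒵.fibered (J := J) (f := 𝟙 (LocObj.base X))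
      (LocObj.cover_mem X)
      (i := fun k hk => Φ.map (LocObj.leg h X k hk).toHom)
      (fun k hk => hl Φ X k hk) (θ'.isHomLift rfl) (ht X) fun k hk => ?_
    refine (natTrans_naturality θ' (LocObj.leg h X k hk).toHom).trans
      (Eq.trans ?_ (htl X k hk).symm)
    exact congrArg (fun γ => γ.toNatTrans.app (LocObj.val X k hk) ≫ _) hθ'

/-- Two extensions of a morphism to a stack along the unit are isomorphic in a unique way. -/
lemma existsUnique_iso_of_whiskerLeft (h𝒵 : IsStack J 𝒵) (h : IsFiberedInGroupoids 𝒴)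
    {F : 𝒴 ⥤ᵇ 𝒵} {Φ Φ' : stackification J 𝒴 ⥤ᵇ 𝒵} (τ : (toStackification J h).comp Φ ≅ F)
    (τ' : (toStackification J h).comp Φ' ≅ F) :
    ∃! θ : Φ ≅ Φ', BasedCategory.whiskerLeft (toStackification J h) θ.hom ≫ τ'.hom = τ.hom := by
  obtain ⟨θ, hθ, hu⟩ := existsUnique_whiskerLeft h𝒵 h (τ.hom ≫ τ'.inv)
  have : IsIso θ := isIso_basedNatTrans h𝒵.fibered θ
  refine ⟨asIso θ, ?_, fun θ' hθ' => Iso.ext (hu _ ?_)⟩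
  · exact (congrArg (· ≫ τ'.hom) hθ).trans ((Category.assoc τ.hom τ'.inv τ'.hom).trans
      ((congrArg (τ.hom ≫ ·) τ'.inv_hom_id).trans (Category.comp_id _)))
  · exact (Iso.eq_comp_inv τ').2 hθ'

end Extension

/-! ### Extension of fully faithful morphisms -/

section FullyFaithful

variable {J : GrothendieckTopology C} {𝒴 : BasedCategory.{v₂, u₂} C} {𝒵 : BasedCategory.{v₃, u₃} C}
  (h𝒵 : IsStack J 𝒵) (F : 𝒴 ⥤ᵇ 𝒵)

lemma extFunctor_faithful [F.Faithful] : (extFunctor h𝒵 F).Faithful where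
  map_injective {X Y f g} e := by
    obtain ⟨φ, rfl⟩ := LocObj.PreHom.exists_toHom_eq f
    obtain ⟨ψ, rfl⟩ := LocObj.PreHom.exists_toHom_eq g
    have hφ := extFunctor_isExtMap h𝒵 F φ
    have hψ := extFunctor_isExtMap h𝒵 F ψ
    rw [← e] at hψ
    have hb : φ.base = ψ.base := by
      have h1 := hφ.isHomLift
      have h2 := hψ.isHomLift
      have := (isHomLift_fac h1).symm.trans (isHomLift_fac h2)
      exact (cancel_mono _).1 ((cancel_epi _).1 this)
    refine LocObj.PreHom.toHom_eq_of_at φ ψ hb (φ.dom ⊓ ψ.dom)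
      (J.intersection_covering φ.dom_mem ψ.dom_mem) inf_le_left inf_le_right ?_
    intro T s hs l hl e₁ e₂
    refine F.map_injective (h𝒵.fibered.cancel (𝟙 T) (extLeg h𝒵 F Y l hl)
      ((F.isHomLift_iff _ _).2 (φ.at_isHomLift s hs.1 l hl e₁))
      ((F.isHomLift_iff _ _).2 (ψ.at_isHomLift s hs.2 l hl e₂)) ?_)
    exact (hφ.leg_comp s hs.1 l hl e₁).symm.trans (hψ.leg_comp s hs.2 l hl e₂)

/-- An arrow between glued objects restricts, on a covering sieve, to arrows between the images of
the values of the descent data; these lift to `𝒴`. -/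
lemma extFunctor_full [F.Faithful] [F.Full] : (extFunctor h𝒵 F).Full where
  map_surjective {X Y} m := by
    let X' : LocObj J 𝒴 := X
    let Y' : LocObj J 𝒴 := Y
    let m' : extObj h𝒵 F X' ⟶ extObj h𝒵 F Y' := m
    let f : X'.base ⟶ Y'.base := eqToHom (p_extObj h𝒵 F X').symm ≫ 𝒵.p.map m' ≫
      eqToHom (p_extObj h𝒵 F Y')
    have hm : 𝒵.p.IsHomLift f m' := IsHomLift.of_fac 𝒵.p f m' (p_extObj h𝒵 F X')
      (p_extObj h𝒵 F Y') rfl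
    let W : Sieve X'.base := X'.cover ⊓ Y'.cover.pullback f
    have hex {T : C} (s : T ⟶ X'.base) (hs : W s) :
        ∃ χ : X'.val s hs.1 ⟶ Y'.val (s ≫ f) hs.2, 𝒴.p.IsHomLift (𝟙 T) χ ∧
          F.map χ ≫ extLeg h𝒵 F Y' (s ≫ f) hs.2 = extLeg h𝒵 F X' s hs.1 ≫ m' := by
      obtain ⟨χ, hχ, hχ'⟩ := h𝒵.fibered.exists_lift (s ≫ f) (𝟙 T) (extLeg h𝒵 F Y' (s ≫ f) hs.2)
        (extLeg h𝒵 F X' s hs.1 ≫ m') (extLeg_isHomLift h𝒵 F Y' _ _)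
        (isHomLift_comp (extLeg_isHomLift h𝒵 F X' s hs.1) hm (Category.id_comp _).symm)
      obtain ⟨χ₀, rfl⟩ := F.map_surjective χ
      exact ⟨χ₀, (F.isHomLift_iff _ _).1 hχ, hχ'⟩
    choose χ hχ hχ' using @hex
    let φ : LocObj.PreHom X' Y' := LocObj.PreHom.ofAt f W
      (J.intersection_covering X'.cover_mem (J.pullback_stable f Y'.cover_mem)) inf_le_left
      inf_le_right (fun s hs => χ s hs) (fun s hs => hχ s hs) (by
        intro T T' s hs s' hs' g e
        have hX := X'.res_isHomLift (hs := hs.1) (hs' := hs'.1) g e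
        have e' : g ≫ s ≫ f = s' ≫ f := by rw [← e, Category.assoc]
        have hY := Y'.res_isHomLift (hs := hs.2) (hs' := hs'.2) g e'
        refine F.map_injective (h𝒵.fibered.cancel g (extLeg h𝒵 F Y' (s ≫ f) hs.2)
          ((F.isHomLift_iff _ _).2 (isHomLift_comp_id hX (hχ s hs)))
          ((F.isHomLift_iff _ _).2 (isHomLift_id_comp (hχ s' hs') hY)) ?_)
        rw [F.map_comp, F.map_comp, Category.assoc, Category.assoc, hχ', ← Category.assoc]
        exact (congrArg (· ≫ m') (map_res_extLeg h𝒵 F X' g e)).trans ((hχ' s' hs').symm.trans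
          (congrArg (F.map (χ s' hs') ≫ ·) (map_res_extLeg h𝒵 F Y' g e').symm)))
    refine ⟨φ.toHom, extFunctor_map_eq h𝒵 F ⟨hm, ?_⟩⟩
    intro T s hs l hl e
    subst e
    refine (hχ' s hs).symm.trans (congrArg (fun k => F.map k ≫ _) ?_)
    exact ((congrArg (χ s hs ≫ ·) (Y'.res_id (Category.id_comp _))).trans
      (Category.comp_id _)).symm

/-- The extension of a fully faithful morphism hits every object which the given morphism hits
locally. -/
lemma extFunctor_exists_iso [F.Faithful] [F.Full] (z : 𝒵.obj) (R : Sieve (𝒵.p.obj z))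
    (hR : R ∈ J (𝒵.p.obj z))
    (hz : ∀ {T : C} (k : T ⟶ 𝒵.p.obj z), R k →
      ∃ (y : 𝒴.obj) (α : F.obj y ⟶ z), 𝒵.p.IsHomLift k α) :
    ∃ (X : (stackification J 𝒴).obj) (α : (extFunctor h𝒵 F).obj X ⟶ z),
      𝒵.p.IsHomLift (𝟙 (𝒵.p.obj z)) α := by
  choose y α hα using @hz
  have hres {T T' : C} (k : T ⟶ 𝒵.p.obj z) (hk : R k) (k' : T' ⟶ 𝒵.p.obj z) (hk' : R k')
      (g : T' ⟶ T) (e : g ≫ k = k') : ∃ χ : y k' hk' ⟶ y k hk, 𝒴.p.IsHomLift g χ ∧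
        F.map χ ≫ α k hk = α k' hk' := by
    obtain ⟨χ, hχ, hχ'⟩ := h𝒵.fibered.exists_lift k g (α k hk) (α k' hk') (hα k hk)
      (e.symm ▸ hα k' hk')
    obtain ⟨χ₀, rfl⟩ := F.map_surjective χ
    exact ⟨χ₀, (F.isHomLift_iff _ _).1 hχ, hχ'⟩
  choose r hr hr' using @hres
  have huniq {T T' : C} {k : T ⟶ 𝒵.p.obj z} {hk : R k} {k' : T' ⟶ 𝒵.p.obj z} {hk' : R k'}
      {g : T' ⟶ T} {χ χ' : y k' hk' ⟶ y k hk} (h1 : 𝒴.p.IsHomLift g χ) (h2 : 𝒴.p.IsHomLift g χ')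
      (e : F.map χ ≫ α k hk = F.map χ' ≫ α k hk) : χ = χ' :=
    F.map_injective (h𝒵.fibered.cancel g (α k hk) ((F.isHomLift_iff _ _).2 (h1))
      ((F.isHomLift_iff _ _).2 (h2)) e)
  have hcomp {T T' T'' : C} (k : T ⟶ 𝒵.p.obj z) (hk : R k) (k' : T' ⟶ 𝒵.p.obj z) (hk' : R k')
      (k'' : T'' ⟶ 𝒵.p.obj z) (hk'' : R k'') (g : T' ⟶ T) (e : g ≫ k = k') (g' : T'' ⟶ T')
      (e' : g' ≫ k' = k'') (g'' : T'' ⟶ T) (e'' : g'' ≫ k = k'') :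
      F.map (r k hk k'' hk'' g'' e'') ≫ α k hk =
        F.map (r k' hk' k'' hk'' g' e' ≫ r k hk k' hk' g e) ≫ α k hk := by
    rw [F.map_comp, Category.assoc, hr', hr', hr']
  -- the objects which hit `z` locally form a descent datum, with transition arrows from fullness
  let D : elts R.functor ⥤ᵇ 𝒴 := mkEltsFunctor (fun x => y x.1 x.2)
    (fun {T T' x x'} g e => r x.1 x.2 x'.1 x'.2 g (congrArg Subtype.val e))
    (fun g e => hr _ _ _ _ _ _)
    (fun {T} x e => huniq (hr _ _ _ _ _ _)
      (IsHomLift.id ((F.w_obj _).symm.trans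
        (have := hα x.1 x.2; IsHomLift.domain_eq 𝒵.p x.1 (α x.1 x.2))))
      ((hr' _ _ _ _ _ _).trans (by simp)))
    (fun g e g' e' e'' => huniq (hr _ _ _ _ _ _)
      (isHomLift_comp (hr _ _ _ _ _ _) (hr _ _ _ _ _ _) rfl)
      (hcomp _ _ _ _ _ _ _ _ _ _ _ _))
  let X : LocObj J 𝒴 := ⟨𝒵.p.obj z, R, hR, D⟩
  obtain ⟨t, ht, -⟩ := h𝒵.hasDescent.glue h𝒵.fibered (𝟙 (𝒵.p.obj z)) (p_extObj h𝒵 F X) rfl hR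
    (fun k hk => F.obj (X.val k hk)) (fun k hk => extLeg h𝒵 F X k hk)
    (fun k hk => extLeg_isHomLift h𝒵 F X k hk) (fun k hk => α k hk)
    (fun k hk => (Category.comp_id k).symm ▸ hα k hk)
    (fun k hk g hk' => ⟨F.map (X.res (hs := hk) (hs' := hk') g rfl),
      (F.isHomLift_iff _ _).2 (X.res_isHomLift g rfl), map_res_extLeg h𝒵 F X g rfl,
      hr' k hk _ hk' g rfl⟩)
  exact ⟨X, t, ht⟩

end FullyFaithful

/-! ### Equivalences over the base -/

section Equivalence

variable {J : GrothendieckTopology C} {𝒳 : BasedCategory.{v₂, u₂} C} {𝒴 : BasedCategory.{v₃, u₃} C}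
  {F : 𝒳 ⥤ᵇ 𝒴}

lemma map_eq_iff_isHomLift {a b : 𝒳.obj} {f : 𝒳.p.obj a ⟶ 𝒳.p.obj b} {φ : a ⟶ b} :
    𝒳.p.map φ = f ↔ 𝒳.p.IsHomLift f φ :=
  ⟨fun h => h ▸ inferInstance, fun _ => (IsHomLift.eq_of_isHomLift 𝒳.p f φ).symm⟩

lemma exists_lift_of_full [F.Full] {a b : 𝒳.obj} {R S : C} {f : R ⟶ S} {φ : F.obj a ⟶ F.obj b}
    (hφ : 𝒴.p.IsHomLift f φ) : ∃ ψ : a ⟶ b, 𝒳.p.IsHomLift f ψ ∧ F.map ψ = φ := by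
  obtain ⟨ψ, rfl⟩ := F.map_surjective φ
  exact ⟨ψ, (F.isHomLift_iff _ _).1 hφ, rfl⟩

/-- A category over `C` which maps fully faithfully to a category fibered in groupoids, hitting
every object up to an isomorphism over `C`, is fibered in groupoids. -/
lemma isFiberedInGroupoids_of_fullyFaithful [F.Full] [F.Faithful] (h : IsFiberedInGroupoids 𝒴)
    (hF : ∀ y : 𝒴.obj, ∃ (x : 𝒳.obj) (α : F.obj x ⟶ y), 𝒴.p.IsHomLift (𝟙 (𝒴.p.obj y)) α) :
    IsFiberedInGroupoids 𝒳 := by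
  refine isFiberedInGroupoids_of_existsUnique 𝒳 (fun a R f => ?_) fun {c a b} φ φ' t ht => ?_
  · let f' : R ⟶ 𝒴.p.obj (F.obj a) := f ≫ eqToHom (F.w_obj a).symm
    have hf' : 𝒴.p.IsHomLift f (h.pullMap (F.obj a) f') :=
      have := h.pullMap_isHomLift (F.obj a) f'
      IsHomLift.of_fac' 𝒴.p f _ (h.pull_obj (F.obj a) f') (F.w_obj a)
        ((isHomLift_fac this).trans (by simp [f']))
    obtain ⟨b, α, hα⟩ := hF (h.pull (F.obj a) f')
    rw [h.pull_obj] at hα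
    obtain ⟨ψ, hψ, -⟩ := exists_lift_of_full (isHomLift_id_comp hα hf')
    exact ⟨b, ψ, hψ⟩
  · have hφ := (F.isHomLift_iff (𝒳.p.map φ) φ).2 inferInstance
    have hφ' := (F.isHomLift_iff (t ≫ 𝒳.p.map φ) φ').2 (ht ▸ inferInstance)
    obtain ⟨χ, hχ, hχφ⟩ := h.exists_lift (𝒳.p.map φ) t (F.map φ) (F.map φ') hφ hφ'
    obtain ⟨ψ, hψ, rfl⟩ := exists_lift_of_full hχ
    refine ⟨ψ, ⟨map_eq_iff_isHomLift.2 hψ, F.map_injective (by rw [F.map_comp, hχφ])⟩, ?_⟩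
    rintro ψ' ⟨h1, h2⟩
    refine F.map_injective (h.cancel t (F.map φ)
      ((F.isHomLift_iff _ _).2 (map_eq_iff_isHomLift.1 h1)) hχ ?_)
    rw [hχφ, ← F.map_comp, h2]

/-- Effective descent is inherited along a fully faithful morphism which hits every object up to an
isomorphism over `C`. -/
lemma isStack_of_fullyFaithful [F.Full] [F.Faithful] (h𝒴 : IsStack J 𝒴)
    (hF : ∀ y : 𝒴.obj, ∃ (x : 𝒳.obj) (α : F.obj x ⟶ y), 𝒴.p.IsHomLift (𝟙 (𝒴.p.obj y)) α) :
    IsStack J 𝒳 := by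
  have h := h𝒴.fibered
  have hd := h𝒴.hasDescent
  have h𝒳 := isFiberedInGroupoids_of_fullyFaithful h hF
  have hl {a : 𝒳.obj} {T : C} (s : T ⟶ 𝒳.p.obj a) : 𝒴.p.IsHomLift s (F.map (h𝒳.pullMap a s)) :=
    (F.isHomLift_iff _ _).2 (h𝒳.pullMap_isHomLift a s)
  have hmem {a : 𝒳.obj} (W : Sieve (𝒳.p.obj a)) {T : C} (s : T ⟶ 𝒳.p.obj a) (hs : W s) :
      W (𝒳.p.map (h𝒳.pullMap a s)) := mem_of_isHomLift (h𝒳.pullMap_isHomLift a s) W hs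
  refine HasDescent.isStack ⟨fun {a b} W hW m m' hm hmm => ?_,
    fun {a b} f W hW m hm nat => ?_, fun {S} R hR D => ?_⟩ h𝒳
  · refine F.map_injective (hd.ext_of_legs h hW (i := fun s _ => F.map (h𝒳.pullMap a s))
      (fun s _ => hl s) ((F.isHomLift_iff (𝒳.p.map m) m).2 inferInstance)
      ((F.isHomLift_iff (𝒳.p.map m) m').2 (hm ▸ inferInstance)) fun s hs => ?_)
    rw [← F.map_comp, ← F.map_comp, hmm _ (hmem W s hs)]
  · obtain ⟨m', hm', hmm'⟩ := hd.glue h f (F.w_obj a) (F.w_obj b) hW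
      (fun s _ => F.obj (h𝒳.pull a s)) (fun s _ => F.map (h𝒳.pullMap a s)) (fun s _ => hl s)
      (fun s hs => F.map (m (h𝒳.pullMap a s) (hmem W s hs)))
      (fun s hs => (F.isHomLift_iff _ _).2 (by
        have := h𝒳.pullMap_isHomLift a s
        apply IsHomLift.of_fac' 𝒳.p _ _ (h𝒳.pull_obj a s) rfl
        rw [hm, isHomLift_fac this]
        simp))
      (fun s hs g hs' => by
        have e := h𝒳.pullLift_pullMap a (g ≫ s) s g rfl
        refine ⟨F.map (h𝒳.pullLift a (g ≫ s) s g rfl),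
          (F.isHomLift_iff _ _).2 (h𝒳.pullLift_isHomLift a _ _ g rfl), ?_, ?_⟩
        · rw [← F.map_comp, e]
        · rw [← F.map_comp, ← nat _ _ _ (by rw [e]; exact hmem W _ hs')]
          congr 2)
    obtain ⟨n, hn, rfl⟩ := exists_lift_of_full hm'
    have hn' {T : C} (s : T ⟶ 𝒳.p.obj a) (hs : W s) :
        h𝒳.pullMap a s ≫ n = m (h𝒳.pullMap a s) (hmem W s hs) :=
      F.map_injective (by rw [F.map_comp, hmm' s hs])
    refine ⟨n, map_eq_iff_isHomLift.2 hn, fun {c} φ hφ => ?_⟩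
    obtain ⟨χ, -, hχ⟩ := h𝒳.exists_lift (𝒳.p.map φ) (𝟙 _) (h𝒳.pullMap a _) φ
      (h𝒳.pullMap_isHomLift _ _) inferInstance
    have h1 := nat χ (h𝒳.pullMap a (𝒳.p.map φ)) (hmem W _ hφ) (by rw [hχ]; exact hφ)
    rw [← hn' _ hφ, ← Category.assoc] at h1
    simp only [hχ] at h1
    exact h1.symm
  · obtain ⟨z, i, hz, hi, hi'⟩ := hd.exists_obj R hR (D.comp F)
    obtain ⟨x, α, hα⟩ := hF z
    rw [hz] at hα
    have hiso := isIso_of_isFiberedInGroupoids h α (S := S)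
    have hinv : 𝒴.p.IsHomLift (𝟙 S) (inv α) := IsHomLift.lift_id_inv_isIso 𝒴.p _ _
    have hex {T : C} (k : R.functor.obj (op T)) := exists_lift_of_full (F := F) (a := D.obj (elt k))
      (b := x) (isHomLift_comp_id (hi k) hinv)
    choose j hj hj' using @hex
    refine ⟨x, j, ?_, hj, fun {T T' k k'} g e => F.map_injective ?_⟩
    · exact (F.w_obj x).symm.trans (IsHomLift.domain_eq 𝒴.p (𝟙 S) α)
    · refine (F.map_comp _ _).trans ((congrArg (_ ≫ ·) (hj' k)).trans ?_)
      exact (Category.assoc _ _ _).symm.trans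
        ((congrArg (· ≫ inv α) (hi' g e)).trans (hj' k').symm)

/-- The quasi-inverse sends `y` to a chosen object whose image is isomorphic to `y` over the
identity, so that it commutes with the projections to `C`. -/
lemma isEquivalence_of_fullyFaithful [F.Full] [F.Faithful] (h : IsFiberedInGroupoids 𝒴)
    (hF : ∀ y : 𝒴.obj, ∃ (x : 𝒳.obj) (α : F.obj x ⟶ y), 𝒴.p.IsHomLift (𝟙 (𝒴.p.obj y)) α) :
    IsEquivalence F := by
  have h𝒳 := isFiberedInGroupoids_of_fullyFaithful h hF
  choose o α hα using hF
  have hiso (y : 𝒴.obj) : IsIso (α y) :=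
    have := hα y
    isIso_of_isFiberedInGroupoids h (S := 𝒴.p.obj y) (α y)
  have hinv (y : 𝒴.obj) : 𝒴.p.IsHomLift (𝟙 _) (inv (α y)) :=
    have := hα y
    IsHomLift.lift_id_inv_isIso 𝒴.p (𝒴.p.obj y) (α y)
  have hm {y y' : 𝒴.obj} (m : y ⟶ y') : 𝒴.p.IsHomLift (𝒴.p.map m) (α y ≫ m ≫ inv (α y')) :=
    isHomLift_id_comp (hα y) (isHomLift_comp_id inferInstance (hinv y'))
  have ho (y : 𝒴.obj) : 𝒳.p.obj (o y) = 𝒴.p.obj y :=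
    (F.w_obj _).symm.trans (IsHomLift.domain_eq 𝒴.p (𝟙 _) (α y))
  let F' : 𝒴 ⥤ᵇ 𝒳 :=
    { obj := o
      map := fun {y y'} m => F.preimage (α y ≫ m ≫ inv (α y'))
      map_id := fun y => F.map_injective (by simp)
      map_comp := fun m m' => F.map_injective (by simp)
      w := CategoryTheory.Functor.ext ho fun y y' m => by
        have : 𝒳.p.IsHomLift (𝒴.p.map m) (F.preimage (α y ≫ m ≫ inv (α y'))) :=
          (F.isHomLift_iff _ _).1 (by rw [F.map_preimage]; exact hm m)
        exact isHomLift_fac this }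
  have hF' {y y' : 𝒴.obj} (m : y ⟶ y') : F.map (F'.map m) ≫ α y' = α y ≫ m := by
    refine (congrArg (· ≫ α y') (F.map_preimage _)).trans ?_
    simp
  let ε : F'.comp F ⟶ BasedFunctor.id 𝒴 :=
    { app := α
      naturality := fun y y' m => hF' m
      isHomLift' := fun y => hα y }
  have hex (x : 𝒳.obj) : ∃ β : o (F.obj x) ⟶ x, 𝒳.p.IsHomLift (𝟙 (𝒳.p.obj x)) β ∧
      F.map β = α (F.obj x) := by
    have hx := hα (F.obj x)
    rw [F.w_obj] at hx
    exact exists_lift_of_full hx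
  choose β hβ hβα using hex
  let η : F.comp F' ⟶ BasedFunctor.id 𝒳 :=
    { app := β
      naturality := fun x x' m => F.map_injective (by
        refine (F.map_comp _ _).trans (Eq.trans ?_ (F.map_comp _ _).symm)
        exact (congrArg (_ ≫ ·) (hβα x')).trans
          ((hF' (F.map m)).trans (congrArg (· ≫ F.map m) (hβα x).symm)))
      isHomLift' := hβ }
  have : IsIso ε := isIso_basedNatTrans h ε
  have : IsIso η := isIso_basedNatTrans h𝒳 η
  exact ⟨F', ⟨asIso η⟩, ⟨asIso ε⟩⟩

end Equivalence

/-! ### Sections of sheaves -/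

section Sheaf

variable {J : GrothendieckTopology C} {A : Cᵒᵖ ⥤ Type v}

lemma psh_map_map (A : Cᵒᵖ ⥤ Type v) {T T' T'' : C} (g : T' ⟶ T) (g' : T'' ⟶ T')
    (x : A.obj (op T)) : A.map g'.op (A.map g.op x) = A.map (g' ≫ g).op x :=
  (Functor.map_comp_apply A g.op g'.op x).symm

lemma psh_map_id (A : Cᵒᵖ ⥤ Type v) {T : C} (x : A.obj (op T)) : A.map (𝟙 T : T ⟶ T).op x = x :=
  Functor.map_id_apply A _ x

lemma psh_nat {A B : Cᵒᵖ ⥤ Type v} (u : A ⟶ B) {T T' : C} (g : T' ⟶ T) (x : A.obj (op T)) :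
    u.app _ (A.map g.op x) = B.map g.op (u.app _ x) :=
  NatTrans.naturality_apply u g.op x

lemma sheaf_ext (hA : Presieve.IsSheaf J A) {T : C} {W : Sieve T} (hW : W ∈ J T)
    {x y : A.obj (op T)} (h : ∀ {T' : C} (g : T' ⟶ T), W g → A.map g.op x = A.map g.op y) :
    x = y :=
  (hA W hW).isSeparatedFor.ext fun _ g hg => h g hg

lemma sheaf_exists (hA : Presieve.IsSheaf J A) {T : C} {W : Sieve T} (hW : W ∈ J T)
    (x : ∀ {T' : C} (g : T' ⟶ T), W g → A.obj (op T'))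
    (hx : ∀ {T' T'' : C} (g : T' ⟶ T) (hg : W g) (k : T'' ⟶ T') (hk : W (k ≫ g)),
      A.map k.op (x g hg) = x (k ≫ g) hk) :
    ∃ y, ∀ {T' : C} (g : T' ⟶ T) (hg : W g), A.map g.op y = x g hg := by
  obtain ⟨y, hy, -⟩ := hA W hW (fun _ g hg => x g hg)
    ((Presieve.compatible_iff_sieveCompatible _).2
      fun _ _ g k hg => (hx g hg k (W.downward_closed hg k)).symm)
  exact ⟨y, fun g hg => hy g hg⟩

/-- A section which exists uniquely locally exists. -/
lemma sheaf_exists_of_existsUnique (hA : Presieve.IsSheaf J A) {T : C} {W : Sieve T} (hW : W ∈ J T)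
    (Q : ∀ {T' : C} (_ : T' ⟶ T), A.obj (op T') → Prop)
    (hQ : ∀ {T' T'' : C} (g : T' ⟶ T) (k : T'' ⟶ T') (y : A.obj (op T')), Q g y →
      Q (k ≫ g) (A.map k.op y))
    (h : ∀ {T' : C} (g : T' ⟶ T), W g → ∃! y, Q g y) :
    ∃ y, ∀ {T' : C} (g : T' ⟶ T), W g → Q g (A.map g.op y) := by
  obtain ⟨y, hy⟩ := sheaf_exists hA hW (fun g hg => (h g hg).choose)
    (fun g hg k hk => (h (k ≫ g) hk).choose_spec.2 _ (hQ g k _ (h g hg).choose_spec.1))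
  exact ⟨y, fun g hg => by rw [hy g hg]; exact (h g hg).choose_spec.1⟩

end Sheaf

/-! ### Components of arrows of pairs -/

section Components

variable {𝒳 : BasedCategory.{v₂, u₂} C} {A B B' : Probe 𝒳}

/-- The component of an arrow of pairs at `x`, with values in the object at `y`. The equation
`u(x) = y` is kept as an argument, so that components at equal sections can be compared. -/
def Probe.Hom.at (α : A ⟶ B) {T : C} (x : A.psh.obj (op T)) (y : B.psh.obj (op T))
    (e : α.u.app _ x = y) : A.map.obj (elt x) ⟶ B.map.obj (elt y) :=
  α.γ.toNatTrans.app (elt x) ≫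
    B.map.map (eltHom (x := y) (x' := α.u.app _ x) (𝟙 T) ((psh_map_id _ _).trans e.symm))

lemma Probe.Hom.at_rfl (α : A ⟶ B) {T : C} (x : A.psh.obj (op T)) :
    Probe.Hom.at α x _ rfl = α.γ.toNatTrans.app (elt x) :=
  (congrArg (_ ≫ ·) (map_eltHom_id B.map _ _)).trans (Category.comp_id _)

lemma Probe.Hom.at_isHomLift (α : A ⟶ B) {T : C} (x : A.psh.obj (op T)) (y : B.psh.obj (op T))
    (e : α.u.app _ x = y) : 𝒳.p.IsHomLift (𝟙 T) (Probe.Hom.at α x y e) :=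
  isHomLift_comp_id (natTrans_app_isHomLift α.γ x) (map_eltHom_isHomLift _ _ _)

lemma Probe.Hom.at_nat (α : A ⟶ B) {T T' : C} {x : A.psh.obj (op T)} {y : B.psh.obj (op T)}
    {x' : A.psh.obj (op T')} {y' : B.psh.obj (op T')} (e : α.u.app _ x = y)
    (e' : α.u.app _ x' = y') (g : T' ⟶ T) (h : A.psh.map g.op x = x')
    (h' : B.psh.map g.op y = y') :
    A.map.map (eltHom g h) ≫ Probe.Hom.at α x y e =
      Probe.Hom.at α x' y' e' ≫ B.map.map (eltHom g h') := by
  subst e e'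
  exact (congrArg (_ ≫ ·) (at_rfl α x)).trans ((natTrans_nat α.γ g h).trans
    (congrArg (· ≫ B.map.map (eltHom g h')) (at_rfl α x').symm))

lemma Probe.Hom.at_congr {α β : A ⟶ B} (h : α = β) {T : C} (x : A.psh.obj (op T))
    (y : B.psh.obj (op T)) (e : α.u.app _ x = y) (e' : β.u.app _ x = y) :
    Probe.Hom.at α x y e = Probe.Hom.at β x y e' := by
  subst h; rfl

lemma Probe.Hom.at_comp (α : A ⟶ B) (β : B ⟶ B') {T : C} (x : A.psh.obj (op T))
    (y : B.psh.obj (op T)) (z : B'.psh.obj (op T)) (e : α.u.app _ x = y) (e' : β.u.app _ y = z)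
    (e'' : (α ≫ β).u.app _ x = z) :
    Probe.Hom.at (α ≫ β) x z e'' = Probe.Hom.at α x y e ≫ Probe.Hom.at β y z e' := by
  subst e e'
  exact (at_rfl (α ≫ β) x).trans (congrArg₂ (· ≫ ·) (at_rfl α x).symm (at_rfl β _).symm)

lemma Probe.Hom.at_id {T : C} (x : A.psh.obj (op T)) :
    Probe.Hom.at (𝟙 A) x x rfl = 𝟙 (A.map.obj (elt x)) :=
  at_rfl (𝟙 A) x

lemma Probe.hom_ext_of_at {α β : A ⟶ B}
    (hu : ∀ {T : C} (x : A.psh.obj (op T)), α.u.app _ x = β.u.app _ x)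
    (h : ∀ {T : C} (x : A.psh.obj (op T)) (y : B.psh.obj (op T)) (e : α.u.app _ x = y)
      (e' : β.u.app _ x = y), Probe.Hom.at α x y e = Probe.Hom.at β x y e') : α = β :=
  Probe.hom_ext_of_app (fun x => (psh_map_id _ _).trans (hu x).symm)
    fun x => (h x _ (hu x) rfl).trans (Probe.Hom.at_rfl β x)

/-- An arrow of pairs from its components. -/
def Probe.homOfAt (u : A.psh ⟶ B.psh)
    (m : ∀ {T : C} (x : A.psh.obj (op T)), A.map.obj (elt x) ⟶ B.map.obj (elt (u.app _ x)))
    (hm : ∀ {T : C} (x : A.psh.obj (op T)), 𝒳.p.IsHomLift (𝟙 T) (m x))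
    (nat : ∀ {T T' : C} {x : A.psh.obj (op T)} {x' : A.psh.obj (op T')} (g : T' ⟶ T)
      (h : A.psh.map g.op x = x') (h' : B.psh.map g.op (u.app _ x) = u.app _ x'),
      A.map.map (eltHom g h) ≫ m x = m x' ≫ B.map.map (eltHom g h')) : A ⟶ B :=
  ⟨u, mkEltsNatTrans (fun x => m x) (fun x => hm x)
    (fun {_ _ x _} g h => nat g h ((psh_nat u g x).symm.trans (congrArg (u.app _ ·) h)))⟩

lemma Probe.homOfAt_at (u : A.psh ⟶ B.psh)
    (m : ∀ {T : C} (x : A.psh.obj (op T)), A.map.obj (elt x) ⟶ B.map.obj (elt (u.app _ x))) (hm)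
    (nat) {T : C} (x : A.psh.obj (op T)) :
    Probe.Hom.at (Probe.homOfAt u m hm nat) x (u.app _ x) rfl = m x :=
  Probe.Hom.at_rfl _ x

end Components

/-! ### Extension from covering subpresheaves -/

section Covering

variable {J : GrothendieckTopology C} {𝒳 : BasedCategory.{v₂, u₂} C}

/-- The restriction of `(A, χ)` to a subpresheaf of `A`. -/
def Probe.restr (A : Probe 𝒳) (D : Subfunctor A.psh) : Probe 𝒳 :=
  ⟨D.toFunctor, (eltsMap D.ι).comp A.map⟩

/-- The inclusion of the restriction to a subpresheaf. -/
def Probe.inclusion (A : Probe 𝒳) (D : Subfunctor A.psh) : A.restr D ⟶ A :=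
  ⟨D.ι, 𝟙 _⟩

lemma Probe.inclusion_at (A : Probe 𝒳) (D : Subfunctor A.psh) {T : C} (x : A.psh.obj (op T))
    (hx : x ∈ D.obj (op T)) :
    Probe.Hom.at (A.inclusion D) (⟨x, hx⟩ : D.toFunctor.obj (op T)) x rfl =
      𝟙 (A.map.obj (elt x)) :=
  Probe.Hom.at_rfl (A.inclusion D) (⟨x, hx⟩ : D.toFunctor.obj (op T))

lemma Probe.inclusion_comp_at {A B : Probe 𝒳} {D : Subfunctor A.psh} {α : A ⟶ B}
    {α' : A.restr D ⟶ B} (h : A.inclusion D ≫ α = α') {T : C} (x : A.psh.obj (op T))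
    (hx : x ∈ D.obj (op T)) (y : B.psh.obj (op T)) (e : α.u.app _ x = y)
    (e' : α'.u.app _ (⟨x, hx⟩ : D.toFunctor.obj (op T)) = y) :
    Probe.Hom.at α x y e = Probe.Hom.at α' (⟨x, hx⟩ : D.toFunctor.obj (op T)) y e' := by
  have h1 := Probe.Hom.at_comp (A.inclusion D) α (⟨x, hx⟩ : D.toFunctor.obj (op T)) x y rfl e e
  have h2 := h1.trans ((congrArg (· ≫ _) (A.inclusion_at D x hx)).trans (Category.id_comp _))
  exact h2.symm.trans (Probe.Hom.at_congr h (⟨x, hx⟩ : D.toFunctor.obj (op T)) y e e')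

/-- Arrows of pairs into a sheaf over a stack agree if they agree on a covering subpresheaf. -/
lemma Probe.ext_of_inclusion (h𝒳 : IsStack J 𝒳) {A B : Probe 𝒳} (hB : Presieve.IsSheaf J B.psh)
    {D : Subfunctor A.psh} (hD : ∀ {T : C} (x : A.psh.obj (op T)), D.sieveOfSection x ∈ J T)
    {α β : A ⟶ B} (h : A.inclusion D ≫ α = A.inclusion D ≫ β) : α = β := by
  refine Probe.hom_ext_of_at (fun {T} x => sheaf_ext hB (hD x) fun {T'} g hg => ?_)
    fun {T} x y e e' => ?_
  · rw [← psh_nat α.u, ← psh_nat β.u]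
    exact congrArg (fun γ : A.restr D ⟶ B => γ.u.app _ (⟨_, hg⟩ : D.toFunctor.obj (op T'))) h
  · refine h𝒳.hasDescent.ext_of_legs h𝒳.fibered (hD x)
      (i := fun g _ => A.map.map (eltHom (x := x) g rfl)) (fun g _ => map_eltHom_isHomLift _ _ _)
      (Probe.Hom.at_isHomLift _ _ _ _) (Probe.Hom.at_isHomLift _ _ _ _) fun {T'} g hg => ?_
    have eα : α.u.app _ (A.psh.map g.op x) = B.psh.map g.op y :=
      (psh_nat α.u g x).trans (congrArg _ e)
    have eβ : β.u.app _ (A.psh.map g.op x) = B.psh.map g.op y :=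
      (psh_nat β.u g x).trans (congrArg _ e')
    refine (Probe.Hom.at_nat α e eα g rfl rfl).trans (Eq.trans ?_
      (Probe.Hom.at_nat β e' eβ g rfl rfl).symm)
    exact congrArg (· ≫ _) ((Probe.inclusion_comp_at h _ hg _ eα eβ).trans
      (Probe.inclusion_comp_at rfl _ hg _ eβ eβ).symm)

/-- Arrows of pairs into a sheaf over a stack extend from a covering subpresheaf. -/
lemma Probe.exists_extension (h𝒳 : IsStack J 𝒳) {A B : Probe 𝒳} (hB : Presieve.IsSheaf J B.psh)
    {D : Subfunctor A.psh} (hD : ∀ {T : C} (x : A.psh.obj (op T)), D.sieveOfSection x ∈ J T)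
    (α' : A.restr D ⟶ B) : ∃ α : A ⟶ B, A.inclusion D ≫ α = α' := by
  let v {T : C} (x : A.psh.obj (op T)) (hx : x ∈ D.obj (op T)) : B.psh.obj (op T) :=
    α'.u.app _ (⟨x, hx⟩ : D.toFunctor.obj (op T))
  have hv {T T' : C} (x : A.psh.obj (op T)) (hx : x ∈ D.obj (op T)) (g : T' ⟶ T)
      (x' : A.psh.obj (op T')) (hx' : x' ∈ D.obj (op T')) (e : A.psh.map g.op x = x') :
      B.psh.map g.op (v x hx) = v x' hx' := by
    subst e
    exact (psh_nat α'.u g (⟨x, hx⟩ : D.toFunctor.obj (op T))).symm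
  have hex {T : C} (x : A.psh.obj (op T)) := sheaf_exists hB (hD x) (fun g hg => v _ hg)
    (fun g hg k hk => hv _ hg k _ hk (psh_map_map _ _ _ _))
  choose w hw using @hex
  have hw' {T T' : C} (x : A.psh.obj (op T)) (g : T' ⟶ T)
      (x' : A.psh.obj (op T')) (hx' : x' ∈ D.obj (op T')) (e : A.psh.map g.op x = x') :
      B.psh.map g.op (w x) = v x' hx' := by
    subst e; exact hw x g hx'
  have hwv {T : C} (x : A.psh.obj (op T)) (hx : x ∈ D.obj (op T)) : w x = v x hx :=
    (psh_map_id _ _).symm.trans (hw' x (𝟙 T) x hx (psh_map_id _ _))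
  let u : A.psh ⟶ B.psh :=
    { app := fun T => ↾fun x => w (T := T.unop) x
      naturality := fun T T' g => by
        refine ConcreteCategory.hom_ext (C := Type v) _ _ fun x => ?_
        let g' : T'.unop ⟶ T.unop := g.unop
        let x' : A.psh.obj (op T.unop) := x
        change w (A.psh.map g'.op x') = B.psh.map g'.op (w x')
        refine sheaf_ext hB (hD (A.psh.map g'.op x')) fun {T''} k hk => ?_
        exact (hw _ k hk).trans ((hw' x' (k ≫ g') _ hk (psh_map_map _ _ _ _).symm).symm.trans
          (psh_map_map _ _ _ _).symm) }
  -- the components are glued from those at the restrictions of `x` which lie in `D`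
  have hm {T : C} (x : A.psh.obj (op T)) := h𝒳.hasDescent.glue h𝒳.fibered (𝟙 T)
    (p_obj_elt A.map x) (p_obj_elt B.map (w x)) (hD x)
    (fun g _ => A.map.obj (elt (A.psh.map g.op x))) (fun g _ => A.map.map (eltHom (x := x) g rfl))
    (fun g _ => map_eltHom_isHomLift _ _ _)
    (fun {T'} g hg => Probe.Hom.at α' (⟨_, hg⟩ : D.toFunctor.obj (op T'))
      (B.psh.map g.op (w x)) (hw x g hg).symm ≫ B.map.map (eltHom g rfl))
    (fun g hg => (Category.comp_id g).symm ▸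
      isHomLift_id_comp (Probe.Hom.at_isHomLift _ _ _ _) (map_eltHom_isHomLift _ _ _))
    (fun {T₁ T₂} g hg k hk => by
      have e := psh_map_map A.psh g k x
      have e' := psh_map_map B.psh g k (w x)
      refine ⟨A.map.map (eltHom k e), map_eltHom_isHomLift _ _ _,
        (map_eltHom_comp A.map g rfl k e rfl).symm, ?_⟩
      exact comp_comp_eq (map_eltHom_comp B.map g rfl k e' rfl).symm
        (Probe.Hom.at_nat α' (x := (⟨_, hg⟩ : D.toFunctor.obj (op T₁)))
          (x' := (⟨_, hk⟩ : D.toFunctor.obj (op T₂))) _ _ k (Subtype.ext e) e'))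
  choose m hm hmg using @hm
  have hmg' {T T' : C} (x : A.psh.obj (op T)) (g : T' ⟶ T) (x' : A.psh.obj (op T'))
      (hx' : x' ∈ D.obj (op T')) (e : A.psh.map g.op x = x') (y' : B.psh.obj (op T'))
      (e' : B.psh.map g.op (w x) = y')
      (e'' : α'.u.app _ (⟨x', hx'⟩ : D.toFunctor.obj (op T')) = y') :
      A.map.map (eltHom g e) ≫ m x = Probe.Hom.at α' (⟨x', hx'⟩ : D.toFunctor.obj (op T')) y' e'' ≫
        B.map.map (eltHom g e') := by
    subst e e'
    exact hmg x g hx'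
  refine ⟨Probe.homOfAt u (fun x => m x) (fun x => hm x) fun {T T' x x'} g h h' => ?_, ?_⟩
  · refine h𝒳.hasDescent.ext_of_legs h𝒳.fibered (hD x')
      (i := fun k _ => A.map.map (eltHom (x := x') k rfl)) (fun g _ => map_eltHom_isHomLift _ _ _)
      (isHomLift_comp_id (map_eltHom_isHomLift _ _ _) (hm x))
      (isHomLift_id_comp (hm x') (map_eltHom_isHomLift _ _ _)) fun {T''} k hk => ?_
    have e : A.psh.map (k ≫ g).op x = A.psh.map k.op x' :=
      (psh_map_map _ _ _ _).symm.trans (congrArg _ h)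
    have h₂ : B.psh.map g.op (w x) = w x' := h'
    have e' : B.psh.map (k ≫ g).op (w x) = B.psh.map k.op (w x') :=
      (psh_map_map _ _ _ _).symm.trans (congrArg _ h₂)
    have e'' := (hw x' k hk).symm
    have h1 : A.map.map (eltHom k rfl) ≫ A.map.map (eltHom g h) = A.map.map (eltHom (k ≫ g) e) :=
      (map_eltHom_comp A.map g h k rfl e).symm
    have h2 : B.map.map (eltHom k rfl) ≫ B.map.map (eltHom g h₂) =
        B.map.map (eltHom (k ≫ g) e') := (map_eltHom_comp B.map g h₂ k rfl e').symm
    refine (Category.assoc _ _ _).symm.trans ((congrArg (· ≫ m x) h1).trans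
      ((hmg' x (k ≫ g) _ hk e _ e' e'').trans ?_))
    refine (congrArg (_ ≫ ·) h2.symm).trans ((Category.assoc _ _ _).symm.trans ?_)
    exact (congrArg (· ≫ B.map.map (eltHom g h₂)) (hmg' x' k _ hk rfl _ rfl e'').symm).trans
      (Category.assoc _ _ _)
  · refine Probe.hom_ext_of_at (fun {T} x => hwv x.1 x.2) fun {T} x y e e' => ?_
    let x₀ : A.psh.obj (op T) := x.1
    have hy : w x₀ = y := e
    subst hy
    refine (Probe.Hom.at_comp (A.inclusion D) _ x x₀ (w x₀) rfl rfl e).trans ?_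
    refine (congrArg₂ (· ≫ ·) (A.inclusion_at D x₀ x.2)
      (Probe.homOfAt_at (A := A) (B := B) u (fun x => m x) _ _ x₀)).trans ?_
    have h1 := hmg' x₀ (𝟙 T) x₀ x.2 (psh_map_id _ _) (w x₀) (psh_map_id _ _) e'
    refine (congrArg (· ≫ m x₀) (map_eltHom_id A.map x₀ (psh_map_id _ _)).symm).trans (h1.trans ?_)
    exact (congrArg (_ ≫ ·) (map_eltHom_id B.map _ _)).trans (Category.comp_id _)

/-- Morphisms from a covering subpresheaf to a stack extend. -/
lemma exists_extension_of_covering (h𝒳 : IsStack J 𝒳) {A : Cᵒᵖ ⥤ Type v} {D : Subfunctor A}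
    (hD : ∀ {T : C} (x : A.obj (op T)), D.sieveOfSection x ∈ J T)
    (F : elts D.toFunctor ⥤ᵇ 𝒳) :
    ∃ F' : elts A ⥤ᵇ 𝒳, Nonempty (F ≅ (eltsMap D.ι).comp F') := by
  have hd := h𝒳.hasDescent
  have h := h𝒳.fibered
  let Fo {T : C} (x : A.obj (op T)) (hx : x ∈ D.obj (op T)) : 𝒳.obj :=
    F.obj (elt (⟨x, hx⟩ : D.toFunctor.obj (op T)))
  let Fm {T T' : C} (x : A.obj (op T)) (hx : x ∈ D.obj (op T)) (g : T' ⟶ T)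
      (x' : A.obj (op T')) (hx' : x' ∈ D.obj (op T')) (e : A.map g.op x = x') :
      Fo x' hx' ⟶ Fo x hx :=
    F.map (eltHom (A := D.toFunctor) (x := ⟨x, hx⟩) (x' := ⟨x', hx'⟩) g (Subtype.ext e))
  have hFm {T T' : C} (x : A.obj (op T)) (hx : x ∈ D.obj (op T)) (g : T' ⟶ T)
      (x' : A.obj (op T')) (hx' : x' ∈ D.obj (op T')) (e : A.map g.op x = x') :
      𝒳.p.IsHomLift g (Fm x hx g x' hx' e) := map_eltHom_isHomLift F _ _
  -- the object glued from the values of `F` at the restrictions of `x` which lie in `D`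
  have hex {T : C} (x : A.obj (op T)) : ∃ (o : 𝒳.obj)
      (j : ∀ {T' : C} (g : T' ⟶ T) (x' : A.obj (op T')) (hx' : x' ∈ D.obj (op T')),
        A.map g.op x = x' → (Fo x' hx' ⟶ o)),
      𝒳.p.obj o = T ∧ (∀ {T' : C} (g : T' ⟶ T) (x' : A.obj (op T')) (hx') (e), 𝒳.p.IsHomLift g
        (j g x' hx' e)) ∧
      ∀ {T' T'' : C} (g : T' ⟶ T) (x' : A.obj (op T')) (hx') (e) (k : T'' ⟶ T')
        (x'' : A.obj (op T'')) (hx'') (e' : A.map k.op x' = x'') (g' : T'' ⟶ T) (_ : k ≫ g = g')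
        (e''),
        Fm x' hx' k x'' hx'' e' ≫ j g x' hx' e = j g' x'' hx'' e'' := by
    let s : (D.sieveOfSection x).functor ⟶ D.toFunctor :=
      { app := fun T' => ↾fun g => ⟨A.map g.1.op x, g.2⟩
        naturality := fun T' T'' k => by
          refine ConcreteCategory.hom_ext (C := Type v) _ _ fun g => Subtype.ext ?_
          exact (psh_map_map A g.1 k.unop x).symm }
    obtain ⟨o, i, ho, hi, hi'⟩ := h𝒳.exists_obj (D.sieveOfSection x) (hD x) ((eltsMap s).comp F)
    have hj {T' : C} (g : T' ⟶ T) (x' : A.obj (op T')) (hx' : x' ∈ D.obj (op T'))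
        (e : A.map g.op x = x') : D.sieveOfSection x g := by
      subst e; exact hx'
    refine ⟨o, fun {T'} g x' hx' e => Fm (A.map g.op x) (hj g x' hx' e) (𝟙 T') x' hx'
      ((psh_map_id _ _).trans e) ≫ i ⟨g, hj g x' hx' e⟩, ho, fun g x' hx' e =>
      isHomLift_id_comp (hFm _ _ _ _ _ ((psh_map_id _ _).trans e)) (hi ⟨g, hj g x' hx' e⟩), ?_⟩
    intro T' T'' g x' hx' e k x'' hx'' e' g' hg e''
    subst e e' hg
    have h1 := hi' (x := (⟨g, hx'⟩ : (D.sieveOfSection x).functor.obj (op T')))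
      (x' := (⟨k ≫ g, hj _ _ hx'' e''⟩ : (D.sieveOfSection x).functor.obj (op T''))) k rfl
    have e₁ := psh_map_map A g k x
    have h2 : Fm (A.map g.op x) hx' (𝟙 T') _ hx' (psh_map_id _ _) = 𝟙 _ := map_eltHom_id F _ _
    have h3 : Fm (A.map g.op x) hx' k _ (hj _ _ hx'' e'') e₁ ≫ i ⟨g, hx'⟩ =
      i ⟨k ≫ g, hj _ _ hx'' e''⟩ := h1
    have h4 : Fm _ (hj _ _ hx'' e'') (𝟙 T'') _ hx'' ((psh_map_id _ _).trans e'') ≫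
        Fm (A.map g.op x) hx' k _ (hj _ _ hx'' e'') e₁ = Fm (A.map g.op x) hx' k _ hx'' rfl := by
      have := map_eltHom_comp F (x := (⟨_, hx'⟩ : D.toFunctor.obj (op T')))
        (x' := (⟨_, hj _ _ hx'' e''⟩ : D.toFunctor.obj (op T'')))
        (x'' := (⟨_, hx''⟩ : D.toFunctor.obj (op T''))) k (Subtype.ext e₁) (𝟙 T'')
        (Subtype.ext ((psh_map_id _ _).trans e''))
        (Subtype.ext ((congrArg (fun l : T'' ⟶ T' => A.map l.op (A.map g.op x))
          (Category.id_comp k))))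
      refine this.symm.trans (congrArg (fun m => F.map m) ?_)
      exact Quiver.Hom.unop_inj (Subtype.ext (congrArg Quiver.Hom.op (Category.id_comp k)))
    refine (congrArg (Fm (A.map g.op x) hx' k _ hx'' rfl ≫ ·)
      ((congrArg (· ≫ i ⟨g, hx'⟩) h2).trans (Category.id_comp _))).trans ?_
    exact (congrArg (· ≫ i ⟨g, hx'⟩) h4.symm).trans ((Category.assoc _ _ _).trans
      (congrArg (_ ≫ ·) h3))
  choose o j ho hj hjj using @hex
  have hext {T T' : C} (x : A.obj (op T)) (b : 𝒳.obj) (g : T ⟶ T') {m m' : o x ⟶ b}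
      (hm : 𝒳.p.IsHomLift g m) (hm' : 𝒳.p.IsHomLift g m')
      (e : ∀ {T'' : C} (k : T'' ⟶ T) (x'' : A.obj (op T'')) (hx'') (e : A.map k.op x = x''),
        j x k x'' hx'' e ≫ m = j x k x'' hx'' e ≫ m') : m = m' :=
    hd.ext_of_legs h (hD x) (i := fun k hk => j x k _ hk rfl) (fun k hk => hj x k _ hk rfl) hm hm'
      fun k hk => e k _ hk rfl
  have hres {T T' : C} (x : A.obj (op T)) (x' : A.obj (op T')) (g : T' ⟶ T)
      (e : A.map g.op x = x') : ∃ r : o x' ⟶ o x, 𝒳.p.IsHomLift g r ∧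
      ∀ {T'' : C} (k : T'' ⟶ T') (x'' : A.obj (op T'')) (hx'') (e' : A.map k.op x' = x'')
        (g' : T'' ⟶ T) (_ : k ≫ g = g') (e''),
        j x' k x'' hx'' e' ≫ r = j x g' x'' hx'' e'' := by
    have he {T'' : C} (k : T'' ⟶ T') : A.map (k ≫ g).op x = A.map k.op x' := by
      rw [← psh_map_map, e]
    obtain ⟨r, hr, hr'⟩ := hd.glue h g (ho x') (ho x) (hD x') (fun k hk => Fo _ hk)
      (fun k hk => j x' k _ hk rfl) (fun k hk => hj x' k _ hk rfl)
      (fun k hk => j x (k ≫ g) _ hk (he k)) (fun k hk => hj x _ _ hk _)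
      (fun k hk l hk' => ⟨Fm _ hk l _ hk' (psh_map_map A k l x'),
        hFm _ hk l _ hk' (psh_map_map A k l x'),
        hjj x' k _ hk rfl l _ hk' (psh_map_map A k l x') _ rfl rfl,
        hjj x (k ≫ g) _ hk (he k) l _ hk' (psh_map_map A k l x') _ (Category.assoc _ _ _).symm
          (he (l ≫ k))⟩)
    exact ⟨r, hr, fun k x'' hx'' e' g' hg e'' => by subst e' hg; exact hr' k hx''⟩
  choose r hr hrj using @hres
  let F' : elts A ⥤ᵇ 𝒳 := mkEltsFunctor (fun x => o x) (fun g e => r _ _ g e)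
    (fun g e => hr _ _ g e)
    (fun {T} x e => hext x (o x) (𝟙 T) (hr _ _ _ _) (IsHomLift.id (ho x))
      fun k x'' hx'' e' => (hrj _ _ _ _ _ _ hx'' e' _ (Category.comp_id k) e').trans
        (Category.comp_id _).symm)
    (fun {T T' T'' x x' x''} g e g' e' e'' => hext x'' (o x) (g' ≫ g) (hr _ _ _ _)
      (isHomLift_comp (hr _ _ _ _) (hr _ _ _ _) rfl)
      fun {T₃} k x₃ hx₃ e₃ => by
        have e₄ : A.map (k ≫ g').op x' = x₃ := by rw [← psh_map_map, e', e₃]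
        have e₅ : A.map ((k ≫ g') ≫ g).op x = x₃ := by rw [← psh_map_map, e, e₄]
        rw [hrj _ _ _ _ _ _ hx₃ e₃ _ (Category.assoc _ _ _).symm e₅, ← Category.assoc,
          hrj _ _ _ _ _ _ hx₃ e₃ _ rfl e₄, hrj _ _ _ _ _ _ hx₃ e₄ _ rfl e₅])
  let α : F ⟶ (eltsMap D.ι).comp F' := mkEltsNatTrans
    (fun {T} x => j x.1 (𝟙 T) x.1 x.2 (psh_map_id _ _)) (fun x => hj _ _ _ _ _)
    (fun {T T' x x'} g e => by
      have e₁ : A.map g.op x.1 = x'.1 := congrArg Subtype.val e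
      refine (hjj x.1 (𝟙 T) x.1 x.2 (psh_map_id _ _) g x'.1 x'.2 e₁ g (Category.comp_id g) e₁).trans
        (hrj x.1 x'.1 g e₁ (𝟙 T') x'.1 x'.2 (psh_map_id _ _) g (Category.id_comp g) e₁).symm)
  have : IsIso α := isIso_basedNatTrans h α
  exact ⟨F', ⟨asIso α⟩⟩

end Covering

/-! ### Torsors and their pullbacks -/

section Torsors

variable {J : GrothendieckTopology C} {G : Cᵒᵖ ⥤ GrpCat.{v}}

lemma isSheaf_yoneda (J : GrothendieckTopology C) [J.Subcanonical] (T : C) :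
    Presieve.IsSheaf J (yoneda.obj T) :=
  GrothendieckTopology.Subcanonical.isSheaf_of_isRepresentable _

/-- The point of the base below a section of a torsor. -/
def Torsor.pr {T : C} (P : Torsor J G T) {S : C} (x : P.psh.obj (op S)) : S ⟶ T :=
  P.proj.app (op S) x

lemma Torsor.pr_map {T : C} (P : Torsor J G T) {S S' : C} (g : S' ⟶ S) (x : P.psh.obj (op S)) :
    P.pr (P.psh.map g.op x) = g ≫ P.pr x :=
  psh_nat P.proj g x

lemma Torsor.pr_smul {T : C} (P : Torsor J G T) {S : C} (g : G.obj (op S))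
    (x : P.psh.obj (op S)) : P.pr (P.smul g x) = P.pr x :=
  P.proj_smul g x

lemma Torsor.existsUnique_smul {T : C} (P : Torsor J G T) {S : C} {x y : P.psh.obj (op S)}
    (h : P.pr x = P.pr y) : ∃! g : G.obj (op S), P.smul g x = y :=
  P.simplyTransitive x y h

lemma Torsor.eq_one_of_smul_eq {T : C} (P : Torsor J G T) {S : C} {g : G.obj (op S)}
    {x : P.psh.obj (op S)} (h : P.smul g x = x) : g = 1 :=
  (P.existsUnique_smul rfl).unique h (P.one_smul x)

/-- `u : P → P'` is an equivariant map over `f`. -/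
structure IsTorsorMap {T T' : C} (P : Torsor J G T) (P' : Torsor J G T') (f : T ⟶ T')
    (u : P.psh ⟶ P'.psh) : Prop where
  pr_apply : ∀ {S : C} (x : P.psh.obj (op S)), P'.pr (u.app _ x) = P.pr x ≫ f
  smul_apply : ∀ {S : C} (g : G.obj (op S)) (x : P.psh.obj (op S)),
    u.app _ (P.smul g x) = P'.smul g (u.app _ x)

lemma IsTorsorMap.eq_of_apply_eq {T T' : C} {P : Torsor J G T} {P' : Torsor J G T'} {f : T ⟶ T'}
    {u : P.psh ⟶ P'.psh} (hu : IsTorsorMap P P' f u) {S : C} {x y : P.psh.obj (op S)}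
    (h : P.pr x = P.pr y) (e : u.app _ x = u.app _ y) : x = y := by
  obtain ⟨g, rfl, -⟩ := P.existsUnique_smul h
  rw [hu.smul_apply] at e
  rw [P'.eq_one_of_smul_eq e.symm, P.one_smul]

/-- Equivariant maps of torsors are cartesian: `P` is the pullback of `P'` along `f`. -/
lemma IsTorsorMap.existsUnique [J.Subcanonical] {T T' : C} {P : Torsor J G T} {P' : Torsor J G T'}
    {f : T ⟶ T'} {u : P.psh ⟶ P'.psh} (hu : IsTorsorMap P P' f u) {S : C} (x : P'.psh.obj (op S))
    (r : S ⟶ T) (h : P'.pr x = r ≫ f) : ∃! y : P.psh.obj (op S), P.pr y = r ∧ u.app _ y = x := by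
  have hW := J.pullback_stable r P.locallyTrivial
  -- local sections of `P` are moved into the fibre of `u` over `x` by the action
  obtain ⟨y, hy⟩ := sheaf_exists_of_existsUnique P.isSheaf hW
    (fun {S'} g y => P.pr y = g ≫ r ∧ u.app _ y = P'.psh.map g.op x)
    (fun g k y ⟨h1, h2⟩ => ⟨by rw [P.pr_map, h1, Category.assoc], by
      rw [psh_nat, h2, psh_map_map]⟩)
    (by
      rintro S' g ⟨z, hz⟩
      have hz' : P.pr z = g ≫ r := hz
      obtain ⟨a, ha, -⟩ := P'.existsUnique_smul (x := u.app _ z) (y := P'.psh.map g.op x)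
        (by rw [hu.pr_apply, hz', P'.pr_map, h, Category.assoc])
      refine ⟨P.smul a z, ⟨(P.pr_smul a z).trans hz', (hu.smul_apply a z).trans ha⟩, ?_⟩
      rintro y ⟨h1, h2⟩
      exact hu.eq_of_apply_eq (by rw [h1, P.pr_smul, hz']) (by rw [h2, hu.smul_apply, ha]))
  refine ⟨y, ⟨sheaf_ext (isSheaf_yoneda J T) hW fun g hg => ?_,
    sheaf_ext P'.isSheaf hW fun g hg => ?_⟩, ?_⟩
  · exact (P.pr_map g y).symm.trans (hy g hg).1
  · exact (psh_nat u g y).symm.trans (hy g hg).2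
  · rintro y' ⟨h1, h2⟩
    have h3 : P.pr y = r := sheaf_ext (isSheaf_yoneda J T) hW fun g hg =>
      (P.pr_map g y).symm.trans (hy g hg).1
    have h4 : u.app _ y = x := sheaf_ext P'.isSheaf hW fun g hg =>
      (psh_nat u g y).symm.trans (hy g hg).2
    exact hu.eq_of_apply_eq (h1.trans h3.symm) (h2.trans h4.symm)

/-- The pullback of a torsor `P` along `f : R ⟶ T`: pairs of a section of `P` and a section of `R`
over the same section of `T`. -/
def Torsor.pull [J.Subcanonical] {R T : C} (P : Torsor J G T) (f : R ⟶ T) : Torsor J G R where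
  psh :=
    { obj := fun S => {x : P.psh.obj S × (S.unop ⟶ R) // P.proj.app S x.1 = x.2 ≫ f}
      map := fun {S S'} s => ↾fun x => ⟨(P.psh.map s x.1.1, s.unop ≫ x.1.2), by
        rw [Category.assoc, ← x.2]
        exact psh_nat P.proj s.unop x.1.1⟩
      map_id := fun S => ConcreteCategory.hom_ext (C := Type v) _ _ fun x =>
        Subtype.ext (Prod.ext (Functor.map_id_apply _ _ _) (Category.id_comp _))
      map_comp := fun s s' => ConcreteCategory.hom_ext (C := Type v) _ _ fun x =>
        Subtype.ext (Prod.ext (Functor.map_comp_apply _ _ _ _) (Category.assoc _ _ _)) }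
  isSheaf := by
    intro S W hW x hx
    have hx' := (Presieve.compatible_iff_sieveCompatible _).1 hx
    obtain ⟨y, hy⟩ := sheaf_exists P.isSheaf hW (fun g hg => (x g hg).1.1)
      (fun g hg k hk => (congrArg (fun z => z.1.1) (hx' g k hg)).symm)
    obtain ⟨r, hr⟩ := sheaf_exists (isSheaf_yoneda J R) hW (fun g hg => (x g hg).1.2)
      (fun g hg k hk => (congrArg (fun z => z.1.2) (hx' g k hg)).symm)
    refine ⟨⟨(y, r), sheaf_ext (isSheaf_yoneda J T) hW fun {S'} g hg => ?_⟩,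
      fun S' g hg => Subtype.ext (Prod.ext (hy g hg) (hr g hg)), fun z hz => Subtype.ext
        (Prod.ext (sheaf_ext P.isSheaf hW fun g hg => ?_)
          (sheaf_ext (isSheaf_yoneda J R) hW fun g hg => ?_))⟩
    · have h1 : P.proj.app _ (x g hg).1.1 = (x g hg).1.2 ≫ f := (x g hg).2
      have h2 : g ≫ r = (x g hg).1.2 := hr g hg
      refine (psh_nat P.proj g y).symm.trans ((congrArg _ (hy g hg)).trans (h1.trans ?_))
      rw [← h2]
      exact Category.assoc _ _ _
    · exact (congrArg (fun z => z.1.1) (hz g hg)).trans (hy g hg).symm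
    · exact (congrArg (fun z => z.1.2) (hz g hg)).trans (hr g hg).symm
  proj :=
    { app := fun _ => ↾fun x => x.1.2
      naturality := fun _ _ _ => rfl }
  smul g x := ⟨(P.smul g x.1.1, x.1.2), (P.proj_smul g x.1.1).trans x.2⟩
  one_smul x := Subtype.ext (Prod.ext (P.one_smul _) rfl)
  mul_smul g h x := Subtype.ext (Prod.ext (P.mul_smul _ _ _) rfl)
  map_smul s g x := Subtype.ext (Prod.ext (P.map_smul _ _ _) rfl)
  proj_smul g x := rfl
  simplyTransitive {S} x y h := by
    have h' : x.1.2 = y.1.2 := h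
    obtain ⟨g, hg, hu⟩ := P.simplyTransitive x.1.1 y.1.1 (by rw [x.2, y.2, h'])
    exact ⟨g, Subtype.ext (Prod.ext hg h), fun g' hg' =>
      hu g' (congrArg (fun z => z.1.1) hg')⟩
  locallyTrivial := by
    refine J.superset_covering ?_ (J.pullback_stable f P.locallyTrivial)
    rintro S g ⟨y, hy⟩
    exact ⟨⟨(y, g), hy⟩, rfl⟩

/-- The projection of the pullback of a torsor. -/
def Torsor.pullFst [J.Subcanonical] {R T : C} (P : Torsor J G T) (f : R ⟶ T) :
    (P.pull f).psh ⟶ P.psh where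
  app _ := ↾fun x => x.1.1
  naturality _ _ _ := rfl

lemma Torsor.isTorsorMap_pullFst [J.Subcanonical] {R T : C} (P : Torsor J G T) (f : R ⟶ T) :
    IsTorsorMap (P.pull f) P f (P.pullFst f) :=
  ⟨fun x => x.2, fun _ _ => rfl⟩

/-- The sections of a torsor over the arrows of a sieve. -/
def Torsor.over {T : C} (P : Torsor J G T) (W : Sieve T) : Subfunctor P.psh where
  obj S := {x | W (P.pr (S := S.unop) x)}
  map {S S'} s x hx := by
    change W (P.pr (P.psh.map s.unop.op x))
    rw [P.pr_map]
    exact W.downward_closed hx _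

lemma Torsor.over_covering {T : C} (P : Torsor J G T) {W : Sieve T} (hW : W ∈ J T) {S : C}
    (x : P.psh.obj (op S)) : (P.over W).sieveOfSection x ∈ J S := by
  refine J.superset_covering ?_ (J.pullback_stable (P.pr x) hW)
  intro S' g hg
  change W (P.pr (P.psh.map g.op x))
  rw [P.pr_map]
  exact hg

end Torsors

/-! ### Arrows of torsors over a stack -/

section Unpar

variable {J : GrothendieckTopology C} {G : Cᵒᵖ ⥤ GrpCat.{v}} {𝒳 : BasedCategory.{v₂, u₂} C}

lemma UnparObj.Hom.isTorsorMap {X X' : UnparObj J G 𝒳} (φ : X ⟶ X') :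
    IsTorsorMap X.torsor X'.torsor (UnparObj.Hom.base φ) (UnparObj.Hom.hom φ).u where
  pr_apply {S} x := congrArg (fun a : X.torsor.psh ⟶ _ => a.app (op S) x) (UnparObj.Hom.proj_hom φ)
  smul_apply g x := UnparObj.Hom.smul_hom φ g x

/-- An arrow of torsors over `𝒳`. -/
def UnparObj.homMk {X X' : UnparObj J G 𝒳} (f : X.base ⟶ X'.base) (α : X.probe ⟶ X'.probe)
    (h : IsTorsorMap X.torsor X'.torsor f α.u) : X ⟶ X' :=
  UnparObj.Hom.mk f α (psh_hom_ext fun _ x => h.pr_apply x) (fun g x => h.smul_apply g x)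

/-- Every arrow of torsors over `𝒳` is cartesian. -/
lemma UnparObj.existsUnique_lift [J.Subcanonical] (h : IsFiberedInGroupoids 𝒳)
    {Z X X' : UnparObj J G 𝒳} (φ : X ⟶ X') (φ' : Z ⟶ X') (t : Z.base ⟶ X.base)
    (ht : t ≫ UnparObj.Hom.base φ = UnparObj.Hom.base φ') :
    ∃! ψ : Z ⟶ X, UnparObj.Hom.base ψ = t ∧ ψ ≫ φ = φ' := by
  have hφ := UnparObj.Hom.isTorsorMap φ
  have hφ' := UnparObj.Hom.isTorsorMap φ'
  have hex {S : C} (z : Z.torsor.psh.obj (op S)) := hφ.existsUnique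
    ((UnparObj.Hom.hom φ').u.app _ z) (Z.torsor.pr z ≫ t)
    (by rw [hφ'.pr_apply, Category.assoc, ht])
  choose w hw hw' using @hex
  simp only at hw hw'
  let u : Z.torsor.psh ⟶ X.torsor.psh :=
    { app := fun S => ↾fun z => w (S := S.unop) z
      naturality := fun S S' s => by
        refine ConcreteCategory.hom_ext (C := Type v) _ _ fun z => ?_
        refine (hw' (S := S'.unop) (Z.torsor.psh.map s.unop.op z)
          (X.torsor.psh.map s.unop.op (w (S := S.unop) z)) ⟨?_, ?_⟩).symm
        · rw [Torsor.pr_map, (hw _).1, Torsor.pr_map, Category.assoc]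
        · rw [psh_nat, (hw _).2, psh_nat] }
  have hu : IsTorsorMap Z.torsor X.torsor t u := by
    refine ⟨fun z => (hw z).1, fun g z => (hw' _ (X.torsor.smul g (w z)) ⟨?_, ?_⟩).symm⟩
    · rw [Torsor.pr_smul, (hw z).1, Torsor.pr_smul]
    · rw [hφ.smul_apply, (hw z).2, hφ'.smul_apply]
  obtain ⟨ψ, ⟨hψ, hψφ⟩, huniq⟩ := Probe.existsUnique_lift h (UnparObj.Hom.hom φ)
    (UnparObj.Hom.hom φ') u (psh_hom_ext fun S z => (hw (S := S.unop) z).2)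
  refine ⟨UnparObj.homMk t ψ (hψ ▸ hu), ⟨rfl, UnparObj.Hom.ext ht hψφ⟩, ?_⟩
  rintro χ ⟨h1, h2⟩
  have hχ := UnparObj.Hom.isTorsorMap χ
  refine UnparObj.Hom.ext h1 (huniq (UnparObj.Hom.hom χ) ⟨psh_hom_ext fun S z => ?_,
    congrArg (fun m : Z ⟶ X' => UnparObj.Hom.hom m) h2⟩)
  refine hw' (S := S.unop) z _ ⟨?_, ?_⟩
  · rw [hχ.pr_apply, h1]
  · exact congrArg (fun m : Z ⟶ X' => (UnparObj.Hom.hom m).u.app S z) h2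

variable [J.Subcanonical]

/-- The pullback of a torsor over `𝒳`. -/
def UnparObj.pull (X : UnparObj J G 𝒳) {R : C} (f : R ⟶ X.base) : UnparObj J G 𝒳 :=
  ⟨R, X.torsor.pull f, (eltsMap (X.torsor.pullFst f)).comp X.map⟩

/-- The projection from the pullback of a torsor over `𝒳`. -/
def UnparObj.pullHom (X : UnparObj J G 𝒳) {R : C} (f : R ⟶ X.base) : X.pull f ⟶ X :=
  UnparObj.homMk (X := X.pull f) f ⟨X.torsor.pullFst f, 𝟙 _⟩ (X.torsor.isTorsorMap_pullFst f)

lemma isFiberedInGroupoids_unparStack (h : IsFiberedInGroupoids 𝒳) :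
    IsFiberedInGroupoids (unparStack J G 𝒳) := by
  refine isFiberedInGroupoids_of_existsUnique _ (fun X R f => ?_)
    fun φ φ' t ht => UnparObj.existsUnique_lift h φ φ' t ht
  exact ⟨UnparObj.pull X f, UnparObj.pullHom X f,
    IsHomLift.map (p := (unparStack J G 𝒳).p) (UnparObj.pullHom X f)⟩

/-- The canonical section of the pullback of a torsor along the projection of a section `x`. -/
def UnparObj.pullElt (X : UnparObj J G 𝒳) {S : C} (x : X.torsor.psh.obj (op S)) :
    (X.pull (X.torsor.pr x)).torsor.psh.obj (op S) :=
  ⟨(x, 𝟙 S), (Category.id_comp _).symm⟩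

lemma UnparObj.pullHom_at (X : UnparObj J G 𝒳) {R S : C} (f : R ⟶ X.base)
    (z : (X.pull f).torsor.psh.obj (op S)) :
    Probe.Hom.at (UnparObj.Hom.hom (X.pullHom f)) z z.1.1 rfl = 𝟙 (X.map.obj (elt z.1.1)) :=
  Probe.Hom.at_rfl _ _

lemma comp_eq_id_of_isIso {D : Type*} [Category* D] {a b : D} {f : a ⟶ b} {g : b ⟶ a} (hg : IsIso g)
    (h : f ≫ g = 𝟙 _) : g ≫ f = 𝟙 _ := by
  rw [← cancel_mono g, Category.assoc, h, Category.comp_id, Category.id_comp]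

/-- Arrows of torsors over a stack are determined locally. -/
lemma unparStack_hom_ext (h𝒳 : IsStack J 𝒳) {a b : UnparObj J G 𝒳} (W : Sieve a.base)
    (hW : W ∈ J a.base) (m m' : a ⟶ b) (hb : UnparObj.Hom.base m = UnparObj.Hom.base m')
    (hm : ∀ {c : UnparObj J G 𝒳} (φ : c ⟶ a), W (UnparObj.Hom.base φ) → φ ≫ m = φ ≫ m') :
    m = m' := by
  have hx {S : C} (x : a.torsor.psh.obj (op S)) (hx : W (a.torsor.pr x)) :=
    congrArg (fun φ : a.pull (a.torsor.pr x) ⟶ b => UnparObj.Hom.hom φ)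
      (hm (a.pullHom (a.torsor.pr x)) hx)
  refine UnparObj.Hom.ext hb (Probe.ext_of_inclusion h𝒳 b.torsor.isSheaf
    (D := a.torsor.over W) (a.torsor.over_covering hW) ?_)
  refine Probe.hom_ext_of_at (fun {T} x => ?_) fun {T} x y e e' => ?_
  · exact congrArg (fun α : (a.pull (a.torsor.pr x.1)).probe ⟶ b.probe =>
      α.u.app _ (a.pullElt x.1)) (hx x.1 x.2)
  · have h1 (n : a ⟶ b) (en : (UnparObj.Hom.hom n).u.app _ x.1 = y) :
        Probe.Hom.at (a.probe.inclusion (a.torsor.over W) ≫ UnparObj.Hom.hom n) x y en =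
          Probe.Hom.at (UnparObj.Hom.hom (a.pullHom (a.torsor.pr x.1) ≫ n)) (a.pullElt x.1) y en :=
      (Probe.inclusion_comp_at rfl x.1 x.2 y en en).symm.trans
        ((Probe.Hom.at_comp (UnparObj.Hom.hom (a.pullHom (a.torsor.pr x.1))) (UnparObj.Hom.hom n)
          (a.pullElt x.1) x.1 y rfl en en).trans
            ((congrArg (· ≫ _) (a.pullHom_at _ (a.pullElt x.1))).trans (Category.id_comp _))).symm
    exact (h1 m e).trans ((Probe.Hom.at_congr (hx x.1 x.2) (a.pullElt x.1) y e e').trans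
      (h1 m' e').symm)

/-- A compatible family of arrows out of the objects over `a` is determined by its values at the
pullbacks of `a` along the projections of sections. -/
lemma UnparObj.apply_eq_of_compatible (h : IsFiberedInGroupoids 𝒳) {a b : UnparObj J G 𝒳}
    {W : Sieve a.base} {m : ∀ {c : UnparObj J G 𝒳} (φ : c ⟶ a), W (UnparObj.Hom.base φ) → (c ⟶ b)}
    (nat : ∀ {c c' : UnparObj J G 𝒳} (ψ : c' ⟶ c) (φ : c ⟶ a) (h : W (UnparObj.Hom.base φ))
      (h' : W (UnparObj.Hom.base (ψ ≫ φ))), m (ψ ≫ φ) h' = ψ ≫ m φ h)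
    {c : UnparObj J G 𝒳} (φ : c ⟶ a) (hφ : W (UnparObj.Hom.base φ)) {S : C}
    (z : c.torsor.psh.obj (op S)) (x : a.torsor.psh.obj (op S))
    (e : (UnparObj.Hom.hom φ).u.app _ z = x) (hx : W (a.torsor.pr x)) :
    (UnparObj.Hom.hom (m (a.pullHom (a.torsor.pr x)) hx)).u.app _ (a.pullElt x) =
        (UnparObj.Hom.hom (m φ hφ)).u.app _ z ∧
      ∀ (y : b.torsor.psh.obj (op S)) ey ey',
        Probe.Hom.at (UnparObj.Hom.hom φ) z x e ≫
          Probe.Hom.at (UnparObj.Hom.hom (m (a.pullHom (a.torsor.pr x)) hx)) (a.pullElt x) y ey =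
        Probe.Hom.at (UnparObj.Hom.hom (m φ hφ)) z y ey' := by
  have hpr : c.torsor.pr z ≫ UnparObj.Hom.base φ = a.torsor.pr x := by
    rw [← e, (UnparObj.Hom.isTorsorMap φ).pr_apply]
  obtain ⟨ψ, ⟨hψ, hψφ⟩, -⟩ := UnparObj.existsUnique_lift h φ (a.pullHom (a.torsor.pr x))
    (c.torsor.pr z) hpr
  have hz : (UnparObj.Hom.hom ψ).u.app _ (a.pullElt x) = z := by
    refine (UnparObj.Hom.isTorsorMap φ).eq_of_apply_eq ?_ ?_
    · rw [(UnparObj.Hom.isTorsorMap ψ).pr_apply, hψ]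
      exact Category.id_comp _
    · exact (congrArg (fun n : a.pull (a.torsor.pr x) ⟶ a =>
        (UnparObj.Hom.hom n).u.app _ (a.pullElt x)) hψφ).trans e.symm
  have hm : m (a.pullHom (a.torsor.pr x)) hx = ψ ≫ m φ hφ := by
    have key : ∀ (χ : a.pull (a.torsor.pr x) ⟶ a) (hχ : W (UnparObj.Hom.base χ)), ψ ≫ φ = χ →
        m χ hχ = ψ ≫ m φ hφ := by
      rintro _ hχ rfl
      exact nat ψ φ hφ hχ
    exact key _ hx hψφ
  rw [hm]
  refine ⟨congrArg ((UnparObj.Hom.hom (m φ hφ)).u.app _ ·) hz, fun y ey ey' => ?_⟩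
  have h1 := Probe.Hom.at_comp (UnparObj.Hom.hom ψ) (UnparObj.Hom.hom (m φ hφ)) (a.pullElt x) z y
    hz ey' ey
  have h2 := Probe.Hom.at_comp (UnparObj.Hom.hom ψ) (UnparObj.Hom.hom φ) (a.pullElt x) z x hz e
    (congrArg (fun n : a.pull (a.torsor.pr x) ⟶ a =>
        (UnparObj.Hom.hom n).u.app _ (a.pullElt x)) hψφ)
  have h3 : Probe.Hom.at (UnparObj.Hom.hom ψ) (a.pullElt x) z hz ≫
      Probe.Hom.at (UnparObj.Hom.hom φ) z x e = 𝟙 _ :=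
    h2.symm.trans ((Probe.Hom.at_congr (congrArg (fun n : a.pull (a.torsor.pr x) ⟶ a =>
      UnparObj.Hom.hom n) hψφ) _ _ _ rfl).trans (a.pullHom_at _ (a.pullElt x)))
  have hl := Probe.Hom.at_isHomLift (UnparObj.Hom.hom φ) z x e
  have hi : IsIso (Probe.Hom.at (UnparObj.Hom.hom φ) z x e) :=
    isIso_of_isFiberedInGroupoids h (S := S) _
  exact (congrArg (_ ≫ ·) h1).trans ((Category.assoc _ _ _).symm.trans
    ((congrArg (· ≫ _) (comp_eq_id_of_isIso hi h3)).trans (Category.id_comp _)))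

/-- Arrows of torsors over a stack can be glued. The value and the component at a section `x` over
the sieve are those of the arrow given on the pullback along the projection of `x`, at the canonical
section of that pullback; this defines the arrow on a covering subpresheaf. -/
lemma unparStack_exists_hom (h𝒳 : IsStack J 𝒳) {a b : UnparObj J G 𝒳} (f : a.base ⟶ b.base)
    (W : Sieve a.base) (hW : W ∈ J a.base)
    (m : ∀ {c : UnparObj J G 𝒳} (φ : c ⟶ a), W (UnparObj.Hom.base φ) → (c ⟶ b))
    (hm : ∀ {c : UnparObj J G 𝒳} (φ : c ⟶ a) (h : W (UnparObj.Hom.base φ)),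
      UnparObj.Hom.base (m φ h) = UnparObj.Hom.base φ ≫ f)
    (nat : ∀ {c c' : UnparObj J G 𝒳} (ψ : c' ⟶ c) (φ : c ⟶ a) (h : W (UnparObj.Hom.base φ))
      (h' : W (UnparObj.Hom.base (ψ ≫ φ))), m (ψ ≫ φ) h' = ψ ≫ m φ h) :
    ∃ m' : a ⟶ b, UnparObj.Hom.base m' = f ∧
      ∀ {c : UnparObj J G 𝒳} (φ : c ⟶ a) (h : W (UnparObj.Hom.base φ)), φ ≫ m' = m φ h := by
  have h := h𝒳.fibered
  let n {S : C} (x : a.torsor.psh.obj (op S)) (hx : W (a.torsor.pr x)) :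
      (a.pull (a.torsor.pr x)).probe ⟶ b.probe :=
    UnparObj.Hom.hom (m (a.pullHom (a.torsor.pr x)) hx)
  let v {S : C} (x : a.torsor.psh.obj (op S)) (hx : W (a.torsor.pr x)) :
      b.torsor.psh.obj (op S) := (n x hx).u.app _ (a.pullElt x)
  have key {c : UnparObj J G 𝒳} (φ : c ⟶ a) (hφ : W (UnparObj.Hom.base φ)) {S : C}
      (z : c.torsor.psh.obj (op S)) (x : a.torsor.psh.obj (op S))
      (e : (UnparObj.Hom.hom φ).u.app _ z = x) (hx : W (a.torsor.pr x)) :=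
    UnparObj.apply_eq_of_compatible h nat φ hφ z x e hx
  have hvm {S S' : C} (x : a.torsor.psh.obj (op S)) (hx : W (a.torsor.pr x)) (g : S' ⟶ S)
      (x' : a.torsor.psh.obj (op S')) (hx' : W (a.torsor.pr x'))
      (e : a.torsor.psh.map g.op x = x') : b.torsor.psh.map g.op (v x hx) = v x' hx' :=
    (psh_nat (n x hx).u g (a.pullElt x)).symm.trans (key (a.pullHom (a.torsor.pr x)) hx
      ((a.pull (a.torsor.pr x)).torsor.psh.map g.op (a.pullElt x)) x' e hx').1.symm
  have hvs {S : C} (x : a.torsor.psh.obj (op S)) (hx : W (a.torsor.pr x)) (g : G.obj (op S))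
      (hx' : W (a.torsor.pr (a.torsor.smul g x))) :
      v (a.torsor.smul g x) hx' = b.torsor.smul g (v x hx) :=
    (key (a.pullHom (a.torsor.pr x)) hx
      ((a.pull (a.torsor.pr x)).torsor.smul g (a.pullElt x)) _ rfl hx').1.trans
      ((UnparObj.Hom.isTorsorMap (m (a.pullHom (a.torsor.pr x)) hx)).smul_apply g (a.pullElt x))
  have hvp {S : C} (x : a.torsor.psh.obj (op S)) (hx : W (a.torsor.pr x)) :
      b.torsor.pr (v x hx) = a.torsor.pr x ≫ f := by
    refine ((UnparObj.Hom.isTorsorMap (m (a.pullHom (a.torsor.pr x)) hx)).pr_apply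
      (a.pullElt x)).trans ?_
    exact (congrArg (_ ≫ ·) (hm _ hx)).trans (Category.id_comp _)
  let u : (a.torsor.over W).toFunctor ⟶ b.torsor.psh :=
    { app := fun S => ↾fun x => v (S := S.unop) x.1 x.2
      naturality := fun S S' s => by
        refine ConcreteCategory.hom_ext (C := Type v) _ _ fun x => ?_
        exact (hvm (S := S.unop) (S' := S'.unop) x.1 x.2 s.unop _ _ rfl).symm }
  let α' : a.probe.restr (a.torsor.over W) ⟶ b.probe :=
    Probe.homOfAt (A := a.probe.restr (a.torsor.over W)) (B := b.probe) u
      (fun x => Probe.Hom.at (n x.1 x.2) (a.pullElt x.1) _ rfl)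
      (fun x => Probe.Hom.at_isHomLift _ _ _ _)
      (fun {T T' x x'} g e e' => by
        obtain ⟨x', hx'⟩ := x'
        obtain rfl : a.torsor.psh.map g.op x.1 = x' := congrArg Subtype.val e
        let z : (a.pull (a.torsor.pr x.1)).torsor.psh.obj (op T') :=
          (a.pull (a.torsor.pr x.1)).torsor.psh.map g.op (a.pullElt x.1)
        have hz := key (a.pullHom (a.torsor.pr x.1)) x.2 z _ rfl hx'
        have e₂ : (n x.1 x.2).u.app _ z = v _ hx' := hz.1.symm
        have h1 := hz.2 _ rfl e₂
        have h2 := Probe.Hom.at_nat (n x.1 x.2) (x := a.pullElt x.1) rfl e₂ g rfl e'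
        refine h2.trans (congrArg (· ≫ b.map.map (eltHom g e')) (h1.symm.trans ?_))
        exact (congrArg (· ≫ _) (a.pullHom_at _ z)).trans (Category.id_comp _))
  obtain ⟨α, hα⟩ := Probe.exists_extension h𝒳 b.torsor.isSheaf (a.torsor.over_covering hW) α'
  have hαv {S : C} (x : a.torsor.psh.obj (op S)) (hx : W (a.torsor.pr x)) :
      α.u.app _ x = v x hx :=
    congrArg (fun β : a.probe.restr (a.torsor.over W) ⟶ b.probe =>
      β.u.app _ (⟨x, hx⟩ : (a.torsor.over W).toFunctor.obj (op S))) hα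
  have ht : IsTorsorMap a.torsor b.torsor f α.u := by
    refine ⟨fun {S} x => sheaf_ext (isSheaf_yoneda J b.base) (a.torsor.over_covering hW x)
      fun g hg => ?_, fun {S} k x => sheaf_ext b.torsor.isSheaf (a.torsor.over_covering hW x)
      fun g hg => ?_⟩
    · exact (b.torsor.pr_map g _).symm.trans ((congrArg b.torsor.pr (psh_nat α.u g x).symm).trans
        ((congrArg b.torsor.pr (hαv _ hg)).trans ((hvp _ hg).trans
          ((congrArg (· ≫ f) (a.torsor.pr_map g x)).trans (Category.assoc _ _ _)))))
    · have hg' : W (a.torsor.pr (a.torsor.smul (G.map g.op k) (a.torsor.psh.map g.op x))) := by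
        rw [Torsor.pr_smul]; exact hg
      refine (psh_nat α.u g _).symm.trans ((congrArg (α.u.app _ ·)
        (a.torsor.map_smul g.op k x)).trans ((hαv _ hg').trans ((hvs _ hg _ hg').trans ?_)))
      refine Eq.trans ?_ (b.torsor.map_smul g.op k _).symm
      exact congrArg (b.torsor.smul _ ·) ((hαv _ hg).symm.trans (psh_nat α.u g x))
  refine ⟨UnparObj.homMk f α ht, rfl, fun {c} φ hφ => UnparObj.Hom.ext (hm φ hφ).symm ?_⟩
  have hW' {S : C} (z : c.torsor.psh.obj (op S)) :
      W (a.torsor.pr ((UnparObj.Hom.hom φ).u.app _ z)) := by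
    rw [(UnparObj.Hom.isTorsorMap φ).pr_apply]
    exact W.downward_closed hφ _
  have hu {S : C} (z : c.torsor.psh.obj (op S)) :
      α.u.app _ ((UnparObj.Hom.hom φ).u.app _ z) = (UnparObj.Hom.hom (m φ hφ)).u.app _ z :=
    (hαv _ (hW' z)).trans (key φ hφ z _ rfl (hW' z)).1
  refine Probe.hom_ext_of_at (fun z => hu z) fun {S} z y e e' => ?_
  let x := (UnparObj.Hom.hom φ).u.app (op S) z
  have ex : α.u.app _ x = y := e
  have ev : v x (hW' z) = y := (hαv x (hW' z)).symm.trans ex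
  refine (Probe.Hom.at_comp (UnparObj.Hom.hom φ) α z x y rfl ex e).trans
    (Eq.trans ?_ ((key φ hφ z x rfl (hW' z)).2 y ev e'))
  refine congrArg (_ ≫ ·) ((Probe.inclusion_comp_at hα x (hW' z) y ex ev).trans ?_)
  subst ev
  exact Probe.homOfAt_at (A := a.probe.restr (a.torsor.over W)) (B := b.probe) u
    (fun x => Probe.Hom.at (n x.1 x.2) (a.pullElt x.1) _ rfl) _ _
    (⟨x, hW' z⟩ : (a.torsor.over W).toFunctor.obj (op S))

end Unpar

/-! ### Families of sections of a descent datum of torsors -/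

section TorsorDescent

variable {J : GrothendieckTopology C} {G : Cᵒᵖ ⥤ GrpCat.{v}}

/-- A descent datum of `G`-torsors along a sieve `R`: a torsor over the source of each arrow of `R`,
and functorial equivariant maps between them. -/
structure TorsorDatum (J : GrothendieckTopology C) (G : Cᵒᵖ ⥤ GrpCat.{v}) {S : C}
    (R : Sieve S) where
  torsor {T : C} (k : T ⟶ S) (hk : R k) : Torsor J G T
  tr {T T' : C} {k : T ⟶ S} {hk : R k} {k' : T' ⟶ S} {hk' : R k'} (g : T' ⟶ T)
    (e : g ≫ k = k') : (torsor k' hk').psh ⟶ (torsor k hk).psh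
  isTorsorMap {T T' : C} {k : T ⟶ S} {hk : R k} {k' : T' ⟶ S} {hk' : R k'} (g : T' ⟶ T)
    (e : g ≫ k = k') : IsTorsorMap (torsor k' hk') (torsor k hk) g (tr g e)
  tr_tr {T T' T'' : C} {k : T ⟶ S} {hk : R k} {k' : T' ⟶ S} {hk' : R k'} {k'' : T'' ⟶ S}
    {hk'' : R k''} (g : T' ⟶ T) (e : g ≫ k = k') (g' : T'' ⟶ T') (e' : g' ≫ k' = k'')
    (g'' : T'' ⟶ T) (hg : g' ≫ g = g'') (e'' : g'' ≫ k = k'') {U : C}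
    (x : (torsor k'' hk'').psh.obj (op U)) :
    (tr (hk := hk) g e).app _ ((tr (hk := hk') g' e').app _ x) = (tr g'' e'').app _ x

variable {S : C} {R : Sieve S}

/-- A section over `T` of the torsor glued from a descent datum: a point `pt` of the base, and a
compatible family of sections of the given torsors, one for each way to factor the restriction of
`pt` along an arrow `s` through an arrow of the sieve. -/
structure TorsorDatum.Fam (D : TorsorDatum J G R) (T : C) where
  pt : T ⟶ S
  sec {T' T'' : C} (s : T' ⟶ T) (k : T'' ⟶ S) (hk : R k) (r : T' ⟶ T'') (e : s ≫ pt = r ≫ k) :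
    (D.torsor k hk).psh.obj (op T')
  pr_sec {T' T'' : C} (s : T' ⟶ T) (k : T'' ⟶ S) (hk : R k) (r : T' ⟶ T'') (e : s ≫ pt = r ≫ k) :
    (D.torsor k hk).pr (sec s k hk r e) = r
  map_sec {T' T'' U : C} (s : T' ⟶ T) (k : T'' ⟶ S) (hk : R k) (r : T' ⟶ T'')
    (e : s ≫ pt = r ≫ k) (g : U ⟶ T') (s' : U ⟶ T) (hs : g ≫ s = s') (r' : U ⟶ T'')
    (hr : g ≫ r = r') (e' : s' ≫ pt = r' ≫ k) :
    (D.torsor k hk).psh.map g.op (sec s k hk r e) = sec s' k hk r' e'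
  tr_sec {T' T₁ T₂ : C} (s : T' ⟶ T) (k : T₁ ⟶ S) (hk : R k) (k' : T₂ ⟶ S) (hk' : R k')
    (r : T' ⟶ T₂) (e : s ≫ pt = r ≫ k') (g : T₂ ⟶ T₁) (hg : g ≫ k = k') (r' : T' ⟶ T₁)
    (hr : r ≫ g = r') (e' : s ≫ pt = r' ≫ k) :
    (D.tr g hg).app _ (sec s k' hk' r e) = sec s k hk r' e'

namespace TorsorDatum

variable {D : TorsorDatum J G R}

/-- Families agree if their points and all their values do. -/
lemma Fam.ext_sec {T : C} {a b : D.Fam T} (hpt : a.pt = b.pt)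
    (h : ∀ {T' T'' : C} (s : T' ⟶ T) (k : T'' ⟶ S) (hk : R k) (r : T' ⟶ T'') e e',
      a.sec s k hk r e = b.sec s k hk r e') : a = b := by
  obtain ⟨t, x, _, _, _⟩ := a
  obtain ⟨t', x', _, _, _⟩ := b
  obtain rfl : t = t' := hpt
  obtain rfl : @x = @x' := by
    funext T' T'' s k hk r e
    exact h s k hk r e e
  rfl

lemma Fam.sec_congr {T : C} (a : D.Fam T) {T' T'' : C} {s s' : T' ⟶ T} (hs : s = s') (k : T'' ⟶ S)
    (hk : R k) {r r' : T' ⟶ T''} (hr : r = r') (e) (e') :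
    a.sec s k hk r e = a.sec s' k hk r' e' := by
  subst hs hr; rfl

lemma Fam.sec_congr_fam {T : C} {a b : D.Fam T} (h : a = b) {T' T'' : C} (s : T' ⟶ T) (k : T'' ⟶ S)
    (hk : R k) (r : T' ⟶ T'') (e) (e') : a.sec s k hk r e = b.sec s k hk r e' := by
  subst h; rfl

/-- The restriction of a section of the glued torsor. -/
def Fam.restr {T T' : C} (g : T' ⟶ T) (a : D.Fam T) : D.Fam T' where
  pt := g ≫ a.pt
  sec s k hk r e := a.sec (s ≫ g) k hk r ((Category.assoc _ _ _).trans e)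
  pr_sec _ _ _ _ _ := a.pr_sec _ _ _ _ _
  map_sec _ _ _ _ _ l _ hs _ hr _ :=
    a.map_sec _ _ _ _ _ l _ ((Category.assoc _ _ _).symm.trans (congrArg (· ≫ g) hs)) _ hr _
  tr_sec _ _ _ _ _ _ _ l hl _ hr _ := a.tr_sec _ _ _ _ _ _ _ l hl _ hr _

lemma Fam.restr_id {T : C} (a : D.Fam T) : a.restr (𝟙 T) = a :=
  Fam.ext_sec (Category.id_comp _) fun _ _ _ _ _ _ =>
    a.sec_congr (Category.comp_id _) _ _ rfl _ _

lemma Fam.restr_restr {T T' T'' : C} (g : T' ⟶ T) (g' : T'' ⟶ T') (a : D.Fam T) :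
    (a.restr g).restr g' = a.restr (g' ≫ g) :=
  Fam.ext_sec (Category.assoc _ _ _).symm fun _ _ _ _ _ _ =>
    a.sec_congr (Category.assoc _ _ _) _ _ rfl _ _

/-- The action of `G` on the sections of the glued torsor. -/
def Fam.smul {T : C} (h : G.obj (op T)) (a : D.Fam T) : D.Fam T where
  pt := a.pt
  sec s k hk r e := (D.torsor k hk).smul (G.map s.op h) (a.sec s k hk r e)
  pr_sec s k hk r e := ((D.torsor k hk).pr_smul _ _).trans (a.pr_sec _ _ _ _ _)
  map_sec s k hk r e l s' hs r' hr e' := by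
    subst hs
    refine ((D.torsor k hk).map_smul l.op _ _).trans ?_
    rw [a.map_sec s k hk r e l _ rfl r' hr e']
    simp
  tr_sec s k hk k' hk' r e l hl r' hr e' := by
    rw [(D.isTorsorMap l hl).smul_apply, a.tr_sec s k hk k' hk' r e l hl r' hr e']

lemma Fam.one_smul {T : C} (a : D.Fam T) : Fam.smul 1 a = a :=
  Fam.ext_sec rfl fun s k hk _ _ _ =>
    (congrArg ((D.torsor k hk).smul · _) (map_one (G.map s.op).hom)).trans
      ((D.torsor k hk).one_smul _)

lemma Fam.mul_smul {T : C} (g h : G.obj (op T)) (a : D.Fam T) :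
    Fam.smul (g * h) a = Fam.smul g (Fam.smul h a) :=
  Fam.ext_sec rfl fun s k hk _ _ _ =>
    (congrArg ((D.torsor k hk).smul · _) (map_mul (G.map s.op).hom g h)).trans
      ((D.torsor k hk).mul_smul _ _ _)

lemma Fam.restr_smul {T T' : C} (g : T' ⟶ T) (h : G.obj (op T)) (a : D.Fam T) :
    (Fam.smul h a).restr g = Fam.smul (G.map g.op h) (a.restr g) :=
  Fam.ext_sec rfl fun s k hk r e e' => by
    change (D.torsor k hk).smul (G.map (s ≫ g).op h) _ =
      (D.torsor k hk).smul (G.map s.op (G.map g.op h)) _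
    simp
    rfl

/-- A section of the glued torsor over a point which factors through the sieve is determined by any
of its values. -/
lemma Fam.ext_of_sec {T T' : C} {a b : D.Fam T} (hpt : a.pt = b.pt) (k : T' ⟶ S) (hk : R k)
    (r : T ⟶ T') (e e') (h : a.sec (𝟙 T) k hk r e = b.sec (𝟙 T) k hk r e') : a = b := by
  have ha : a.pt = r ≫ k := (Category.id_comp _).symm.trans e
  have hb : b.pt = r ≫ k := (Category.id_comp _).symm.trans e'
  refine Fam.ext_sec hpt fun {U U'} s k₂ hk₂ r₂ e₁ e₂ => ?_
  -- the values at `(s, k₂)` are compared with those at `(s, k)` over the common refinement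
  have hk₀ : R (s ≫ r ≫ k) := R.downward_closed (R.downward_closed hk _) _
  have h₁ : s ≫ a.pt = 𝟙 _ ≫ s ≫ r ≫ k := by rw [ha, Category.id_comp]
  have h₂ : s ≫ b.pt = 𝟙 _ ≫ s ≫ r ≫ k := by rw [hb, Category.id_comp]
  have h₃ : r₂ ≫ k₂ = s ≫ r ≫ k := by rw [← e₁, ha]
  rw [← a.tr_sec s k₂ hk₂ (s ≫ r ≫ k) hk₀ (𝟙 _) h₁ r₂ h₃ r₂ (Category.id_comp _) e₁,
    ← b.tr_sec s k₂ hk₂ (s ≫ r ≫ k) hk₀ (𝟙 _) h₂ r₂ h₃ r₂ (Category.id_comp _) e₂]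
  congr 1
  refine (D.isTorsorMap (hk := hk) (s ≫ r) (Category.assoc _ _ _)).eq_of_apply_eq
    ((a.pr_sec _ _ _ _ _).trans (b.pr_sec _ _ _ _ _).symm) ?_
  have h₄ : s ≫ a.pt = (s ≫ r) ≫ k := by rw [ha, Category.assoc]
  have h₅ : s ≫ b.pt = (s ≫ r) ≫ k := by rw [hb, Category.assoc]
  rw [a.tr_sec s k hk _ hk₀ (𝟙 _) h₁ (s ≫ r) (Category.assoc _ _ _) (s ≫ r)
      (Category.id_comp _) h₄, b.tr_sec s k hk _ hk₀ (𝟙 _) h₂ (s ≫ r) (Category.assoc _ _ _) (s ≫ r)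
      (Category.id_comp _) h₅,
    ← a.map_sec (𝟙 T) k hk r e s s (Category.comp_id _) (s ≫ r) rfl h₄,
    ← b.map_sec (𝟙 T) k hk r e' s s (Category.comp_id _) (s ≫ r) rfl h₅, h]

/-- Sections of the glued torsor which agree locally are equal. -/
lemma Fam.ext_of_restr [J.Subcanonical] {T : C} {W : Sieve T} (hW : W ∈ J T) {a b : D.Fam T}
    (h : ∀ {T' : C} (g : T' ⟶ T), W g → a.restr g = b.restr g) : a = b := by
  refine Fam.ext_sec (sheaf_ext (isSheaf_yoneda J S) hW fun g hg => congrArg Fam.pt (h g hg)) ?_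
  intro T' T'' s k hk r e e'
  refine sheaf_ext (D.torsor k hk).isSheaf (J.pullback_stable s hW) fun {U} g hg => ?_
  have ha : (g ≫ s) ≫ a.pt = (g ≫ r) ≫ k := by rw [Category.assoc, e, Category.assoc]
  have hb : (g ≫ s) ≫ b.pt = (g ≫ r) ≫ k := by rw [Category.assoc, e', Category.assoc]
  have ha' : 𝟙 _ ≫ (a.restr (g ≫ s)).pt = (g ≫ r) ≫ k := (Category.id_comp _).trans ha
  have hb' : 𝟙 _ ≫ (b.restr (g ≫ s)).pt = (g ≫ r) ≫ k := (Category.id_comp _).trans hb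
  have h1 := Fam.sec_congr_fam (h (g ≫ s) hg) (𝟙 U) k hk (g ≫ r) ha' hb'
  rw [a.map_sec s k hk r e g _ rfl _ rfl ha, b.map_sec s k hk r e' g _ rfl _ rfl hb]
  exact (a.sec_congr (Category.id_comp _).symm k hk rfl _ _).trans
    (h1.trans (b.sec_congr (Category.id_comp _) k hk rfl _ _))

/-- Sections of the glued torsor can be glued. -/
lemma Fam.exists_glue [J.Subcanonical] {T : C} {W : Sieve T} (hW : W ∈ J T)
    (a : ∀ {T' : C} (g : T' ⟶ T), W g → D.Fam T')
    (ha : ∀ {T' T'' : C} (g : T' ⟶ T) (hg : W g) (k : T'' ⟶ T') (hk : W (k ≫ g)),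
      (a g hg).restr k = a (k ≫ g) hk) :
    ∃ b : D.Fam T, ∀ {T' : C} (g : T' ⟶ T) (hg : W g), b.restr g = a g hg := by
  obtain ⟨t, ht⟩ := sheaf_exists (isSheaf_yoneda J S) hW (fun g hg => (a g hg).pt)
    (fun g hg k hk => congrArg Fam.pt (ha g hg k hk))
  have ht' {T' : C} (g : T' ⟶ T) (hg : W g) : (a g hg).pt = g ≫ t := (ht g hg).symm
  have hae {T' T'' U : C} {s : T' ⟶ T} {k : T'' ⟶ S} {r : T' ⟶ T''} (e : s ≫ t = r ≫ k)
      (g : U ⟶ T') (s' : U ⟶ T) (hs' : W s') (es : g ≫ s = s') (r' : U ⟶ T'') (er : g ≫ r = r') :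
      𝟙 U ≫ (a s' hs').pt = r' ≫ k := by
    rw [Category.id_comp, ht', ← es, ← er, Category.assoc, e, Category.assoc]
  have hm {T' T'' U : C} (s : T' ⟶ T) (hs : W s) (k : T'' ⟶ S) (hk : R k) (r : T' ⟶ T'')
      (e : 𝟙 T' ≫ (a s hs).pt = r ≫ k) (g : U ⟶ T') (s' : U ⟶ T) (hs' : W s') (es : g ≫ s = s')
      (r' : U ⟶ T'') (er : g ≫ r = r') (e' : 𝟙 U ≫ (a s' hs').pt = r' ≫ k) :
      (D.torsor k hk).psh.map g.op ((a s hs).sec (𝟙 T') k hk r e) =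
        (a s' hs').sec (𝟙 U) k hk r' e' := by
    subst es
    have h1 : g ≫ (a s hs).pt = r' ≫ k := by rw [← er, Category.assoc, ← e, Category.id_comp]
    have h2 : 𝟙 U ≫ ((a s hs).restr g).pt = r' ≫ k := (Category.id_comp _).trans h1
    rw [(a s hs).map_sec (𝟙 T') k hk r e g g (Category.comp_id _) r' er h1]
    refine Eq.trans ?_ (Fam.sec_congr_fam (ha s hs g hs') (𝟙 U) k hk r' h2 e')
    exact (a s hs).sec_congr (Category.id_comp _).symm k hk rfl _ _
  have hex {T' T'' : C} (s : T' ⟶ T) (k : T'' ⟶ S) (hk : R k) (r : T' ⟶ T'') (e : s ≫ t = r ≫ k) :=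
    sheaf_exists (D.torsor k hk).isSheaf (J.pullback_stable s hW)
      (fun {U} g hg => (a (g ≫ s) hg).sec (𝟙 U) k hk (g ≫ r) (hae e g _ hg rfl _ rfl))
      (fun g hg l hl => hm _ _ _ _ _ _ l _ hl (Category.assoc _ _ _).symm _
        (Category.assoc _ _ _).symm _)
  choose x hx using @hex
  have hx' {T' T'' U : C} (s : T' ⟶ T) (k : T'' ⟶ S) (hk : R k) (r : T' ⟶ T'')
      (e : s ≫ t = r ≫ k) (g : U ⟶ T') (s' : U ⟶ T) (hs' : W s') (es : g ≫ s = s') (r' : U ⟶ T'')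
      (er : g ≫ r = r') : (D.torsor k hk).psh.map g.op (x s k hk r e) =
        (a s' hs').sec (𝟙 U) k hk r' (hae e g s' hs' es r' er) := by
    subst es er
    exact hx s k hk r e g hs'
  let b : D.Fam T :=
    { pt := t
      sec := fun s k hk r e => x s k hk r e
      pr_sec := fun {T' T''} s k hk r e => by
        refine sheaf_ext (isSheaf_yoneda J T'') (J.pullback_stable s hW) fun g hg => ?_
        exact ((D.torsor k hk).pr_map g _).symm.trans
          ((congrArg (D.torsor k hk).pr (hx' s k hk r e g _ hg rfl _ rfl)).trans
            ((a _ _).pr_sec _ _ _ _ _))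
      map_sec := fun s k hk r e g s' hs r' hr e' => by
        refine sheaf_ext (D.torsor k hk).isSheaf (J.pullback_stable s' hW) fun l hl => ?_
        rw [psh_map_map, hx' s k hk r e (l ≫ g) _ hl (by rw [Category.assoc, hs]) (l ≫ r')
          (by rw [Category.assoc, hr]), hx' s' k hk r' e' l _ hl rfl _ rfl]
      tr_sec := fun s k hk k' hk' r e l hl r' hr e' => by
        refine sheaf_ext (D.torsor k hk).isSheaf (J.pullback_stable s hW) fun g hg => ?_
        rw [← psh_nat, hx' s k' hk' r e g _ hg rfl _ rfl, hx' s k hk r' e' g _ hg rfl _ rfl]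
        exact (a _ _).tr_sec _ _ _ _ _ _ _ l hl _ (by rw [Category.assoc, hr]) _ }
  refine ⟨b, fun {T'} g hg => Fam.ext_sec (ht g hg) fun {U U'} s k hk r e e' => ?_⟩
  have h1 : W (s ≫ g) := W.downward_closed hg s
  have h2 := hx' (s ≫ g) k hk r ((Category.assoc _ _ _).trans e) (𝟙 U) (s ≫ g) h1
    (Category.id_comp _) r (Category.id_comp _)
  have h3 : 𝟙 U ≫ ((a g hg).restr s).pt = r ≫ k := (Category.id_comp _).trans e'
  refine (psh_map_id _ _).symm.trans (h2.trans
    ((Fam.sec_congr_fam (ha g hg s h1) (𝟙 U) k hk r h3 _).symm.trans ?_))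
  exact (a g hg).sec_congr (Category.id_comp _) k hk rfl _ _

/-- The group acts simply transitively on the sections of the glued torsor over a point. -/
lemma Fam.existsUnique_smul [J.Subcanonical] (hG : Presieve.IsSheaf J (groupSet G)) (hR : R ∈ J S)
    {T : C} (a b : D.Fam T) (hpt : a.pt = b.pt) : ∃! h : G.obj (op T), Fam.smul h a = b := by
  have hW := J.pullback_stable a.pt hR
  have key {T' : C} (g : T' ⟶ T) (hg : R (g ≫ a.pt)) :
      ∃! h : G.obj (op T'), Fam.smul h (a.restr g) = b.restr g := by
    have e : 𝟙 T' ≫ (a.restr g).pt = 𝟙 T' ≫ g ≫ a.pt := rfl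
    have e' : 𝟙 T' ≫ (b.restr g).pt = 𝟙 T' ≫ g ≫ a.pt := by rw [hpt]; rfl
    obtain ⟨h, hh, hu⟩ := (D.torsor (g ≫ a.pt) hg).existsUnique_smul
      (x := (a.restr g).sec (𝟙 T') _ hg (𝟙 T') e) (y := (b.restr g).sec (𝟙 T') _ hg (𝟙 T') e')
      ((Fam.pr_sec _ _ _ _ _ _).trans (Fam.pr_sec _ _ _ _ _ _).symm)
    have h1 (k : G.obj (op T')) : (Fam.smul k (a.restr g)).sec (𝟙 T') _ hg (𝟙 T') e =
        (D.torsor (g ≫ a.pt) hg).smul k ((a.restr g).sec (𝟙 T') _ hg (𝟙 T') e) :=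
      congrArg ((D.torsor _ hg).smul · _) (Functor.map_id_apply (groupSet G) _ k)
    refine ⟨h, Fam.ext_of_sec (congrArg (g ≫ ·) hpt) (g ≫ a.pt) hg (𝟙 _) e e' ((h1 h).trans hh),
      fun k hk => hu k ((h1 k).symm.trans (Fam.sec_congr_fam hk _ _ _ _ _ _))⟩
  obtain ⟨h, hh⟩ := sheaf_exists_of_existsUnique hG hW
    (fun g (h : G.obj _) => Fam.smul h (a.restr g) = b.restr g)
    (fun {T' T''} g k (h : G.obj _) hh => by
      refine Eq.trans ?_ ((congrArg (Fam.restr k ·) hh).trans (b.restr_restr g k))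
      refine Eq.trans ?_ (Fam.restr_smul k h (a.restr g)).symm
      exact congrArg (Fam.smul (G.map k.op h) ·) (a.restr_restr g k).symm)
    (fun g hg => key g hg)
  refine ⟨h, Fam.ext_of_restr hW fun g hg => (Fam.restr_smul g _ a).trans (hh g hg), fun k hk => ?_⟩
  refine sheaf_ext hG hW fun g hg => (key g hg).unique ?_ (hh g hg)
  exact (Fam.restr_smul g k a).symm.trans (congrArg (Fam.restr g ·) hk)

/-- A section of one of the given torsors is a section of the glued torsor. -/
lemma Fam.exists_of_section [J.Subcanonical] {T T' : C} (k : T ⟶ S) (hk : R k)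
    (y : (D.torsor k hk).psh.obj (op T')) :
    ∃ a : D.Fam T', a.pt = (D.torsor k hk).pr y ≫ k ∧
      ∀ e, a.sec (𝟙 T') k hk ((D.torsor k hk).pr y) e = y := by
  let r := (D.torsor k hk).pr y
  have hk₀ {U : C} (s : U ⟶ T') : R (s ≫ r ≫ k) := R.downward_closed (R.downward_closed hk _) _
  have hex {U : C} (s : U ⟶ T') := (D.isTorsorMap (hk := hk) (hk' := hk₀ s) (s ≫ r)
    (Category.assoc _ _ _)).existsUnique ((D.torsor k hk).psh.map s.op y) (𝟙 U)
    (((D.torsor k hk).pr_map s y).trans (Category.id_comp _).symm)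
  choose z hz hz' using @hex
  simp only at hz hz'
  -- the sections `z s` over `s ≫ r ≫ k` are compatible with restriction
  have hzm {U V : C} (s : U ⟶ T') (g : V ⟶ U) (s' : V ⟶ T') (hs : g ≫ s = s') :
      (D.tr (hk := hk₀ s) (hk' := hk₀ s') g (by rw [← hs, Category.assoc])).app _ (z s') =
        (D.torsor _ (hk₀ s)).psh.map g.op (z s) := by
    refine (D.isTorsorMap (hk := hk) (s ≫ r) (Category.assoc _ _ _)).eq_of_apply_eq ?_ ?_
    · rw [(D.isTorsorMap _ _).pr_apply, (hz s').1, Torsor.pr_map, (hz s).1, Category.id_comp,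
        Category.comp_id]
    · rw [D.tr_tr (s ≫ r) _ g _ (s' ≫ r) (by rw [← hs, Category.assoc]) (Category.assoc _ _ _),
        (hz s').2, psh_nat, (hz s).2, psh_map_map, hs]
  let a : D.Fam T' :=
    { pt := r ≫ k
      sec := fun s k₂ hk₂ r₂ e => (D.tr (hk := hk₂) (hk' := hk₀ s) r₂ e.symm).app _ (z s)
      pr_sec := fun s k₂ hk₂ r₂ e => by
        rw [(D.isTorsorMap _ _).pr_apply, (hz s).1, Category.id_comp]
      map_sec := fun s k₂ hk₂ r₂ e g s' hs r' hr e' => by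
        rw [← psh_nat, ← hzm s g s' hs, D.tr_tr r₂ _ g _ r' hr]
      tr_sec := fun s k₁ hk₁ k₂ hk₂ r₂ e g hg r' hr e' => D.tr_tr _ _ _ _ _ hr _ _ }
  refine ⟨a, rfl, fun e => ?_⟩
  have h1 : (D.tr (hk := hk) (hk' := hk₀ (𝟙 T')) (𝟙 T' ≫ r) (Category.assoc _ _ _)).app _
      (z (𝟙 T')) = y := (hz (𝟙 T')).2.trans (psh_map_id _ _)
  refine Eq.trans ?_ h1
  have h2 : ∀ (r' : T' ⟶ T) (_ : r = r') e e',
      (D.tr (hk := hk) (hk' := hk₀ (𝟙 T')) r e).app _ (z (𝟙 T')) =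
        (D.tr (hk := hk) (hk' := hk₀ (𝟙 T')) r' e').app _ (z (𝟙 T')) := by
    rintro _ rfl _ _; rfl
  exact h2 _ (Category.id_comp _).symm _ _

/-- The families over `T` form a small type, although they are indexed by all objects of `C`: by
simple transitivity a family is given by its point and the element of `G` which moves a chosen
family over this point to it. -/
lemma small_fam [J.Subcanonical] (hG : Presieve.IsSheaf J (groupSet G)) (hR : R ∈ J S)
    (D : TorsorDatum J G R) (T : C) : Small.{v} (D.Fam T) := by
  let f : {t : T ⟶ S // ∃ a : D.Fam T, a.pt = t} × G.obj (op T) → D.Fam T :=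
    fun x => Fam.smul x.2 x.1.2.choose
  refine small_of_surjective (f := f) fun a => ?_
  have ht : ∃ b : D.Fam T, b.pt = a.pt := ⟨a, rfl⟩
  obtain ⟨h, hh, -⟩ := Fam.existsUnique_smul hG hR ht.choose a ht.choose_spec
  exact ⟨(⟨a.pt, ht⟩, h), hh⟩

end TorsorDatum

end TorsorDescent

/-! ### Effective descent for torsors -/

section Glued

variable {J : GrothendieckTopology C} {G : Cᵒᵖ ⥤ GrpCat.{v}} {S : C} {R : Sieve S}

namespace TorsorDatum

/-- The glued torsor. Its sections are the compatible families of sections of the given torsors, up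
to a bijection with a type in the universe of the given torsors. -/
lemma exists_torsor [J.Subcanonical] (hG : Presieve.IsSheaf J (groupSet G)) (hR : R ∈ J S)
    (D : TorsorDatum J G R) :
    ∃ (P : Torsor J G S) (e : ∀ {T : C}, P.psh.obj (op T) ≃ D.Fam T),
      (∀ {T T' : C} (g : T' ⟶ T) (x : P.psh.obj (op T)), e (P.psh.map g.op x) = (e x).restr g) ∧
      (∀ {T : C} (x : P.psh.obj (op T)), P.pr x = (e x).pt) ∧
      ∀ {T : C} (h : G.obj (op T)) (x : P.psh.obj (op T)), e (P.smul h x) = Fam.smul h (e x) := by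
  have (T : C) : Small.{v} (D.Fam T) := small_fam hG hR D T
  let e (T : C) : D.Fam T ≃ Shrink.{v} (D.Fam T) := equivShrink (D.Fam T)
  let A : Cᵒᵖ ⥤ Type v :=
    { obj := fun T => Shrink.{v} (D.Fam T.unop)
      map := fun {T T'} g => ↾fun a => e T'.unop (((e T.unop).symm a).restr g.unop)
      map_id := fun T => ConcreteCategory.hom_ext (C := Type v) _ _ fun a =>
        (congrArg (e T.unop) (Fam.restr_id _)).trans ((e T.unop).apply_symm_apply a)
      map_comp := fun {T T' T''} g g' => ConcreteCategory.hom_ext (C := Type v) _ _ fun a => by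
        change e T''.unop (((e T.unop).symm a).restr (g'.unop ≫ g.unop)) =
          e T''.unop (((e T'.unop).symm (e T'.unop (((e T.unop).symm a).restr g.unop))).restr
            g'.unop)
        rw [Equiv.symm_apply_apply, Fam.restr_restr] }
  have hA {T T' : C} (g : T' ⟶ T) (x : A.obj (op T)) :
      (e T').symm (A.map g.op x) = ((e T).symm x).restr g :=
    (e T').symm_apply_apply _
  refine ⟨⟨A, ?_, ⟨fun T => ↾fun x => ((e T.unop).symm x).pt, ?_⟩,
    fun {T} h x => e T.unop (Fam.smul h ((e T.unop).symm x)), ?_, ?_, ?_, ?_, ?_, ?_⟩,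
    fun {T} => (e T).symm, hA, fun x => rfl, fun h x => (e _).symm_apply_apply _⟩
  · intro T W hW x hx
    have hx' := (Presieve.compatible_iff_sieveCompatible _).1 hx
    obtain ⟨b, hb⟩ := Fam.exists_glue hW (fun {T'} g hg => (e T').symm (x g hg))
      (fun {T' T''} g hg k hk => (hA k _).symm.trans
        (congrArg (e T'').symm (hx' g k hg).symm))
    refine ⟨e T b, fun T' g hg => (e T').symm.injective ?_, fun y hy => (e T).symm.injective ?_⟩
    · refine (hA g _).trans (Eq.trans ?_ (hb g hg))
      rw [Equiv.symm_apply_apply]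
    · rw [Equiv.symm_apply_apply]
      refine Fam.ext_of_restr hW fun {T'} g hg => ?_
      exact (hA g y).symm.trans ((congrArg (e T').symm (hy g hg)).trans (hb g hg).symm)
  · intro T T' g
    refine ConcreteCategory.hom_ext (C := Type v) _ _ fun x => ?_
    exact congrArg Fam.pt (hA g.unop x)
  · intro T x
    rw [Fam.one_smul, Equiv.apply_symm_apply]
  · intro T g h x
    rw [Fam.mul_smul, Equiv.symm_apply_apply]
  · intro T T' s g x
    refine (e T'.unop).symm.injective ((hA s.unop _).trans ?_)
    rw [Equiv.symm_apply_apply, Equiv.symm_apply_apply, Fam.restr_smul]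
    exact congrArg _ (hA s.unop x).symm
  · intro T g x
    exact (congrArg Fam.pt ((e T.unop).symm_apply_apply (Fam.smul g ((e T.unop).symm x)))).trans
      rfl
  · intro T x y h
    obtain ⟨g, hg, hu⟩ := Fam.existsUnique_smul hG hR ((e T.unop).symm x) ((e T.unop).symm y) h
    refine ⟨g, ?_, fun g' hg' => hu g' ?_⟩
    · exact (e T.unop).symm.injective (((e T.unop).symm_apply_apply _).trans hg)
    · exact ((e T.unop).symm_apply_apply _).symm.trans (congrArg (e T.unop).symm hg')
  · refine J.transitive hR _ fun {T} k hk => ?_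
    refine J.superset_covering ?_ (D.torsor k hk).locallyTrivial
    rintro T' g ⟨y, hy⟩
    obtain ⟨a, ha, -⟩ := Fam.exists_of_section k hk y
    refine ⟨e T' a, (congrArg Fam.pt ((e T').symm_apply_apply a)).trans (ha.trans ?_)⟩
    exact congrArg (· ≫ k) hy

/-- Every descent datum of torsors is effective. As equivariant maps are cartesian, the maps `i` to
the glued torsor exhibit the given torsors as its pullbacks. -/
lemma exists_descent [J.Subcanonical] (hG : Presieve.IsSheaf J (groupSet G)) (hR : R ∈ J S)
    (D : TorsorDatum J G R) :
    ∃ (P : Torsor J G S) (i : ∀ {T : C} (k : T ⟶ S) (hk : R k), (D.torsor k hk).psh ⟶ P.psh),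
      (∀ {T : C} (k : T ⟶ S) (hk : R k), IsTorsorMap (D.torsor k hk) P k (i k hk)) ∧
      ∀ {T T' U : C} (k : T ⟶ S) (hk : R k) (k' : T' ⟶ S) (hk' : R k') (g : T' ⟶ T)
        (e : g ≫ k = k') (x : (D.torsor k' hk').psh.obj (op U)),
        (i k hk).app _ ((D.tr (hk := hk) g e).app _ x) = (i k' hk').app _ x := by
  obtain ⟨P, e, he, hpr, hsmul⟩ := D.exists_torsor hG hR
  have hex {T : C} (k : T ⟶ S) (hk : R k) {U : C} (y : (D.torsor k hk).psh.obj (op U)) :=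
    Fam.exists_of_section k hk y
  choose a ha has using @hex
  have hext {T U : C} (k : T ⟶ S) (hk : R k) (y : (D.torsor k hk).psh.obj (op U)) (b : D.Fam U)
      (hb : b.pt = (D.torsor k hk).pr y ≫ k)
      (hbs : ∀ h, b.sec (𝟙 U) k hk ((D.torsor k hk).pr y) h = y) : a k hk y = b := by
    have h1 := (Category.id_comp _).trans (ha k hk y)
    have h2 := (Category.id_comp _).trans hb
    exact Fam.ext_of_sec ((ha k hk y).trans hb.symm) k hk _ h1 h2
      ((has k hk y h1).trans (hbs h2).symm)
  let i {T : C} (k : T ⟶ S) (hk : R k) : (D.torsor k hk).psh ⟶ P.psh :=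
    { app := fun U => ↾fun y => e.symm (a k hk (U := U.unop) y)
      naturality := fun U U' s => ConcreteCategory.hom_ext (C := Type v) _ _ fun y => by
        refine (e (T := U'.unop)).injective (((e (T := U'.unop)).apply_symm_apply _).trans ?_)
        refine Eq.trans ?_ (he (T := U.unop) s.unop (e.symm (a k hk (U := U.unop) y))).symm
        rw [Equiv.apply_symm_apply]
        refine hext (U := U'.unop) k hk _ _ ?_ fun h => ?_
        · change s.unop ≫ (a k hk (U := U.unop) y).pt = _
          rw [ha]
          exact (Category.assoc _ _ _).symm.trans
            (congrArg (· ≫ k) ((D.torsor k hk).pr_map s.unop y).symm)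
        · have h1 := (Category.id_comp _).trans (ha k hk (U := U.unop) y)
          have h2 := (D.torsor k hk).pr_map (S := U.unop) s.unop y
          refine Eq.trans ?_ (congrArg ((D.torsor k hk).psh.map s.unop.op ·)
            (has k hk (U := U.unop) y h1))
          exact ((a k hk (U := U.unop) y).map_sec _ _ _ _ _ s.unop _
            ((Category.comp_id _).trans (Category.id_comp _).symm) _ h2.symm _).symm }
  have hi {T U : C} (k : T ⟶ S) (hk : R k) (y : (D.torsor k hk).psh.obj (op U)) :
      e ((i k hk).app _ y) = a k hk y := e.apply_symm_apply _
  refine ⟨P, fun k hk => i k hk, fun {T} k hk => ⟨fun {U} y => ?_, fun {U} h y => ?_⟩, ?_⟩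
  · rw [hpr, hi, ha]
  · refine e.injective ?_
    rw [hi, hsmul, hi]
    refine hext _ _ _ _ ((ha k hk y).trans (by rw [Torsor.pr_smul])) fun h' => ?_
    have h1 := (Category.id_comp _).trans (ha k hk y)
    have h2 : (D.torsor k hk).smul (G.map (𝟙 U : U ⟶ U).op h)
        ((a k hk y).sec (𝟙 U) k hk ((D.torsor k hk).pr y) h1) = (D.torsor k hk).smul h y :=
      congrArg₂ (D.torsor k hk).smul (Functor.map_id_apply (groupSet G) _ h) (has k hk y h1)
    refine Eq.trans ?_ h2
    exact congrArg ((D.torsor k hk).smul _ ·)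
      ((a k hk y).sec_congr rfl k hk (Torsor.pr_smul _ _ _) _ _)
  · intro T T' U k hk k' hk' g h x
    refine e.injective ?_
    have hp := (D.isTorsorMap (hk := hk) (hk' := hk') g h).pr_apply x
    have h1 := (Category.id_comp _).trans (ha k' hk' x)
    rw [hi, hi]
    refine hext _ _ _ _ ((ha k' hk' x).trans (by rw [hp, Category.assoc, h])) fun h' => ?_
    exact ((a k' hk' x).tr_sec _ k hk k' hk' _ h1 g h _ hp.symm _).symm.trans
      (congrArg _ (has k' hk' x h1))

end TorsorDatum

end Glued

/-! ### The stack of torsors over a stack -/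

section UnparDescent

variable {J : GrothendieckTopology C} {G : Cᵒᵖ ⥤ GrpCat.{v}} {𝒳 : BasedCategory.{v₂, u₂} C}

lemma Probe.Hom.at_comp_map_congr {A B : Probe 𝒳} {α α' : A ⟶ B} (hα : α = α') {T U : C}
    (x : A.psh.obj (op T)) {z z' : B.psh.obj (op T)} (e : α.u.app _ x = z) (e' : α'.u.app _ x = z')
    {w : B.psh.obj (op U)} {g g' : T ⟶ U} (hg : g = g') (h : B.psh.map g.op w = z)
    (h' : B.psh.map g'.op w = z') :
    Probe.Hom.at α x z e ≫ B.map.map (eltHom g h) =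
      Probe.Hom.at α' x z' e' ≫ B.map.map (eltHom g' h') := by
  subst hα e e' hg; rfl

lemma Probe.Hom.at_map_comp_at {A B B' : Probe 𝒳} (α : A ⟶ B) (β : B ⟶ B') {T U : C}
    (x : A.psh.obj (op T)) {y : B.psh.obj (op U)} {y' : B.psh.obj (op T)} {z : B'.psh.obj (op U)}
    {z' : B'.psh.obj (op T)} (e : α.u.app _ x = y') (g : T ⟶ U) (h : B.psh.map g.op y = y')
    (e' : β.u.app _ y = z) (h' : B'.psh.map g.op z = z') (e'' : (α ≫ β).u.app _ x = z') :
    (Probe.Hom.at α x y' e ≫ B.map.map (eltHom g h)) ≫ Probe.Hom.at β y z e' =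
      Probe.Hom.at (α ≫ β) x z' e'' ≫ B'.map.map (eltHom g h') := by
  have e₁ : β.u.app _ y' = z' := (congrArg (β.u.app _ ·) e).symm.trans e''
  rw [Category.assoc, Probe.Hom.at_nat β e' e₁ g h h', Probe.Hom.at_comp α β x y' z' e e₁ e'',
    Category.assoc]

/-- A torsor over `T`, regarded as a torsor over an object equal to `T`. Its underlying sheaf is
unchanged, so that equivariant maps need not be transported: the objects of a descent datum of the
fibered category lie over the objects of the sieve only up to propositional equality. -/
def Torsor.cast {T T' : C} (P : Torsor J G T) (h : T = T') : Torsor J G T' where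
  psh := P.psh
  isSheaf := P.isSheaf
  proj := P.proj ≫ yoneda.map (eqToHom h)
  smul := P.smul
  one_smul := P.one_smul
  mul_smul := P.mul_smul
  map_smul := P.map_smul
  proj_smul g x := congrArg (· ≫ eqToHom h) (P.proj_smul g x)
  simplyTransitive x y e := P.simplyTransitive x y ((cancel_mono (eqToHom h)).1 e)
  locallyTrivial := by
    subst h
    have : P.proj ≫ yoneda.map (eqToHom rfl) = P.proj := by simp
    rw [this]
    exact P.locallyTrivial

variable {S : C} {R : Sieve S}

/-- The value of a descent datum at an arrow of the sieve. -/
def unparDatumObj (D : elts R.functor ⥤ᵇ unparStack J G 𝒳) {T : C} (k : T ⟶ S) (hk : R k) :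
    UnparObj J G 𝒳 :=
  D.obj (elt (⟨k, hk⟩ : R.functor.obj (op T)))

/-- The transition arrow of a descent datum. -/
def unparDatumMap (D : elts R.functor ⥤ᵇ unparStack J G 𝒳) {T T' : C} {k : T ⟶ S} {hk : R k}
    {k' : T' ⟶ S} {hk' : R k'} (g : T' ⟶ T) (e : g ≫ k = k') :
    unparDatumObj D k' hk' ⟶ unparDatumObj D k hk :=
  D.map (eltHom (A := R.functor) (x := ⟨k, hk⟩) (x' := ⟨k', hk'⟩) g (Subtype.ext e))

variable (D : elts R.functor ⥤ᵇ unparStack J G 𝒳)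

lemma unparDatumObj_base {T : C} (k : T ⟶ S) (hk : R k) : (unparDatumObj D k hk).base = T :=
  p_obj_elt D (⟨k, hk⟩ : R.functor.obj (op T))

lemma unparDatumMap_id {T : C} (k : T ⟶ S) (hk : R k) (e) :
    unparDatumMap D (hk := hk) (hk' := hk) (𝟙 T) e = 𝟙 (unparDatumObj D k hk) :=
  map_eltHom_id D _ _

lemma unparDatumMap_comp {T T' T'' : C} {k : T ⟶ S} {hk : R k} {k' : T' ⟶ S} {hk' : R k'}
    {k'' : T'' ⟶ S} {hk'' : R k''} (g : T' ⟶ T) (e : g ≫ k = k') (g' : T'' ⟶ T')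
    (e' : g' ≫ k' = k'') (g'' : T'' ⟶ T) (hg : g' ≫ g = g'') (e'' : g'' ≫ k = k'') :
    unparDatumMap D (hk := hk') (hk' := hk'') g' e' ≫ unparDatumMap D (hk := hk) g e =
      unparDatumMap D g'' e'' := by
  subst hg
  exact (map_eltHom_comp D _ _ _ _ _).symm

lemma unparDatumMap_base {T T' : C} {k : T ⟶ S} {hk : R k} {k' : T' ⟶ S} {hk' : R k'}
    (g : T' ⟶ T) (e : g ≫ k = k') :
    UnparObj.Hom.base (unparDatumMap D (hk := hk) (hk' := hk') g e) ≫
      eqToHom (unparDatumObj_base D k hk) = eqToHom (unparDatumObj_base D k' hk') ≫ g := by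
  have : (unparStack J G 𝒳).p.IsHomLift g (unparDatumMap D (hk := hk) (hk' := hk') g e) :=
    map_eltHom_isHomLift D (x := (⟨k, hk⟩ : R.functor.obj (op T)))
    (x' := (⟨k', hk'⟩ : R.functor.obj (op T'))) g (Subtype.ext e)
  exact IsHomLift.commSq (unparStack J G 𝒳).p g (unparDatumMap D (hk := hk) (hk' := hk') g e) |>.w

/-- The torsors of a descent datum of torsors over `𝒳`. -/
def unparTorsorDatum : TorsorDatum J G R where
  torsor k hk := (unparDatumObj D k hk).torsor.cast (unparDatumObj_base D k hk)
  tr g e := (UnparObj.Hom.hom (unparDatumMap D g e)).u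
  isTorsorMap {T T' k hk k' hk'} g e := by
    refine ⟨fun {U} x => ?_, fun h x =>
      (UnparObj.Hom.isTorsorMap (unparDatumMap D g e)).smul_apply h x⟩
    have h1 := (UnparObj.Hom.isTorsorMap (unparDatumMap D (hk := hk) (hk' := hk') g e)).pr_apply x
    refine (congrArg (· ≫ eqToHom (unparDatumObj_base D k hk)) h1).trans ?_
    refine (Category.assoc _ _ _).trans ((congrArg (_ ≫ ·) (unparDatumMap_base D g e)).trans ?_)
    exact (Category.assoc _ _ _).symm
  tr_tr {_ _ _ _ _ _ _ _ _} g e g' e' g'' hg e'' {U} x := congrArg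
    (fun m : unparDatumObj D _ _ ⟶ unparDatumObj D _ _ => (UnparObj.Hom.hom m).u.app (op U) x)
    (unparDatumMap_comp D g e g' e' g'' hg e'')

/-- Every descent datum of torsors over a stack is effective. -/
lemma unparStack_exists_obj [J.Subcanonical] (hG : Presieve.IsSheaf J (groupSet G))
    (h𝒳 : IsStack J 𝒳) (hR : R ∈ J S) :
    ∃ (a : UnparObj J G 𝒳)
      (i : ∀ {T : C} (k : T ⟶ S) (hk : R k), unparDatumObj D k hk ⟶ a) (ha : a.base = S),
      (∀ {T : C} (k : T ⟶ S) (hk : R k), UnparObj.Hom.base (i k hk) ≫ eqToHom ha =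
        eqToHom (unparDatumObj_base D k hk) ≫ k) ∧
      ∀ {T T' : C} (k : T ⟶ S) (hk : R k) (k' : T' ⟶ S) (hk' : R k') (g : T' ⟶ T)
        (e : g ≫ k = k'), unparDatumMap D (hk := hk) (hk' := hk') g e ≫ i k hk = i k' hk' := by
  let E := unparTorsorDatum D
  let X {T : C} (k : T ⟶ S) (hk : R k) := unparDatumObj D k hk
  let M {T T' : C} {k : T ⟶ S} (hk : R k) {k' : T' ⟶ S} (hk' : R k') (g : T' ⟶ T)
    (e : g ≫ k = k') : (X k' hk').probe ⟶ (X k hk).probe := UnparObj.Hom.hom (unparDatumMap D g e)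
  have hMM {T T' T'' : C} {k : T ⟶ S} (hk : R k) {k' : T' ⟶ S} (hk' : R k')
      {k'' : T'' ⟶ S} (hk'' : R k'') (g : T' ⟶ T) (e : g ≫ k = k') (g' : T'' ⟶ T')
      (e' : g' ≫ k' = k'') (g'' : T'' ⟶ T) (hg : g' ≫ g = g'') (e'' : g'' ≫ k = k'') :
      M hk' hk'' g' e' ≫ M hk hk' g e = M hk hk'' g'' e'' :=
    congrArg (fun m : X k'' hk'' ⟶ X k hk => UnparObj.Hom.hom m)
      (unparDatumMap_comp D g e g' e' g'' hg e'')
  obtain ⟨P, i, hi, hitr⟩ := E.exists_descent hG hR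
  -- a section `p` of `P` over `t ∈ R` is the image of a section of the torsor given at `t`
  have hex {T : C} (p : P.psh.obj (op T)) (hp : R (P.pr p)) :=
    (hi (P.pr p) hp).existsUnique p (𝟙 T) (Category.id_comp _).symm
  choose y hy _ using @hex
  have hMy {T T' : C} (p : P.psh.obj (op T)) (hp : R (P.pr p)) {k : T' ⟶ S} (hk : R k)
      (r : T ⟶ T') (e : r ≫ k = P.pr p) (x : (X k hk).torsor.psh.obj (op T))
      (hx : (E.torsor k hk).pr x = r) (hxp : (i k hk).app _ x = p) :
      (M hk hp r e).u.app _ (y p hp) = x := by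
    refine (hi k hk).eq_of_apply_eq ?_ ((hitr k hk _ hp r e (y p hp)).trans
      ((hy p hp).2.trans hxp.symm))
    refine ((E.isTorsorMap (hk := hk) (hk' := hp) r e).pr_apply (y p hp)).trans ?_
    rw [(hy p hp).1, Category.id_comp, hx]
  have hyg {T T' : C} (p : P.psh.obj (op T)) (hp : R (P.pr p)) (p' : P.psh.obj (op T'))
      (hp' : R (P.pr p')) (g : T' ⟶ T) (e : g ≫ P.pr p = P.pr p') (h : P.psh.map g.op p = p') :
      (M hp hp' g e).u.app _ (y p' hp') = (X _ hp).torsor.psh.map g.op (y p hp) := by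
    refine hMy p' hp' hp g e _ ?_ ?_
    · refine ((E.torsor _ hp).pr_map g (y p hp)).trans ?_
      rw [(hy p hp).1, Category.comp_id]
    · refine (psh_nat (i _ hp) g (y p hp)).trans ?_
      rw [(hy p hp).2, h]
  have hpr {T T' : C} {p : P.psh.obj (op T)} {p' : P.psh.obj (op T')} (g : T' ⟶ T)
      (h : P.psh.map g.op p = p') : g ≫ P.pr p = P.pr p' := by rw [← h, P.pr_map]
  let N {T T' : C} (p : P.psh.obj (op T)) (hp : R (P.pr p)) (p' : P.psh.obj (op T'))
      (hp' : R (P.pr p')) (g : T' ⟶ T) (h : P.psh.map g.op p = p') :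
      (X _ hp').map.obj (elt (y p' hp')) ⟶ (X _ hp).map.obj (elt (y p hp)) :=
    Probe.Hom.at (M hp hp' g (hpr g h)) (y p' hp') _ (hyg p hp p' hp' g (hpr g h) h) ≫
      (X _ hp).map.map (eltHom g rfl)
  -- the given morphisms to `𝒳` define a morphism from the part of `P` over `R` to `𝒳`
  let χ : elts (P.over R).toFunctor ⥤ᵇ 𝒳 := mkEltsFunctor
    (fun p => (X _ p.2).map.obj (elt (y p.1 p.2)))
    (fun {T T' p p'} g h => N p.1 p.2 p'.1 p'.2 g (congrArg Subtype.val h))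
    (fun {T T' p p'} g h => isHomLift_id_comp (Probe.Hom.at_isHomLift _ _ _ _)
      (map_eltHom_isHomLift _ _ _))
    (fun {T} p h => by
      refine (Probe.Hom.at_comp_map_congr (B := (X _ p.2).probe)
        (congrArg (fun m : X _ p.2 ⟶ X _ p.2 => UnparObj.Hom.hom m)
          (unparDatumMap_id D (P.pr p.1) p.2 _)) (y p.1 p.2) _ rfl rfl _
        (psh_map_id _ _)).trans ?_
      exact (congrArg₂ (· ≫ ·) (Probe.Hom.at_id (A := (X _ p.2).probe) (y p.1 p.2))
        (map_eltHom_id (X _ p.2).map _ (psh_map_id _ _))).trans (Category.comp_id _))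
    (fun {T T' T'' p p' p''} g h g' h' h'' => by
      have hg := hpr g (congrArg Subtype.val h)
      have hg' := hpr g' (congrArg Subtype.val h')
      have hg'' := hpr (g' ≫ g) (congrArg Subtype.val h'')
      have hM := hMM p.2 p'.2 p''.2 g hg g' hg' (g' ≫ g) rfl hg''
      have e₁ := psh_map_map (X _ p.2).torsor.psh g g' (y p.1 p.2)
      have e₂ := (hyg p.1 p.2 p''.1 p''.2 (g' ≫ g) hg'' (congrArg Subtype.val h'')).trans e₁.symm
      have e₃ := (congrArg (fun m : (X _ p''.2).probe ⟶ (X _ p.2).probe =>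
        m.u.app _ (y p''.1 p''.2)) hM).trans e₂
      have h1 := Probe.Hom.at_map_comp_at (M p'.2 p''.2 g' hg') (M p.2 p'.2 g hg) (y p''.1 p''.2)
        (hyg p'.1 p'.2 p''.1 p''.2 g' hg' (congrArg Subtype.val h')) g' rfl
        (hyg p.1 p.2 p'.1 p'.2 g hg (congrArg Subtype.val h)) rfl e₃
      refine Eq.symm ((Category.assoc _ _ _).symm.trans ((congrArg (· ≫ _) h1).trans
        ((Category.assoc _ _ _).trans ((congrArg (_ ≫ ·)
          (map_eltHom_comp (X _ p.2).map g rfl g' rfl e₁.symm).symm).trans ?_))))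
      exact Probe.Hom.at_comp_map_congr hM _ _ _ rfl _ _)
  obtain ⟨χ', ⟨α⟩⟩ := exists_extension_of_covering h𝒳 (P.over_covering hR) χ
  let iR {T : C} (k : T ⟶ S) (hk : R k) : (X k hk).torsor.psh ⟶ (P.over R).toFunctor :=
    { app := fun U => ↾fun x => ⟨(i k hk).app U x, by
        change R (P.pr (S := U.unop) ((i k hk).app (op U.unop) x))
        rw [(hi k hk).pr_apply (S := U.unop) x]
        exact R.downward_closed hk _⟩
      naturality := fun U U' s => ConcreteCategory.hom_ext (C := Type v) _ _ fun x =>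
        Subtype.ext (psh_nat (i k hk) s.unop x) }
  -- over the part given at `k`, this morphism is isomorphic to the given one
  let β {T : C} (k : T ⟶ S) (hk : R k) : (eltsMap (iR k hk)).comp χ ⟶ (X k hk).map :=
    mkEltsNatTrans
      (fun {U} x => Probe.Hom.at (M hk ((iR k hk).app (op U) x).2 ((E.torsor k hk).pr x)
          ((hi k hk).pr_apply x).symm) (y _ ((iR k hk).app (op U) x).2) x
          (hMy _ ((iR k hk).app (op U) x).2 hk _ _ x rfl rfl))
      (fun x => Probe.Hom.at_isHomLift _ _ _ _)
      (fun {U U' x x'} g h => by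
        have hx := ((hi k hk).pr_apply x).symm
        have hx' := ((hi k hk).pr_apply x').symm
        have hg := hpr (p := ((iR k hk).app (op U) x).1) (p' := ((iR k hk).app (op U') x').1) g
          ((psh_nat (i k hk) g x).symm.trans (congrArg ((i k hk).app _ ·) h))
        have hr : g ≫ (E.torsor k hk).pr x = (E.torsor k hk).pr x' := by
          rw [← h]; exact ((E.torsor k hk).pr_map g x).symm
        have hM := hMM hk ((iR k hk).app (op U) x).2 ((iR k hk).app (op U') x').2 _ hx g hg _ hr hx'
        have e₂ := hMy _ ((iR k hk).app (op U') x').2 hk _ hx' x' rfl rfl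
        have e₃ := (congrArg (fun m : (X _ ((iR k hk).app (op U') x').2).probe ⟶ (X k hk).probe =>
          m.u.app _ (y _ ((iR k hk).app (op U') x').2)) hM).trans e₂
        refine (Probe.Hom.at_map_comp_at _ _ _ _ g _ _ h e₃).trans ?_
        exact Probe.Hom.at_comp_map_congr hM _ _ _ rfl _ _)
  have hβ {T : C} (k : T ⟶ S) (hk : R k) : IsIso (β k hk) :=
    isIso_basedNatTrans h𝒳.fibered (β k hk)
  let γ {T : C} (k : T ⟶ S) (hk : R k) : (X k hk).map ⟶ (eltsMap (i k hk)).comp χ' :=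
    have := hβ k hk
    inv (β k hk) ≫ BasedCategory.whiskerLeft (eltsMap (iR k hk)) α.hom
  have hγ {T : C} (k : T ⟶ S) (hk : R k) : β k hk ≫ γ k hk =
      BasedCategory.whiskerLeft (eltsMap (iR k hk)) α.hom := by
    have := hβ k hk
    exact IsIso.hom_inv_id_assoc (β k hk) _
  let Q : Probe 𝒳 := ⟨P.psh, χ'⟩
  let l {T : C} (k : T ⟶ S) (hk : R k) : (X k hk).probe ⟶ Q := ⟨i k hk, γ k hk⟩
  -- the 2-morphism of the leg is determined by its composition with `β`, which is `α`
  have hl {T T' : C} (k : T' ⟶ S) (hk : R k) (p : P.psh.obj (op T)) (hp : R (P.pr p)) (r : T ⟶ T')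
      (e : r ≫ k = P.pr p) (x : (X k hk).torsor.psh.obj (op T)) (hx : (E.torsor k hk).pr x = r)
      (hxp : (i k hk).app _ x = p) :
      Probe.Hom.at (M hk hp r e) (y p hp) x (hMy p hp hk r e x hx hxp) ≫
        Probe.Hom.at (l k hk) x p hxp =
      α.hom.toNatTrans.app (elt (⟨p, hp⟩ : (P.over R).toFunctor.obj (op T))) := by
    subst hx hxp
    refine (congrArg (_ ≫ ·) (Probe.Hom.at_rfl (l k hk) x)).trans ?_
    exact congrArg (fun m : (eltsMap (iR k hk)).comp χ ⟶ _ => m.toNatTrans.app (elt x)) (hγ k hk)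
  refine ⟨⟨S, P, χ'⟩, fun {T} k hk => UnparObj.homMk
    (eqToHom (unparDatumObj_base D k hk) ≫ k) (l k hk) ⟨fun x => ?_, (hi k hk).smul_apply⟩, rfl,
    fun k hk => Category.comp_id _, fun {T T'} k hk k' hk' g e => UnparObj.Hom.ext ?_
      (Probe.hom_ext_of_at (fun z => hitr k hk k' hk' g e z) fun {U} z p e₁ e₂ => ?_)⟩
  · exact ((hi k hk).pr_apply x).trans (Category.assoc _ _ _)
  · exact (Category.assoc _ _ _).symm.trans ((congrArg (· ≫ k) (unparDatumMap_base D g e)).trans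
      ((Category.assoc _ _ _).trans (congrArg (_ ≫ ·) e)))
  · have hz : P.pr p = (E.torsor k' hk').pr z ≫ k' :=
      (congrArg P.pr e₂.symm).trans ((hi k' hk').pr_apply z)
    have hp : R (P.pr p) := hz ▸ R.downward_closed hk' _
    let x := (M hk hk' g e).u.app _ z
    have hx : (E.torsor k hk).pr x = (E.torsor k' hk').pr z ≫ g :=
      (E.isTorsorMap (hk := hk) (hk' := hk') g e).pr_apply z
    have hx' : ((E.torsor k' hk').pr z ≫ g) ≫ k = P.pr p := by rw [hz, Category.assoc, e]
    have h1 := hl k' hk' p hp _ hz.symm z rfl e₂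
    have h2 := hl k hk p hp _ hx' x hx e₁
    have hM := hMM hk hk' hp g e _ hz.symm _ rfl hx'
    have e₃ := hMy p hp hk' _ hz.symm z rfl e₂
    have h3 := Probe.Hom.at_comp (M hk' hp _ hz.symm) (M hk hk' g e) (y p hp) z x e₃ rfl
      (congrArg ((M hk hk' g e).u.app _ ·) e₃)
    have h4 := Probe.Hom.at_congr hM (y p hp) x (congrArg ((M hk hk' g e).u.app _ ·) e₃)
      (hMy p hp hk _ hx' x hx e₁)
    have h5 := Probe.Hom.at_comp (M hk hk' g e) (l k hk) z x p rfl e₁ e₁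
    have hB := Probe.Hom.at_isHomLift (M hk' hp _ hz.symm) (y p hp) z e₃
    have hB' : IsIso (Probe.Hom.at (M hk' hp _ hz.symm) (y p hp) z e₃) :=
      isIso_of_isFiberedInGroupoids h𝒳.fibered (S := U) _
    refine (cancel_epi (Probe.Hom.at (M hk' hp _ hz.symm) (y p hp) z e₃)).1 (Eq.trans ?_ h1.symm)
    exact (congrArg (_ ≫ ·) h5).trans ((Category.assoc _ _ _).symm.trans
      ((congrArg (· ≫ _) (h3.symm.trans h4)).trans h2))

/-- Torsors over a stack form a stack. -/
lemma isStack_unparStack [J.Subcanonical] (hG : Presieve.IsSheaf J (groupSet G))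
    (h𝒳 : IsStack J 𝒳) : IsStack J (unparStack J G 𝒳) := by
  have hd : HasDescent J (unparStack J G 𝒳) :=
    { hom_ext := fun {a b} W hW m m' hm h => unparStack_hom_ext h𝒳 W hW m m' hm h
      exists_hom := fun {a b} f W hW m hm nat => unparStack_exists_hom h𝒳 f W hW m hm nat
      exists_obj := fun {S} R hR D => by
        obtain ⟨a, i, ha, hi, hc⟩ := unparStack_exists_obj D hG h𝒳 hR
        refine ⟨a, fun x => i x.1 x.2, ha, fun {T} x => ?_, fun {T T' x x'} g h =>
          hc x.1 x.2 x'.1 x'.2 g (congrArg Subtype.val h)⟩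
        refine IsHomLift.of_commSq (unparStack J G 𝒳).p x.1 (i x.1 x.2)
          (unparDatumObj_base D x.1 x.2) ha ⟨hi x.1 x.2⟩ }
  exact hd.isStack (isFiberedInGroupoids_unparStack h𝒳.fibered)

end UnparDescent

/-! ### The comparison morphism -/

section Main

variable {J : GrothendieckTopology C} {G : Cᵒᵖ ⥤ GrpCat.{v}} {𝒳 : BasedCategory.{v₂, u₂} C}

/-- The section `(1, id)` of the trivial torsor. -/
def unitSection (G : Cᵒᵖ ⥤ GrpCat.{v}) (T : C) : (trivPsh G T).obj (op T) :=
  ((1 : G.obj (op T)), 𝟙 T)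

lemma twist_unitSection {T T' : C} (g : G.obj (op T)) (t : T ⟶ T') :
    (twist G g t).app _ (unitSection G T) = (g, t) := by
  refine Prod.ext ?_ (Category.id_comp t)
  change (1 : G.obj (op T)) * G.map (𝟙 T : T ⟶ T).op g = g
  simp

lemma eq_smul_unitSection [J.Subcanonical] (hG : Presieve.IsSheaf J (groupSet G)) {S T : C}
    (x : (trivPsh G T).obj (op S)) :
    (trivTorsor J G hG T).smul x.1 ((trivPsh G T).map (Quiver.Hom.op x.2) (unitSection G T)) =
      x := by
  refine Prod.ext ?_ (Category.comp_id x.2)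
  change HMul.hMul (α := G.obj (op S)) x.1 (G.map (Quiver.Hom.op x.2) 1) = x.1
  rw [map_one, mul_one]

/-- Equivariant maps from a trivial torsor are determined by the image of the unit section. -/
lemma IsTorsorMap.eq_of_unitSection [J.Subcanonical] {hG : Presieve.IsSheaf J (groupSet G)}
    {T T' : C} {P : Torsor J G T'} {t t' : T ⟶ T'} {u u' : trivPsh G T ⟶ P.psh}
    (hu : IsTorsorMap (trivTorsor J G hG T) P t u) (hu' : IsTorsorMap (trivTorsor J G hG T) P t' u')
    (h : u.app _ (unitSection G T) = u'.app _ (unitSection G T)) : u = u' := by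
  refine psh_hom_ext fun S x => ?_
  have key {w : trivPsh G T ⟶ P.psh} {s : T ⟶ T'} (hw : IsTorsorMap (trivTorsor J G hG T) P s w) :
      w.app S x = P.smul x.1 (P.psh.map (Quiver.Hom.op x.2) (w.app _ (unitSection G T))) :=
    (congrArg (w.app S ·) (eq_smul_unitSection (S := S.unop) hG x)).symm.trans
      ((hw.smul_apply (S := S.unop) x.1 _).trans (congrArg (P.smul x.1 ·)
        (psh_nat w (T' := S.unop) x.2 (unitSection G T))))
  rw [key hu, key hu', h]

variable [J.Subcanonical] (hG : Presieve.IsSheaf J (groupSet G))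

lemma isTorsorMap_twist {T T' : C} (g : G.obj (op T)) (t : T ⟶ T') :
    IsTorsorMap (trivTorsor J G hG T) (trivTorsor J G hG T') t (twist G g t) :=
  ⟨fun _ => rfl, fun {S} _ _ => Prod.ext (mul_assoc (G := G.obj (op S)) _ _ _) rfl⟩

lemma quotToUnpar_faithful : (quotToUnpar J G hG 𝒳).Faithful where
  map_injective {X X' φ ψ} h := by
    have hb : QuotObj.Hom.base φ = QuotObj.Hom.base ψ :=
      congrArg (fun m : (quotToUnpar J G hG 𝒳).obj X ⟶ (quotToUnpar J G hG 𝒳).obj X' =>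
        UnparObj.Hom.base m) h
    have hh : QuotObj.Hom.hom φ = QuotObj.Hom.hom ψ :=
      congrArg (fun m : (quotToUnpar J G hG 𝒳).obj X ⟶ (quotToUnpar J G hG 𝒳).obj X' =>
        UnparObj.Hom.hom m) h
    have hu : twist G (QuotObj.Hom.elt φ) (QuotObj.Hom.base φ) =
        twist G (QuotObj.Hom.elt ψ) (QuotObj.Hom.base ψ) := by
      rw [← QuotObj.Hom.hom_u φ, hh, QuotObj.Hom.hom_u ψ]
    refine QuotObj.Hom.ext hb (congrArg Prod.fst ((twist_unitSection _ _).symm.trans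
      ((congrArg (fun u : trivPsh G X.pt.base ⟶ trivPsh G X'.pt.base =>
        u.app _ (unitSection G _)) hu).trans
        (twist_unitSection _ _)))) hh

lemma quotToUnpar_full : (quotToUnpar J G hG 𝒳).Full where
  map_surjective {X X'} m := by
    have hm := UnparObj.Hom.isTorsorMap m
    let w : (trivPsh G X'.pt.base).obj (op X.pt.base) :=
      (UnparObj.Hom.hom m).u.app _ (unitSection G X.pt.base)
    have hw : w.2 = UnparObj.Hom.base m :=
      (hm.pr_apply (unitSection G X.pt.base)).trans (Category.id_comp _)
    have hu : (UnparObj.Hom.hom m).u = twist G w.1 (UnparObj.Hom.base m) :=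
      hm.eq_of_unitSection (isTorsorMap_twist hG w.1 (UnparObj.Hom.base m))
        ((Prod.ext rfl hw : w = (w.1, UnparObj.Hom.base m)).trans (twist_unitSection _ _).symm)
    exact ⟨QuotObj.Hom.mk (UnparObj.Hom.base m) w.1 (UnparObj.Hom.hom m) hu, rfl⟩

/-- Every object over `T` is in the image of `⌊G\Map(G, 𝒳)⌋` over the covering sieve of the arrows
along which its torsor has a section: a section identifies the torsor with a trivial one. -/
lemma quotToUnpar_exists_lift (z : UnparObj J G 𝒳) {T : C} (k : T ⟶ z.base)
    (hk : Sieve.sieveOfSubfunctor z.torsor.proj k) :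
    ∃ (y : QuotObj G 𝒳) (α : (quotToUnpar J G hG 𝒳).obj y ⟶ z),
      (unparStack J G 𝒳).p.IsHomLift k α := by
  obtain ⟨x, hx⟩ := hk
  let o : trivPsh G T ⟶ z.torsor.psh :=
    { app := fun S => ↾fun a => z.torsor.smul a.1 (z.torsor.psh.map (Quiver.Hom.op a.2) x)
      naturality := fun S S' s => ConcreteCategory.hom_ext (C := Type v) _ _ fun a => by
        refine Eq.trans ?_ (z.torsor.map_smul s a.1 _).symm
        exact congrArg (z.torsor.smul _ ·) (psh_map_map z.torsor.psh a.2 s.unop x).symm }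
  have ho : IsTorsorMap (trivTorsor J G hG T) z.torsor k o :=
    ⟨fun a => (z.torsor.pr_smul _ _).trans ((z.torsor.pr_map _ _).trans (congrArg (_ ≫ ·) hx)),
      fun _ _ => z.torsor.mul_smul _ _ _⟩
  let y : QuotObj G 𝒳 := ⟨⟨T, (eltsMap o).comp z.map⟩⟩
  let α : (quotToUnpar J G hG 𝒳).obj y ⟶ z :=
    UnparObj.homMk (X := (quotToUnpar J G hG 𝒳).obj y) k ⟨o, 𝟙 _⟩ ho
  exact ⟨y, α, IsHomLift.map (p := (unparStack J G 𝒳).p) α⟩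

/-- The equivalence is the extension of `quotToUnpar` to the stackification; the quotient stack
satisfies descent because the torsors over `𝒳` do. -/
lemma exists_equivalence (h𝒳 : IsStack J 𝒳) :
    IsStack J (quotStack J G 𝒳) ∧ IsStack J (unparStack J G 𝒳) ∧
      ∃ (Φ : quotStack J G 𝒳 ⥤ᵇ unparStack J G 𝒳)
        (τ : (quotUnit J G h𝒳.fibered).comp Φ ≅ quotToUnpar J G hG 𝒳)
        (σ : (quotStackProj J G h𝒳.fibered).comp Φ ≅ mapToUnpar J G hG 𝒳),
        IsEquivalence Φ ∧
        σ.hom = BasedCategory.whiskerLeft (quotProj G 𝒳) τ.hom ∧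
        ∀ (Φ' : quotStack J G 𝒳 ⥤ᵇ unparStack J G 𝒳)
          (τ' : (quotUnit J G h𝒳.fibered).comp Φ' ≅ quotToUnpar J G hG 𝒳),
          ∃! θ : Φ ≅ Φ',
            BasedCategory.whiskerLeft (quotUnit J G h𝒳.fibered) θ.hom ≫ τ'.hom = τ.hom := by
  have hS := isStack_unparStack hG h𝒳
  have hQ := isFiberedInGroupoids_quotPrestack G h𝒳.fibered
  have := quotToUnpar_faithful (𝒳 := 𝒳) hG
  have := quotToUnpar_full (𝒳 := 𝒳) hG
  let Φ : quotStack J G 𝒳 ⥤ᵇ unparStack J G 𝒳 := extFunctor hS (quotToUnpar J G hG 𝒳)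
  have : Φ.Faithful := extFunctor_faithful hS (quotToUnpar J G hG 𝒳)
  have : Φ.Full := extFunctor_full hS (quotToUnpar J G hG 𝒳)
  have hex (z : UnparObj J G 𝒳) := extFunctor_exists_iso hS (quotToUnpar J G hG 𝒳) z
    (Sieve.sieveOfSubfunctor z.torsor.proj) z.torsor.locallyTrivial
    (fun k hk => quotToUnpar_exists_lift hG z k hk)
  obtain ⟨τ⟩ := nonempty_extFunctor_iso hS (quotToUnpar J G hG 𝒳) hQ
  let τ : (quotUnit J G h𝒳.fibered).comp Φ ≅ quotToUnpar J G hG 𝒳 := τ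
  let m : (quotStackProj J G h𝒳.fibered).comp Φ ⟶ mapToUnpar J G hG 𝒳 :=
    BasedCategory.whiskerLeft (quotProj G 𝒳) τ.hom
  have : IsIso m := isIso_basedNatTrans hS.fibered m
  exact ⟨isStack_of_fullyFaithful (F := Φ) hS hex, hS, Φ, τ, asIso m,
    isEquivalence_of_fullyFaithful (F := Φ) hS.fibered hex, rfl,
    fun Φ' τ' => existsUnique_iso_of_whiskerLeft hS hQ τ τ'⟩

end Main

end UnparametrizedTorsor

theorem propositionP :
    (∀ {C : Type u} [Category.{v} C] (J : GrothendieckTopology C) [J.Subcanonical]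
      (G : Cᵒᵖ ⥤ GrpCat.{v}) (hG : Presieve.IsSheaf J (groupSet G))
      (𝒳 : BasedCategory.{v₂, u₂} C) (h𝒳 : IsStack J 𝒳),
      IsStack J (quotStack J G 𝒳) ∧ IsStack J (unparStack J G 𝒳) ∧
      ∃ (Φ : quotStack J G 𝒳 ⥤ᵇ unparStack J G 𝒳)
        (τ : (quotUnit J G h𝒳.fibered).comp Φ ≅ quotToUnpar J G hG 𝒳)
        (σ : (quotStackProj J G h𝒳.fibered).comp Φ ≅ mapToUnpar J G hG 𝒳),
        IsEquivalence Φ ∧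
        σ.hom = BasedCategory.whiskerLeft (quotProj G 𝒳) τ.hom ∧
        ∀ (Φ' : quotStack J G 𝒳 ⥤ᵇ unparStack J G 𝒳)
          (τ' : (quotUnit J G h𝒳.fibered).comp Φ' ≅ quotToUnpar J G hG 𝒳),
          ∃! θ : Φ ≅ Φ',
            BasedCategory.whiskerLeft (quotUnit J G h𝒳.fibered) θ.hom ≫ τ'.hom = τ.hom) ∧
    (∀ (𝒳 : BasedCategory.{v₂, u₂} TopCat.{0}) (h𝒳 : IsStack TopCat.grothendieckTopology 𝒳),
      ∃ (Φ : circleQuotient 𝒳 ⥤ᵇ unparametrizedLoops 𝒳)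
        (τ : (quotUnit TopCat.grothendieckTopology circleGroup h𝒳.fibered).comp Φ ≅
          quotToUnpar TopCat.grothendieckTopology circleGroup isSheaf_circleGroup 𝒳)
        (σ : (loopStackProj h𝒳.fibered).comp Φ ≅ loopStackToUnparametrized 𝒳),
        IsEquivalence Φ ∧
        σ.hom = BasedCategory.whiskerLeft (quotProj circleGroup 𝒳) τ.hom ∧
        ∀ (Φ' : circleQuotient 𝒳 ⥤ᵇ unparametrizedLoops 𝒳)
          (τ' : (quotUnit TopCat.grothendieckTopology circleGroup h𝒳.fibered).comp Φ' ≅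
            quotToUnpar TopCat.grothendieckTopology circleGroup isSheaf_circleGroup 𝒳),
          ∃! θ : Φ ≅ Φ', BasedCategory.whiskerLeft
            (quotUnit TopCat.grothendieckTopology circleGroup h𝒳.fibered) θ.hom ≫ τ'.hom =
              τ.hom) :=
  ⟨fun _ _ _ hG _ h𝒳 => exists_equivalence hG h𝒳,
    fun _ h𝒳 => (exists_equivalence isSheaf_circleGroup h𝒳).2.2⟩
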